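/- **Feedback MAB.** There are $n$ arms. In every time slot arm $i$ is good or bad; independently of the other arms and of the plays it moves from bad to good with probability $\alpha_i\ge 0$ and from good to bad with probability $\beta_i\ge 0$, where $0<\alpha_i+\beta_i<1$. In every slot a policy plays at most one arm; a play of arm $i$ yields reward $r_i\ge 0$ if the arm is good and $0$ if it is bad, and reveals its current state. States of arms that are not played are not observed. Policies may be randomized and depend on all past plays and observations; the goal is to maximize the infinite-horizon average expected reward. An arm is in information state $(s,t)$, $s\in\{g,b\}$, $t\ge 1$, if it was last observed $t$ steps ago, in state $s$ ($g$ = good, $b$ = bad). Initially every arm is in some information state $(b,t)$, $t\ge1$, or $(g,1)$, with at most one arm in $(g,1)$. **Single-arm quantities.** Let $u_{it}$ (resp. $v_{it}$) be the probability that arm $i$ is good given that it was good (resp. bad) $t$ steps ago. For $\lambda\ge0$ let $H_i(\lambda)$ be the supremum of $\sum_{t\ge1}\bigl(r_ix_{gt}-\lambda(x_{gt}+x_{bt})\bigr)$ over all $x_{gt},x_{bt}\ge0$ with $\sum_{t\ge1}t(x_{gt}+x_{bt})\le1$ and $\sum_{t\ge1}x_{bt}v_{it}=\sum_{t\ge1}x_{gt}(1-u_{it})$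 (the optimal reward minus penalty of arm $i$, if each play costs $\lambda$). Let $\mathcal P_i(t)$ be the policy, started with arm $i$ in information state $(b,1)$, that plays only arm $i$: immediately after it was observed good, and $t$ steps after it was observed bad. Let $R_i(t)$ and $Q_i(t)$ be its long-run expected reward and number of plays per step. If $H_i(\lambda)>0$, let $t_i(\lambda)$ be any maximizer of $R_i(t)-\lambda Q_i(t)$ over the integers $t\ge1$. **BalancedIndex.** For $\varepsilon>0$ call $\lambda\ge0$ *$\varepsilon$-balanced* if, with $\lambda'=(1+\varepsilon/2)\lambda$, we have $\lambda\le\sum_iH_i(\lambda)$ and $\sum_iH_i(\lambda')\le\lambda'$. Given such a $\lambda$, let $S=\{i: H_i(\lambda)>0\}$ and $t_i=t_i(\lambda)$ for $i\in S$. In every slot the policy does the following, with ties broken in any way: (1) if some arm of $S$ is in information state $(g,1)$, it plays such an arm; (2) otherwise, if some arm $i\in S$ is *ready*, that is, in information state $(b,t)$ with $t\ge t_i$, it plays such an arm; (3) otherwise it plays no arm. **Theorem.** 1. For every instance and every $\varepsilon>0$, $\varepsilon$-balanced multipliers $\lambda$ and maximizers $t_i(\lambda)$, $i \in S$, exist.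 For every such choice and every initial information state as above, a BalancedIndex policy exists, and every BalancedIndex policy is a $(2+\varepsilon)$-approximation: if $A_T$ and $A'_T$ are the expected average rewards in the first $T$ slots of the BalancedIndex policy and of any other policy started in the same information state, then $\limsup_{T\to\infty}A'_T\le(2+\varepsilon)\,\liminf_{T\to\infty}A_T$. 2. The policy can be computed in polynomial time: there is an algorithm (a program for a random access machine with logarithmic cost) that, given $n$, rational $\alpha_i,\beta_i,r_i$ as above and a rational $\varepsilon>0$, outputs an $\varepsilon$-balanced rational $\lambda$, the set $S$ for it, and a maximizer $t_i(\lambda)$ for every $i\in S$, in time polynomial in the bit length of the input and $1/\varepsilon$. Moreover each step of the policy can be executed in polynomial time: given $n$, $S$, the numbers $t_i\ge1$ ($i\in S$), and the present information states of the arms, an action that rules (1)–(3) allow is computed in time polynomial in the bit length of these data. -/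

import Mathlib

open Filter Finset

noncomputable section

/-! ### The bandit problem -/

/-- An instance of Feedback MAB with `n` arms. In every time slot arm `i` is good (`true`) or bad
(`false`); independently of the plays and of the other arms it moves from bad to good with
probability `α i` and from good to bad with probability `β i`. A play of a good arm `i` yields
reward `r i`, a play of a bad arm yields `0`. For finitely many arms, burstiness
(`α i + β i ≤ 1 - δ` for some `δ > 0`) is the condition `α i + β i < 1`. -/
structure FeedbackMAB (n : ℕ) where
  α : Fin n → ℝ
  β : Fin n → ℝ
  r : Fin n → ℝ
  α_nonneg : ∀ i, 0 ≤ α i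
  β_nonneg : ∀ i, 0 ≤ β i
  add_pos : ∀ i, 0 < α i + β i
  bursty : ∀ i, α i + β i < 1
  r_nonneg : ∀ i, 0 ≤ r i

/-- The (hidden) joint state of the arms. -/
abbrev Hidden (n : ℕ) := Fin n → Bool

/-- The joint information state: `x i = (s, t)` says that arm `i` was last observed `t` steps ago,
and was then in state `s`. -/
abbrev Info (n : ℕ) := Fin n → Bool × ℕ

/-- What the player records in one slot: `none` if no arm is played, and `some (i, s)` if arm `i`
is played and seen in state `s`. -/
abbrev Event (n : ℕ) := Option (Fin n × Bool)

/-- The events of the past slots, the most recent one first. -/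
abbrev History (n : ℕ) := List (Event n)

/-- The information state in the next slot. -/
def Info.update {n : ℕ} (x : Info n) : Event n → Info n
  | none => fun j => ((x j).1, (x j).2 + 1)
  | some (i, s) => fun j => if j = i then (s, 1) else ((x j).1, (x j).2 + 1)

/-- The information state after the history `h`, for the initial information state `σ`. -/
def Info.after {n : ℕ} (σ : Info n) : History n → Info n
  | [] => σ
  | e :: h => (Info.after σ h).update e

/-- A history-dependent randomized policy: in each slot it plays at most one arm (`none` stands for
idling), with probabilities that depend on the past plays and observations. -/
structure Policy (n : ℕ) where
  prob : History n → Option (Fin n) → ℝ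
  nonneg : ∀ h a, 0 ≤ prob h a
  sum_eq_one : ∀ h, ∑ a, prob h a = 1

/-- The deterministic policy given by a function of the history. -/
def Policy.ofFun {n : ℕ} (f : History n → Option (Fin n)) : Policy n where
  prob h a := if a = f h then 1 else 0
  nonneg h a := by split_ifs <;> norm_num
  sum_eq_one h := by simp

/-- The probability of the state `s` if the good state has probability `q`. -/
def stateProb (q : ℝ) (s : Bool) : ℝ := if s then q else 1 - q

namespace FeedbackMAB

variable {n : ℕ} (M : FeedbackMAB n)

/-- If arm `i` is now good with probability `q`, this is the probability that it is good in the
next slot. -/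
def beliefStep (i : Fin n) (q : ℝ) : ℝ := (1 - q) * M.α i + q * (1 - M.β i)

/-- The probability that arm `i` is good, given that it was in state `s` exactly `t` steps ago:
`u_{it}` for `s = true` and `v_{it}` for `s = false`. -/
def goodProb (i : Fin n) (s : Bool) (t : ℕ) : ℝ := (M.beliefStep i)^[t] (if s then 1 else 0)

/-- The transition probabilities of the joint state; the arms are independent. -/
def trans (s s' : Hidden n) : ℝ := ∏ i, stateProb (M.goodProb i (s i) 1) (s' i)

/-- The law of the present joint state, given the information state `σ`. -/
def prior (σ : Info n) (s : Hidden n) : ℝ :=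
  ∏ i, stateProb (M.goodProb i (σ i).1 (σ i).2) (s i)

/-- The expected total payoff of the policy `π` in the next `T` slots, if the past history is `h`
and the present joint state is `s`, where the action `a` in joint state `s` pays `w s a`. -/
def expTotal (π : Policy n) (w : Hidden n → Option (Fin n) → ℝ) :
    ℕ → History n → Hidden n → ℝ
  | 0, _, _ => 0
  | T + 1, h, s => ∑ a, π.prob h a *
      (w s a + ∑ s', M.trans s s' *
        expTotal π w T (a.map (fun i => (i, s i)) :: h) s')

/-- The expected payoff per slot of `π` over the first `T` slots, from the information state `σ`. -/
def expAverage (σ : Info n) (π : Policy n) (w : Hidden n → Option (Fin n) → ℝ) (T : ℕ) : ℝ :=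
  (∑ s, M.prior σ s * M.expTotal π w T [] s) / T

/-- The payoff that is the reward of the slot. -/
def reward (s : Hidden n) : Option (Fin n) → ℝ
  | none => 0
  | some i => if s i then M.r i else 0

/-- The payoff that counts the plays. -/
def plays (_ : Hidden n) (a : Option (Fin n)) : ℝ := if a.isSome then 1 else 0

/-- The infinite-horizon average reward of `π`, as a lower limit. -/
def lowerReward (σ : Info n) (π : Policy n) : ℝ :=
  liminf (M.expAverage σ π M.reward) atTop

/-- The infinite-horizon average reward of `π`, as an upper limit. -/
def upperReward (σ : Info n) (π : Policy n) : ℝ :=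
  limsup (M.expAverage σ π M.reward) atTop

/-! ### Single-arm problems -/

/-- The information state in which every arm was just observed to be bad. -/
def allBad : Info n := fun _ => (false, 1)

/-- The policy that never plays an arm other than `i`; it plays arm `i` if it was just observed to
be good, and after an observation that it is bad waits `t - 1` steps and plays it. -/
def armPolicy (i : Fin n) (t : ℕ) : Policy n :=
  Policy.ofFun fun h =>
    if Info.after allBad h i = (true, 1) ∨
        ((Info.after allBad h i).1 = false ∧ t ≤ (Info.after allBad h i).2)
      then some i else none

/-- The expected per-step reward `R_i(t)` of `armPolicy i t` (the limit exists). -/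
def armReward (i : Fin n) (t : ℕ) : ℝ :=
  liminf (M.expAverage allBad (armPolicy i t) M.reward) atTop

/-- The expected rate of play `Q_i(t)` of `armPolicy i t` (the limit exists). -/
def armRate (i : Fin n) (t : ℕ) : ℝ :=
  liminf (M.expAverage allBad (armPolicy i t) plays) atTop

/-- The value `F_i(lam, t) = R_i(t) - lam * Q_i(t)` of `armPolicy i t` under penalty `lam`. -/
def armValue (i : Fin n) (lam : ℝ) (t : ℕ) : ℝ := M.armReward i t - lam * M.armRate i t

/-- Feasibility in the linear program of the single arm `i`; `x s k` is the rate of plays of the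
arm in information state `(s, t)` with `t = k + 1`. -/
structure ArmFeasible (i : Fin n) (x : Bool → ℕ → ℝ) : Prop where
  nonneg : ∀ s k, 0 ≤ x s k
  summable : ∀ s, Summable fun k : ℕ => ((k : ℝ) + 1) * x s k
  time_le : ∑ s, ∑' k : ℕ, ((k : ℝ) + 1) * x s k ≤ 1
  balance : ∑' k : ℕ, x false k * M.goodProb i false (k + 1) =
    ∑' k : ℕ, x true k * (1 - M.goodProb i true (k + 1))

/-- `H_i(lam)`: the optimal reward minus penalty of arm `i`, for a penalty `lam` per play. -/
def armOpt (i : Fin n) (lam : ℝ) : ℝ :=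
  sSup {c : ℝ | ∃ x, M.ArmFeasible i x ∧
    c = ∑' k : ℕ, (M.r i * x true k - lam * (x true k + x false k))}

/-! ### The balanced index policy -/

/-- `lam` balances `lam` and `∑ i, H_i(lam)` up to the factor `1 + η`. -/
def IsBalanced (η lam : ℝ) : Prop :=
  0 ≤ lam ∧ lam ≤ ∑ i, M.armOpt i lam ∧
    ∑ i, M.armOpt i ((1 + η) * lam) ≤ (1 + η) * lam

/-- `t` is `t_i(lam)`, a maximizer of `F_i(lam, ·)` over `t ≥ 1`, if `H_i(lam) > 0`; the value `0`
marks the arms with `H_i(lam) = 0`, which are never played. -/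
def IsThreshold (lam : ℝ) (i : Fin n) (t : ℕ) : Prop :=
  (0 < M.armOpt i lam ∧ 1 ≤ t ∧ ∀ t', 1 ≤ t' → M.armValue i lam t' ≤ M.armValue i lam t) ∨
    (M.armOpt i lam = 0 ∧ t = 0)

end FeedbackMAB

/-- Arm `i` is good: it was just observed in the good state. -/
def IsGood {n : ℕ} (x : Info n) (i : Fin n) : Prop := x i = (true, 1)

/-- Arm `i` is ready: it was last observed in the bad state, at least `t i` steps ago. -/
def IsReady {n : ℕ} (t : Fin n → ℕ) (x : Info n) (i : Fin n) : Prop :=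
  (x i).1 = false ∧ t i ≤ (x i).2

/-- The priority scheme in information state `x`, for the set `S` of arms and the thresholds `t`:
play any good arm of `S` (exploit); if there is none, play any ready arm of `S` (explore); if there
is none either, idle. -/
def IndexRule {n : ℕ} (S : Set (Fin n)) (t : Fin n → ℕ) (x : Info n) : Option (Fin n) → Prop
  | some i => i ∈ S ∧ (IsGood x i ∨ ((∀ j ∈ S, ¬ IsGood x j) ∧ IsReady t x i))
  | none => ∀ j ∈ S, ¬ IsGood x j ∧ ¬ IsReady t x j

/-- `π` is a BalancedIndex policy for the multiplier `lam` and the thresholds `t`, from the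
information state `σ`: in every slot it takes an action that the priority scheme allows for the
arms with `H_i(lam) > 0`. Ties may be broken in any way. -/
def FeedbackMAB.IsBalancedIndex {n : ℕ} (M : FeedbackMAB n) (lam : ℝ) (t : Fin n → ℕ)
    (σ : Info n) (π : Policy n) : Prop :=
  ∀ h a, 0 < π.prob h a → IndexRule {i | 0 < M.armOpt i lam} t (Info.after σ h) a

/-- The initial information states: every arm was last observed at least one step ago, every arm
last observed good was observed in the last slot, and there is at most one such arm. -/
def Info.IsInitial {n : ℕ} (σ : Info n) : Prop :=
  (∀ i, 1 ≤ (σ i).2) ∧ (∀ i, (σ i).1 = true → (σ i).2 = 1) ∧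
    ∀ i j, (σ i).1 = true → (σ j).1 = true → i = j

/-! ### Running times: random access machine programs at logarithmic cost -/

/-- The memory: arrays of integers, indexed by the natural numbers. -/
abbrev Mem := ℕ → ℕ → ℤ

/-- The number of bits of an integer, with its sign. -/
def bitLen (z : ℤ) : ℕ := z.natAbs.size + 1

/-- Arithmetic expressions; `get a e` is entry `e` of array `a`, and `div` is integer division. -/
inductive Expr where
  | const (z : ℤ)
  | get (a : ℕ) (e : Expr)
  | add (e f : Expr)
  | sub (e f : Expr)
  | mul (e f : Expr)
  | div (e f : Expr)

/-- The value of an expression. -/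
def Expr.eval (m : Mem) : Expr → ℤ
  | const z => z
  | get a e => m a (e.eval m).toNat
  | add e f => e.eval m + f.eval m
  | sub e f => e.eval m - f.eval m
  | mul e f => e.eval m * f.eval m
  | div e f => e.eval m / f.eval m

/-- The cost of an evaluation: every operation costs the number of bits of its operands, products
and quotients cost the product of these numbers. -/
def Expr.cost (m : Mem) : Expr → ℕ
  | const z => bitLen z
  | get a e => e.cost m + bitLen (e.eval m) + bitLen (m a (e.eval m).toNat)
  | add e f => e.cost m + f.cost m + bitLen (e.eval m) + bitLen (f.eval m)
  | sub e f => e.cost m + f.cost m + bitLen (e.eval m) + bitLen (f.eval m)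
  | mul e f => e.cost m + f.cost m + bitLen (e.eval m) * bitLen (f.eval m)
  | div e f => e.cost m + f.cost m + bitLen (e.eval m) * bitLen (f.eval m)

/-- Programs; `set a e f` stores the value of `f` in entry `e` of array `a`, and the tests of `ite`
and `loop` (a while loop) ask whether the value of an expression is positive. -/
inductive Prog where
  | skip
  | set (a : ℕ) (e f : Expr)
  | seq (p q : Prog)
  | ite (e : Expr) (p q : Prog)
  | loop (e : Expr) (p : Prog)

/-- The memory after `z` is stored in entry `k` of array `a`. -/
def Mem.store (m : Mem) (a k : ℕ) (z : ℤ) : Mem :=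
  fun b j => if b = a ∧ j = k then z else m b j

/-- `Exec p m c m'`: the program `p`, started with memory `m`, halts with memory `m'` at total
cost `c`. -/
inductive Exec : Prog → Mem → ℕ → Mem → Prop where
  | skip (m) : Exec .skip m 1 m
  | set (a e f m) : Exec (.set a e f) m
      (1 + e.cost m + f.cost m + bitLen (e.eval m) + bitLen (f.eval m))
      (m.store a (e.eval m).toNat (f.eval m))
  | seq {p q m m' m'' c c'} : Exec p m c m' → Exec q m' c' m'' →
      Exec (.seq p q) m (1 + c + c') m''
  | ite_pos {e p q m m' c} : 0 < e.eval m → Exec p m c m' →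
      Exec (.ite e p q) m (1 + e.cost m + c) m'
  | ite_neg {e p q m m' c} : ¬ 0 < e.eval m → Exec q m c m' →
      Exec (.ite e p q) m (1 + e.cost m + c) m'
  | loop_pos {e p m m' m'' c c'} : 0 < e.eval m → Exec p m c m' →
      Exec (.loop e p) m' c' m'' → Exec (.loop e p) m (1 + e.cost m + c + c') m''
  | loop_neg {e p m} : ¬ 0 < e.eval m → Exec (.loop e p) m (1 + e.cost m) m

/-- An array with the given first entries, continued by zeros. -/
def toArray {n : ℕ} (f : Fin n → ℤ) (j : ℕ) : ℤ := if h : j < n then f ⟨j, h⟩ else 0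

/-- The memory that holds the number of arms, the parameters of a rational instance, and `ε`. -/
def instanceMem {n : ℕ} (α β r : Fin n → ℚ) (ε : ℚ) : Mem
  | 0 => toArray ![(n : ℤ), ε.num, (ε.den : ℤ)]
  | 1 => toArray fun i => (α i).num
  | 2 => toArray fun i => ((α i).den : ℤ)
  | 3 => toArray fun i => (β i).num
  | 4 => toArray fun i => ((β i).den : ℤ)
  | 5 => toArray fun i => (r i).num
  | 6 => toArray fun i => ((r i).den : ℤ)
  | _ => fun _ => 0

/-- The number of bits of a rational number, written as a reduced fraction. -/
def ratLen (q : ℚ) : ℕ := bitLen q.num + bitLen (q.den : ℤ)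

/-- The number of bits of the input `instanceMem α β r ε`. -/
def instanceLen {n : ℕ} (α β r : Fin n → ℚ) (ε : ℚ) : ℕ :=
  bitLen (n : ℤ) + ratLen ε + ∑ i, (ratLen (α i) + ratLen (β i) + ratLen (r i))

/-- The memory that holds the number of arms, thresholds `t`, and an information state `x`. -/
def stepMem {n : ℕ} (t : Fin n → ℕ) (x : Info n) : Mem
  | 0 => toArray ![(n : ℤ)]
  | 1 => toArray fun i => (t i : ℤ)
  | 2 => toArray fun i => if (x i).1 then 1 else 0
  | 3 => toArray fun i => ((x i).2 : ℤ)
  | _ => fun _ => 0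

/-- The number of bits of the input `stepMem t x`. -/
def stepLen {n : ℕ} (t : Fin n → ℕ) (x : Info n) : ℕ :=
  bitLen (n : ℤ) + ∑ i, (bitLen (t i : ℤ) + 1 + bitLen ((x i).2 : ℤ))

/-- The code of an action: `0` for idling and `i + 1` for a play of arm `i` (`i = 0, …, n - 1`). -/
def actionCode {n : ℕ} : Option (Fin n) → ℤ
  | none => 0
  | some i => (i : ℤ) + 1

end

noncomputable section

/-! ### The problem of a single arm -/

namespace FeedbackMAB

variable {n : ℕ} (M : FeedbackMAB n) (i : Fin n)

/-- The mixing rate `α + β` of an arm. -/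
def mix : ℝ := M.α i + M.β i

lemma mix_pos : 0 < M.mix i := M.add_pos i
lemma mix_lt_one : M.mix i < 1 := M.bursty i

lemma goodProb_zero (s : Bool) : M.goodProb i s 0 = if s then 1 else 0 := rfl

lemma goodProb_succ (s : Bool) (t : ℕ) :
    M.goodProb i s (t + 1) = M.beliefStep i (M.goodProb i s t) := by
  simp only [goodProb, Function.iterate_succ_apply']

lemma mix_mul_goodProb_false (t : ℕ) :
    M.mix i * M.goodProb i false t = M.α i * (1 - (1 - M.mix i) ^ t) := by
  induction t with
  | zero => simp [goodProb_zero]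
  | succ t ih =>
    rw [goodProb_succ, beliefStep, pow_succ]
    have : M.mix i = M.α i + M.β i := rfl
    linear_combination (1 - M.α i - M.β i) * ih +
      M.α i * (1 - (1 - M.mix i) ^ t) * this

lemma mix_mul_one_sub_goodProb_true (t : ℕ) :
    M.mix i * (1 - M.goodProb i true t) = M.β i * (1 - (1 - M.mix i) ^ t) := by
  induction t with
  | zero => simp [goodProb_zero]
  | succ t ih =>
    rw [goodProb_succ, beliefStep, pow_succ]
    have : M.mix i = M.α i + M.β i := rfl
    linear_combination (1 - M.α i - M.β i) * ih +
      M.β i * (1 - (1 - M.mix i) ^ t) * this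

lemma α_le_mix : M.α i ≤ M.mix i := by have := M.β_nonneg i; unfold mix; linarith
lemma β_le_mix : M.β i ≤ M.mix i := by have := M.α_nonneg i; unfold mix; linarith

lemma decay_pow_nonneg (t : ℕ) : 0 ≤ (1 - M.mix i) ^ t :=
  pow_nonneg (by linarith [M.mix_lt_one i]) _

lemma decay_pow_le_one (t : ℕ) : (1 - M.mix i) ^ t ≤ 1 :=
  pow_le_one₀ (by linarith [M.mix_lt_one i]) (by linarith [M.mix_pos i])

lemma decay_pow_anti : Antitone fun t : ℕ => (1 - M.mix i) ^ t :=
  pow_right_anti₀ (by linarith [M.mix_lt_one i]) (by linarith [M.mix_pos i])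

lemma goodProb_mem (s : Bool) (t : ℕ) : M.goodProb i s t ∈ Set.Icc (0 : ℝ) 1 := by
  induction t with
  | zero => cases s <;> simp [goodProb_zero]
  | succ t ih =>
    rw [goodProb_succ, beliefStep]
    have h1 := M.α_nonneg i
    have h2 := M.β_nonneg i
    have h3 := M.bursty i
    obtain ⟨h4, h5⟩ := ih
    constructor <;> nlinarith

lemma goodProb_nonneg (s : Bool) (t : ℕ) : 0 ≤ M.goodProb i s t := (M.goodProb_mem i s t).1
lemma goodProb_le_one (s : Bool) (t : ℕ) : M.goodProb i s t ≤ 1 := (M.goodProb_mem i s t).2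

lemma goodProb_true_one : M.goodProb i true 1 = 1 - M.β i := by
  simp [goodProb, beliefStep]

lemma goodProb_false_one : M.goodProb i false 1 = M.α i := by
  simp [goodProb, beliefStep]

lemma goodProb_false_mono : Monotone (M.goodProb i false) := by
  intro s t h
  have h1 := M.decay_pow_anti i h
  have h2 := M.mix_mul_goodProb_false i s
  have h3 := M.mix_mul_goodProb_false i t
  have := M.mix_pos i
  have := M.α_nonneg i
  refine le_of_mul_le_mul_left ?_ (M.mix_pos i)
  rw [h2, h3]
  exact mul_le_mul_of_nonneg_left (sub_le_sub_left h1 1) this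

lemma β_le_one_sub_goodProb {t : ℕ} (ht : 1 ≤ t) : M.β i ≤ 1 - M.goodProb i true t := by
  have h1 := M.decay_pow_anti i ht
  have h3 := M.mix_mul_one_sub_goodProb_true i t
  refine le_of_mul_le_mul_left ?_ (M.mix_pos i)
  rw [h3]
  have := mul_le_mul_of_nonneg_left h1 (M.β_nonneg i)
  simp only [pow_one] at this
  linarith

lemma α_le_goodProb_false {t : ℕ} (ht : 1 ≤ t) : M.α i ≤ M.goodProb i false t := by
  rw [← goodProb_false_one]; exact M.goodProb_false_mono i ht

lemma goodProb_false_succ (t : ℕ) : M.goodProb i false (t + 1) =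
    M.goodProb i false t + M.α i * (1 - M.mix i) ^ t := by
  have h2 := M.mix_mul_goodProb_false i t
  rw [goodProb_succ, beliefStep]
  have : M.mix i = M.α i + M.β i := rfl
  linear_combination - h2 + (M.goodProb i false t) * this

/-- The expected length of a cycle of `armPolicy i t`, up to a common factor. -/
def cycleTime (t : ℕ) : ℝ := M.goodProb i false t + t * M.β i

lemma cycleTime_pos {t : ℕ} (ht : 1 ≤ t) : 0 < M.cycleTime i t := by
  have h1 := M.α_le_goodProb_false i ht
  have h2 := M.add_pos i
  have h3 : (1 : ℝ) ≤ t := by exact_mod_cast ht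
  have h4 := M.β_nonneg i
  unfold cycleTime
  nlinarith

/-- The reward minus penalty per slot of `armPolicy i t`, in closed form. -/
def cycleValue (lam : ℝ) (t : ℕ) : ℝ :=
  ((M.r i - lam) * M.goodProb i false t - lam * M.β i) / M.cycleTime i t

/-- The reward minus penalty in the limit of long waits, up to a positive factor; the arm is
profitable at penalty `lam` if this is positive. -/
def margin (lam : ℝ) : ℝ := (M.r i - lam) * M.α i - lam * M.β i * M.mix i

/-- The coefficient of the decaying term of `waitGap`. -/
def waitCoeff (lam : ℝ) (t : ℕ) : ℝ :=
  (M.r i - lam) * M.α i * (1 + t * M.mix i) + lam * M.mix i * M.α i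

/-- The sign of `waitGap` tells whether waiting one more slot than `t` does not pay. -/
def waitGap (lam : ℝ) (t : ℕ) : ℝ :=
  M.margin i lam - (1 - M.mix i) ^ t * M.waitCoeff i lam t

lemma waitGap_succ_sub (lam : ℝ) (t : ℕ) : M.waitGap i lam (t + 1) - M.waitGap i lam t =
    M.α i * M.mix i ^ 2 * (1 - M.mix i) ^ t * ((t + 1) * (M.r i - lam) + lam) := by
  simp only [waitGap, waitCoeff, pow_succ]; push_cast; ring

lemma waitGap_le_succ {lam : ℝ} (hr : lam ≤ M.r i) (t : ℕ) :
    M.α i * M.mix i ^ 2 * (1 - M.mix i) ^ t * M.r i ≤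
      M.waitGap i lam (t + 1) - M.waitGap i lam t := by
  rw [waitGap_succ_sub]
  have h1 := M.decay_pow_nonneg i t
  have h2 := M.α_nonneg i
  refine mul_le_mul_of_nonneg_left ?_ (by positivity)
  have : (0 : ℝ) ≤ t := by positivity
  nlinarith

lemma waitGap_mono {lam : ℝ} (hr : lam ≤ M.r i) : Monotone (M.waitGap i lam) := by
  refine monotone_nat_of_le_succ fun t => ?_
  have h := M.waitGap_le_succ i hr t
  have h1 := M.decay_pow_nonneg i t
  have h2 := M.α_nonneg i
  have h3 := M.r_nonneg i
  have : 0 ≤ M.α i * M.mix i ^ 2 * (1 - M.mix i) ^ t * M.r i := by positivity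
  linarith

lemma cycleValue_sub_succ (lam : ℝ) {t : ℕ} (ht : 1 ≤ t) :
    M.mix i * (M.cycleTime i t * M.cycleTime i (t + 1)) *
      (M.cycleValue i lam t - M.cycleValue i lam (t + 1)) = M.β i * M.waitGap i lam t := by
  have h1 := (M.cycleTime_pos i ht).ne'
  have h2 := (M.cycleTime_pos i (Nat.le_add_left 1 t)).ne'
  have e1 : M.cycleTime i t * M.cycleValue i lam t =
    (M.r i - lam) * M.goodProb i false t - lam * M.β i := by
    rw [cycleValue]; field_simp
  have e2 : M.cycleTime i (t + 1) * M.cycleValue i lam (t + 1) =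
    (M.r i - lam) * M.goodProb i false (t + 1) - lam * M.β i := by
    rw [cycleValue]; field_simp
  have e3 : M.mix i * (M.cycleTime i t * M.cycleTime i (t + 1)) *
      (M.cycleValue i lam t - M.cycleValue i lam (t + 1)) =
      M.mix i * (M.cycleTime i (t + 1) * (M.cycleTime i t * M.cycleValue i lam t) -
       M.cycleTime i t * (M.cycleTime i (t + 1) * M.cycleValue i lam (t + 1))) := by ring
  rw [e3, e1, e2]
  simp only [cycleTime, goodProb_false_succ, waitGap, waitCoeff, margin]
  have h3 := M.mix_mul_goodProb_false i t
  push_cast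
  linear_combination (M.β i * (M.r i - lam)) * h3

lemma cycleValue_succ_le {lam : ℝ} {t : ℕ} (ht : 1 ≤ t) (h : 0 ≤ M.waitGap i lam t) :
    M.cycleValue i lam (t + 1) ≤ M.cycleValue i lam t := by
  have h1 := M.cycleTime_pos i ht
  have h2 := M.cycleTime_pos i (Nat.le_add_left 1 t)
  have h3 := M.mix_pos i
  have h4 := mul_nonneg (M.β_nonneg i) h
  rw [← cycleValue_sub_succ M i lam ht] at h4
  have := nonneg_of_mul_nonneg_right h4 (by positivity)
  linarith

lemma cycleValue_le_succ {lam : ℝ} {t : ℕ} (ht : 1 ≤ t) (h : M.waitGap i lam t ≤ 0) :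
    M.cycleValue i lam t ≤ M.cycleValue i lam (t + 1) := by
  have h1 := M.cycleTime_pos i ht
  have h2 := M.cycleTime_pos i (Nat.le_add_left 1 t)
  have h3 := M.mix_pos i
  have h4 := mul_nonneg (M.β_nonneg i) (neg_nonneg.2 h)
  rw [mul_neg, ← cycleValue_sub_succ M i lam ht, ← mul_neg] at h4
  have := nonneg_of_mul_nonneg_right h4 (by positivity)
  linarith

/-- The first wait from which on longer waits do not pay is optimal. -/
lemma cycleValue_le_of_waitGap {lam : ℝ} (hr : lam ≤ M.r i) {t : ℕ}
    (h1 : M.waitGap i lam t ≤ 0) (h2 : 0 ≤ M.waitGap i lam (t + 1)) {s : ℕ} (hs : 1 ≤ s) :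
    M.cycleValue i lam s ≤ M.cycleValue i lam (t + 1) := by
  rcases le_total s (t + 1) with h | h
  · obtain ⟨d, hd⟩ := Nat.exists_eq_add_of_le h
    clear h
    induction d generalizing s with
    | zero => rw [hd]; rfl
    | succ d ih =>
      refine (M.cycleValue_le_succ i hs ?_).trans (ih (by omega) (by omega))
      exact (M.waitGap_mono i hr (by omega)).trans h1
  · induction s, h using Nat.le_induction with
    | base => rfl
    | succ s h ih =>
      refine (M.cycleValue_succ_le i (by omega) ?_).trans (ih (by omega))
      exact h2.trans (M.waitGap_mono i hr h)

lemma waitGap_zero_nonpos {lam : ℝ} (h0 : 0 ≤ lam) : M.waitGap i lam 0 ≤ 0 := by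
  have h1 := M.mix_pos i
  have h2 := M.α_nonneg i
  have h3 := M.β_nonneg i
  simp only [waitGap, waitCoeff, margin, pow_zero]
  have : 0 ≤ lam * M.β i * M.mix i := by positivity
  have : 0 ≤ lam * M.mix i * M.α i := by positivity
  push_cast; linarith

lemma tendsto_mul_decay_pow : Tendsto (fun t : ℕ => (t : ℝ) * (1 - M.mix i) ^ t) atTop (nhds 0) :=
  tendsto_self_mul_const_pow_of_lt_one (by linarith [M.mix_lt_one i]) (by linarith [M.mix_pos i])

lemma tendsto_decay_pow : Tendsto (fun t : ℕ => (1 - M.mix i) ^ t) atTop (nhds 0) :=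
  tendsto_pow_atTop_nhds_zero_of_lt_one (by linarith [M.mix_lt_one i]) (by linarith [M.mix_pos i])

lemma tendsto_waitGap (lam : ℝ) :
    Tendsto (M.waitGap i lam) atTop (nhds (M.margin i lam)) := by
  have h := ((M.tendsto_decay_pow i).mul_const
    ((M.r i - lam) * M.α i + lam * M.mix i * M.α i)).add
    ((M.tendsto_mul_decay_pow i).mul_const ((M.r i - lam) * M.α i * M.mix i))
  have := (tendsto_const_nhds (x := M.margin i lam)).sub h
  simp only [zero_mul, add_zero, sub_zero] at this
  refine this.congr fun t => ?_
  simp only [waitGap, waitCoeff]; ring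

lemma lam_le_of_margin_pos {lam : ℝ} (h0 : 0 ≤ lam) (h : 0 < M.margin i lam) :
    lam ≤ M.r i ∧ 0 < M.α i := by
  have h1 := M.mix_pos i
  have h2 := M.α_nonneg i
  have h3 := M.β_nonneg i
  have h4 : 0 ≤ lam * M.β i * M.mix i := by positivity
  have h5 : 0 < (M.r i - lam) * M.α i := by unfold margin at h; linarith
  rcases h2.eq_or_lt with h6 | h6
  · rw [← h6] at h5; simp at h5
  · exact ⟨by linarith [pos_of_mul_pos_left h5 h6.le], h6⟩

/-- If the arm is profitable, then some wait is optimal. -/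
lemma exists_optimal_wait {lam : ℝ} (h0 : 0 ≤ lam) (h : 0 < M.margin i lam) :
    ∃ t, 1 ≤ t ∧ ∀ s, 1 ≤ s → M.cycleValue i lam s ≤ M.cycleValue i lam t := by
  classical
  have hr := (M.lam_le_of_margin_pos i h0 h).1
  have hex : ∃ t, 0 ≤ M.waitGap i lam (t + 1) := by
    have := ((M.tendsto_waitGap i lam).comp (tendsto_add_atTop_nat 1)).eventually
      (lt_mem_nhds h)
    obtain ⟨t, ht⟩ := this.exists
    exact ⟨t, ht.le⟩
  refine ⟨Nat.find hex + 1, by omega, fun s hs => ?_⟩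
  refine M.cycleValue_le_of_waitGap i hr ?_ (Nat.find_spec hex) hs
  rcases Nat.eq_zero_or_pos (Nat.find hex) with h1 | h1
  · rw [h1]; exact M.waitGap_zero_nonpos i h0
  · obtain ⟨k, hk⟩ := Nat.exists_eq_succ_of_ne_zero h1.ne'
    rw [hk]
    exact (not_le.1 (Nat.find_min hex (by omega : k < Nat.find hex))).le

lemma exists_cycleValue_pos {lam : ℝ} (h : 0 < M.margin i lam) :
    ∃ s, 1 ≤ s ∧ 0 < M.cycleValue i lam s := by
  have h1 := (((M.tendsto_decay_pow i).mul_const ((M.r i - lam) * M.α i)).comp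
    (tendsto_add_atTop_nat 1))
  rw [zero_mul] at h1
  obtain ⟨s, hs⟩ := (h1.eventually (gt_mem_nhds h)).exists
  refine ⟨s + 1, by omega, div_pos ?_ (M.cycleTime_pos i (by omega))⟩
  refine pos_of_mul_pos_right (a := M.mix i) ?_ (M.mix_pos i).le
  have h2 := M.mix_mul_goodProb_false i (s + 1)
  simp only [Function.comp, margin] at hs
  linear_combination hs - (M.r i - lam) * h2

/-! ### Duality for the linear program of a single arm -/

/-- Feasibility in the dual of the linear program of arm `i`; `h` is the price of a slot and `φ`
the value of seeing the arm good instead of bad. -/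
structure ArmDual (lam h φ : ℝ) : Prop where
  nonneg : 0 ≤ h
  bad_le : ∀ t : ℕ, 1 ≤ t → M.goodProb i false t * φ ≤ lam + h * t
  φ_nonneg : 0 ≤ φ
  good_le : M.r i - lam ≤ h + M.β i * φ

variable {M i}

lemma ArmDual.good_le' {lam h φ : ℝ} (D : M.ArmDual i lam h φ) {t : ℕ} (ht : 1 ≤ t) :
    M.r i - lam ≤ h * t + (1 - M.goodProb i true t) * φ := by
  have h1 := M.β_le_one_sub_goodProb i ht
  have h2 : (1 : ℝ) ≤ t := by exact_mod_cast ht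
  have := D.nonneg
  have := D.φ_nonneg
  have := D.good_le
  nlinarith

lemma ArmFeasible.objective_le {lam h φ : ℝ} (D : M.ArmDual i lam h φ) {x : Bool → ℕ → ℝ}
    (hx : M.ArmFeasible i x) :
    ∑' k : ℕ, (M.r i * x true k - lam * (x true k + x false k)) ≤ h := by
  have hs : ∀ s, Summable (x s) := fun s => by
    refine Summable.of_nonneg_of_le (hx.nonneg s) (fun k => ?_) (hx.summable s)
    have := hx.nonneg s k
    have : (0 : ℝ) ≤ k := by positivity
    nlinarith
  have hq : ∀ s, Summable fun k => x s k * M.goodProb i s (k + 1) := fun s => by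
    refine Summable.of_nonneg_of_le (fun k => mul_nonneg (hx.nonneg s k) (M.goodProb_nonneg _ _ _))
      (fun k => ?_) (hs s)
    exact mul_le_of_le_one_right (hx.nonneg s k) (M.goodProb_le_one _ _ _)
  have hq' : Summable fun k => x true k * (1 - M.goodProb i true (k + 1)) := by
    simpa only [mul_sub, mul_one] using (hs true).sub (hq true)
  have e1 := (hx.summable true).mul_left h
  have e2 := (hx.summable false).mul_left h
  have e3 := (hq false).mul_left φ
  have e4 := hq'.mul_left φ
  have hle : ∑' k : ℕ, (M.r i * x true k - lam * (x true k + x false k)) ≤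
      ∑' k : ℕ, (h * (((k : ℝ) + 1) * x true k) + h * (((k : ℝ) + 1) * x false k) +
        (φ * (x true k * (1 - M.goodProb i true (k + 1))) -
          φ * (x false k * M.goodProb i false (k + 1)))) := by
    refine Summable.tsum_le_tsum (fun k => ?_)
      (((hs true).mul_left _).sub (((hs true).add (hs false)).mul_left _))
      ((e1.add e2).add (e4.sub e3))
    have h1 := mul_le_mul_of_nonneg_left (D.good_le' (Nat.le_add_left 1 k)) (hx.nonneg true k)
    have h2 := mul_le_mul_of_nonneg_left (D.bad_le (k + 1) (Nat.le_add_left 1 k))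
      (hx.nonneg false k)
    push_cast at h1 h2
    linarith
  refine hle.trans ?_
  rw [(e1.add e2).tsum_add (e4.sub e3), e1.tsum_add e2, e4.tsum_sub e3]
  simp only [tsum_mul_left]
  rw [hx.balance, sub_self, add_zero, ← mul_add]
  have h1 := hx.time_le
  rw [Fintype.sum_bool] at h1
  exact mul_le_of_le_one_right D.nonneg h1

variable (M i)

lemma armFeasible_zero : M.ArmFeasible i 0 := by
  constructor <;> simp [summable_zero]

lemma armDual_r {lam : ℝ} (h0 : 0 ≤ lam) : M.ArmDual i lam (M.r i) 0 := by
  have h := M.r_nonneg i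
  refine ⟨h, fun t _ => ?_, le_rfl, by linarith⟩
  rw [mul_zero]; positivity

lemma armOpt_bddAbove {lam : ℝ} (h0 : 0 ≤ lam) : BddAbove {c : ℝ | ∃ x, M.ArmFeasible i x ∧
    c = ∑' k : ℕ, (M.r i * x true k - lam * (x true k + x false k))} := by
  refine ⟨M.r i, ?_⟩
  rintro _ ⟨x, hx, rfl⟩
  exact hx.objective_le (M.armDual_r i h0)

lemma armOpt_nonneg {lam : ℝ} (h0 : 0 ≤ lam) : 0 ≤ M.armOpt i lam :=
  le_csSup (M.armOpt_bddAbove i h0) ⟨0, M.armFeasible_zero i, by simp⟩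

lemma armOpt_le {lam h φ : ℝ} (D : M.ArmDual i lam h φ) : M.armOpt i lam ≤ h := by
  refine csSup_le ⟨0, 0, M.armFeasible_zero i, by simp⟩ ?_
  rintro _ ⟨x, hx, rfl⟩
  exact hx.objective_le D

/-- The frequencies of the plays of `armPolicy i t`. -/
def cycleFreq (t : ℕ) (s : Bool) (k : ℕ) : ℝ :=
  if s then (if k = 0 then M.goodProb i false t / M.cycleTime i t else 0)
  else (if k + 1 = t then M.β i / M.cycleTime i t else 0)

lemma cycleValue_le_armOpt {lam : ℝ} (h0 : 0 ≤ lam) {t : ℕ} (ht : 1 ≤ t) :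
    M.cycleValue i lam t ≤ M.armOpt i lam := by
  obtain ⟨t, rfl⟩ : ∃ k, t = k + 1 := ⟨t - 1, by omega⟩
  have hpos := M.cycleTime_pos i ht
  have hv := M.goodProb_nonneg i false (t + 1)
  have hβ := M.β_nonneg i
  have key : ∀ g : Bool → ℕ → ℝ, ∀ s : Bool,
      HasSum (fun k => g s k * M.cycleFreq i (t + 1) s k)
      (if s then g true 0 * (M.goodProb i false (t + 1) / M.cycleTime i (t + 1))
        else g false t * (M.β i / M.cycleTime i (t + 1))) := by
    intro g s
    cases s
    · convert hasSum_ite_eq t (g false t * (M.β i / M.cycleTime i (t + 1))) using 1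
      · ext k
        by_cases hk : k = t <;> simp [cycleFreq, hk]
      · simp
    · convert hasSum_ite_eq 0
        (g true 0 * (M.goodProb i false (t + 1) / M.cycleTime i (t + 1))) using 1
      · ext k
        by_cases hk : k = 0 <;> simp [cycleFreq, hk]
      · simp
  refine le_csSup (M.armOpt_bddAbove i h0) ⟨M.cycleFreq i (t + 1), ⟨fun s k => ?_, fun s => ?_,
    ?_, ?_⟩, ?_⟩
  · unfold cycleFreq; split_ifs <;> positivity
  · exact (key (fun _ k => (k : ℝ) + 1) s).summable
  · rw [Fintype.sum_bool, (key (fun _ k => (k : ℝ) + 1) true).tsum_eq,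
      (key (fun _ k => (k : ℝ) + 1) false).tsum_eq]
    refine le_of_eq ?_
    simp only [if_true, Bool.false_eq_true, if_false]
    field_simp
    simp only [cycleTime]; push_cast; ring
  · have h1 := (key (fun _ k => M.goodProb i false (k + 1)) false).tsum_eq
    have h2 := (key (fun _ k => 1 - M.goodProb i true (k + 1)) true).tsum_eq
    simp only [mul_comm (M.cycleFreq _ _ _ _)]
    rw [h1, h2]
    simp only [if_true, Bool.false_eq_true, if_false, zero_add, goodProb_true_one]
    ring
  · have h1 := key (fun _ k => M.r i - lam) true
    have h2 := key (fun _ k => lam) false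
    have h3 := (h1.sub h2).tsum_eq
    simp only [if_true, Bool.false_eq_true, if_false] at h3
    rw [cycleValue, sub_div, mul_div_assoc, mul_div_assoc, ← h3]
    congr 1; ext k; ring

lemma armDual_of_margin_nonpos {lam : ℝ} (h0 : 0 ≤ lam) (h : M.margin i lam ≤ 0) :
    ∃ φ, M.ArmDual i lam 0 φ := by
  have h1 := M.mix_pos i
  have h3 := M.β_nonneg i
  have h4 := M.r_nonneg i
  rcases (M.α_nonneg i).eq_or_lt with h2 | h2
  · have hβ : 0 < M.β i := by have := M.add_pos i; linarith
    refine ⟨M.r i / M.β i, le_rfl, fun t _ => ?_, by positivity, ?_⟩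
    · have := M.mix_mul_goodProb_false i t
      rw [← h2, zero_mul] at this
      have : M.goodProb i false t = 0 := by
        rcases mul_eq_zero.1 this with h | h
        · exact absurd h h1.ne'
        · exact h
      rw [this]; simpa using h0
    · rw [mul_div_cancel₀ _ hβ.ne']; linarith
  · refine ⟨lam * M.mix i / M.α i, le_rfl, fun t _ => ?_, by positivity, ?_⟩
    · have h5 := M.mix_mul_goodProb_false i t
      have h6 := M.decay_pow_nonneg i t
      have : M.goodProb i false t * (lam * M.mix i / M.α i) =
        lam * (1 - (1 - M.mix i) ^ t) := by
        field_simp; linear_combination lam * h5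
      rw [this]
      nlinarith
    · unfold margin at h
      have : M.β i * (lam * M.mix i / M.α i) = (lam * M.β i * M.mix i) / M.α i := by ring
      rw [this, zero_add, le_div_iff₀ h2]; linarith

lemma armOpt_eq_zero_of_margin_nonpos {lam : ℝ} (h0 : 0 ≤ lam) (h : M.margin i lam ≤ 0) :
    M.armOpt i lam = 0 := by
  obtain ⟨φ, D⟩ := M.armDual_of_margin_nonpos i h0 h
  exact le_antisymm (M.armOpt_le i D) (M.armOpt_nonneg i h0)

lemma armOpt_pos_iff {lam : ℝ} (h0 : 0 ≤ lam) : 0 < M.armOpt i lam ↔ 0 < M.margin i lam := by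
  constructor
  · intro h; by_contra h'
    rw [M.armOpt_eq_zero_of_margin_nonpos i h0 (not_lt.1 h')] at h
    exact lt_irrefl _ h
  · intro h
    obtain ⟨s, hs, hv⟩ := M.exists_cycleValue_pos i h
    exact hv.trans_le (M.cycleValue_le_armOpt i h0 hs)

/-- At an optimal wait `t` of a profitable arm there is a dual solution that is tight for plays
after the wait `t` and, if the arm can become bad, for plays of the good arm. -/
lemma armDual_of_optimal {lam : ℝ} (h0 : 0 ≤ lam) (h : 0 < M.margin i lam) {t : ℕ} (ht : 1 ≤ t)
    (hmax : ∀ s, 1 ≤ s → M.cycleValue i lam s ≤ M.cycleValue i lam t) :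
    0 < M.cycleValue i lam t ∧
    (∃ φ, M.ArmDual i lam (M.cycleValue i lam t) φ) ∧
    ∃ φ, 0 ≤ φ ∧ M.goodProb i false t * φ = lam + M.cycleValue i lam t * t ∧
      M.r i - lam = M.cycleValue i lam t + M.β i * φ := by
  obtain ⟨s, hs, hsv⟩ := M.exists_cycleValue_pos i h
  have hpos : 0 < M.cycleValue i lam t := hsv.trans_le (hmax s hs)
  set c := M.cycleValue i lam t with hc
  have hα := (M.lam_le_of_margin_pos i h0 h).2
  have hv : ∀ s, 1 ≤ s → 0 < M.goodProb i false s := fun s hs =>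
    hα.trans_le (M.α_le_goodProb_false i hs)
  have hβ := M.β_nonneg i
  have heq : (M.r i - lam) * M.goodProb i false t - lam * M.β i =
      c * (M.goodProb i false t + t * M.β i) := by
    rw [hc, cycleValue, ← cycleTime, div_mul_cancel₀ _ (M.cycleTime_pos i ht).ne']
  have hle : ∀ s, 1 ≤ s → (M.r i - lam) * M.goodProb i false s - lam * M.β i ≤
      c * (M.goodProb i false s + s * M.β i) := fun s hs => by
    rw [← cycleTime, ← div_le_iff₀ (M.cycleTime_pos i hs)]
    exact hmax s hs
  have htight : ∃ φ, 0 ≤ φ ∧ M.goodProb i false t * φ = lam + c * t ∧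
      M.r i - lam = c + M.β i * φ := by
    have hvt := hv t ht
    refine ⟨(lam + c * t) / M.goodProb i false t, by positivity, ?_, ?_⟩
    · field_simp
    · have : M.goodProb i false t * (M.r i - lam) = M.goodProb i false t *
        (c + M.β i * ((lam + c * t) / M.goodProb i false t)) := by
        field_simp; linear_combination heq
      exact mul_left_cancel₀ hvt.ne' this
  refine ⟨hpos, ?_, htight⟩
  rcases hβ.eq_or_lt with hb | hb
  · refine ⟨lam + c, hpos.le, fun s hs => ?_, by positivity, ?_⟩
    · have h1 := M.goodProb_le_one i false s
      have h2 : (1 : ℝ) ≤ s := by exact_mod_cast hs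
      nlinarith
    · obtain ⟨φ, -, -, h3⟩ := htight
      rw [← hb] at h3 ⊢; linarith
  · obtain ⟨φ, h1, h2, h3⟩ := htight
    refine ⟨φ, hpos.le, fun s hs => ?_, h1, h3.le⟩
    have h4 := hle s hs
    have : M.β i * (M.goodProb i false s * φ) ≤ M.β i * (lam + c * s) := by
      rw [h3] at h4; linarith
    exact le_of_mul_le_mul_left this hb

lemma armOpt_eq_cycleValue {lam : ℝ} (h0 : 0 ≤ lam) (h : 0 < M.margin i lam) {t : ℕ} (ht : 1 ≤ t)
    (hmax : ∀ s, 1 ≤ s → M.cycleValue i lam s ≤ M.cycleValue i lam t) :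
    M.armOpt i lam = M.cycleValue i lam t := by
  obtain ⟨-, ⟨φ, D⟩, -⟩ := M.armDual_of_optimal i h0 h ht hmax
  exact le_antisymm (M.armOpt_le i D) (M.cycleValue_le_armOpt i h0 ht)

/-- Strong duality. -/
lemma exists_armDual {lam : ℝ} (h0 : 0 ≤ lam) : ∃ φ, M.ArmDual i lam (M.armOpt i lam) φ := by
  rcases le_or_gt (M.margin i lam) 0 with h | h
  · rw [M.armOpt_eq_zero_of_margin_nonpos i h0 h]
    exact M.armDual_of_margin_nonpos i h0 h
  · obtain ⟨t, ht, hmax⟩ := M.exists_optimal_wait i h0 h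
    rw [M.armOpt_eq_cycleValue i h0 h ht hmax]
    exact (M.armDual_of_optimal i h0 h ht hmax).2.1

lemma ArmDual.shift {M : FeedbackMAB n} {i : Fin n} {lam h φ μ : ℝ} (D : M.ArmDual i lam h φ)
    (hμ : lam ≤ μ) : M.ArmDual i μ h φ :=
  ⟨D.nonneg, fun t ht => (D.bad_le t ht).trans (by linarith), D.φ_nonneg, by linarith [D.good_le]⟩

lemma armOpt_anti {lam μ : ℝ} (h0 : 0 ≤ lam) (hμ : lam ≤ μ) :
    M.armOpt i μ ≤ M.armOpt i lam := by
  obtain ⟨φ, D⟩ := M.exists_armDual i h0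
  exact M.armOpt_le i (D.shift hμ)

lemma armOpt_le_add {lam μ : ℝ} (h0 : 0 ≤ lam) (hμ : lam ≤ μ) :
    M.armOpt i lam ≤ M.armOpt i μ + (μ - lam) := by
  obtain ⟨φ, D⟩ := M.exists_armDual i (h0.trans hμ)
  refine M.armOpt_le i (φ := φ) ⟨by linarith [D.nonneg], fun t ht => ?_, D.φ_nonneg, ?_⟩
  · have h1 := D.bad_le t ht
    have h2 : (1 : ℝ) ≤ t := by exact_mod_cast ht
    nlinarith
  · linarith [D.good_le]

lemma armOpt_of_r_le {lam : ℝ} (h0 : 0 ≤ lam) (h : M.r i ≤ lam) : M.armOpt i lam = 0 := by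
  have h1 := M.mix_pos i
  have h2 := M.α_nonneg i
  have h3 := M.β_nonneg i
  refine M.armOpt_eq_zero_of_margin_nonpos i h0 ?_
  unfold margin
  have : 0 ≤ lam * M.β i * M.mix i := by positivity
  nlinarith

/-! ### Balanced multipliers -/

lemma IsBalanced.mono {M : FeedbackMAB n} {η η' lam : ℝ} (h : M.IsBalanced η lam) (hη : 0 ≤ η)
    (h' : η ≤ η') : M.IsBalanced η' lam := by
  obtain ⟨h0, h1, h2⟩ := h
  refine ⟨h0, h1, ?_⟩
  have h3 : (1 + η) * lam ≤ (1 + η') * lam := by nlinarith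
  refine (Finset.sum_le_sum fun i _ => M.armOpt_anti i (by positivity) h3).trans (h2.trans h3)

lemma exists_isBalanced {η : ℝ} (hη : 0 < η) : ∃ lam, M.IsBalanced η lam := by
  set f : ℝ → ℝ := fun x => ∑ i, M.armOpt i x - x with hf
  have hcont : ContinuousOn f (Set.Icc 0 (∑ i, M.r i)) := by
    refine ContinuousOn.sub (continuousOn_finsetSum _ fun i _ => ?_) continuousOn_id
    refine LipschitzOnWith.continuousOn (K := 1) (LipschitzOnWith.of_dist_le_mul ?_)
    have key : ∀ x y, 0 ≤ x → x ≤ y →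
        dist (M.armOpt i x) (M.armOpt i y) ≤ dist x y := fun x y hx hxy => by
      have h1 := M.armOpt_anti i hx hxy
      have h2 := M.armOpt_le_add i hx hxy
      rw [Real.dist_eq, Real.dist_eq, abs_of_nonneg (by linarith), abs_of_nonpos (by linarith)]
      linarith
    intro x hx y hy
    rw [NNReal.coe_one, one_mul]
    rcases le_total x y with h | h
    · exact key x y hx.1 h
    · rw [dist_comm, dist_comm x]; exact key y x hy.1 h
  have hr : 0 ≤ ∑ i, M.r i := Finset.sum_nonneg fun i _ => M.r_nonneg i
  have h0 : 0 ≤ f 0 := by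
    simp only [hf, sub_zero]; exact Finset.sum_nonneg fun i _ => M.armOpt_nonneg i le_rfl
  have h1 : f (∑ i, M.r i) ≤ 0 := by
    have : ∑ j, M.armOpt j (∑ i, M.r i) = 0 := Finset.sum_eq_zero fun j _ =>
      M.armOpt_of_r_le j hr (Finset.single_le_sum (f := M.r) (fun i _ => M.r_nonneg i) (mem_univ j))
    simp only [hf, this]; linarith
  obtain ⟨x, hx, hfx⟩ := intermediate_value_Icc' hr hcont ⟨h1, h0⟩
  simp only [hf] at hfx
  refine ⟨x, hx.1, by linarith, ?_⟩
  have h3 : x ≤ (1 + η) * x := by nlinarith [hx.1]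
  exact (Finset.sum_le_sum fun i _ => M.armOpt_anti i hx.1 h3).trans (by linarith)

end FeedbackMAB

/-! ### Beliefs and potential functions -/

lemma Fintype.sum_prod_apply {ι : Type*} [Fintype ι] [DecidableEq ι] (F : ι → Bool → ℝ) :
    ∑ s : ι → Bool, ∏ j, F j (s j) = ∏ j, (F j true + F j false) := by
  have h := Finset.prod_univ_sum (fun _ : ι => (Finset.univ : Finset Bool)) F
  rw [Fintype.piFinset_univ] at h
  rw [← h]
  simp only [Fintype.sum_bool]

lemma stateProb_true (q : ℝ) : stateProb q true = q := rfl
lemma stateProb_false (q : ℝ) : stateProb q false = 1 - q := rfl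

namespace FeedbackMAB

variable {n : ℕ} (M : FeedbackMAB n)

/-- The belief that arm `i` is good in information state `x`. -/
def belief (x : Info n) (i : Fin n) : ℝ := M.goodProb i (x i).1 (x i).2

lemma stateProb_step (i : Fin n) (s : Bool) (t : ℕ) (b : Bool) :
    stateProb (M.goodProb i s t) true * stateProb (M.goodProb i true 1) b +
      stateProb (M.goodProb i s t) false * stateProb (M.goodProb i false 1) b =
    stateProb (M.goodProb i s (t + 1)) b := by
  rw [goodProb_succ M i s t, goodProb_true_one, goodProb_false_one]
  cases b <;> simp only [stateProb_true, stateProb_false, beliefStep] <;> ring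

lemma sum_prior_mul_trans (x : Info n) (s' : Hidden n) :
    ∑ s, M.prior x s * M.trans s s' = M.prior (x.update none) s' := by
  simp only [prior, trans, ← Finset.prod_mul_distrib]
  rw [Fintype.sum_prod_apply fun j b => stateProb (M.goodProb j (x j).1 (x j).2) b *
    stateProb (M.goodProb j b 1) (s' j)]
  simp only [stateProb_step, Info.update]

lemma sum_prior_mul_trans_observed (x : Info n) (i : Fin n) (b : Bool) (s' : Hidden n) :
    ∑ s, M.prior x s * (if s i = b then M.trans s s' else 0) =
      stateProb (M.belief x i) b * M.prior (x.update (some (i, b))) s' := by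
  have h1 : ∀ s : Hidden n, M.prior x s * (if s i = b then M.trans s s' else 0) =
      ∏ j, (stateProb (M.goodProb j (x j).1 (x j).2) (s j) *
        stateProb (M.goodProb j (s j) 1) (s' j) *
          (if j = i then (if s j = b then 1 else 0) else 1)) := by
    intro s
    rw [Finset.prod_mul_distrib, Finset.prod_mul_distrib, Finset.prod_ite_eq' univ i]
    simp only [mem_univ, if_true, prior, trans]
    split_ifs <;> ring
  simp only [h1]
  rw [Fintype.sum_prod_apply fun j c => stateProb (M.goodProb j (x j).1 (x j).2) c *
        stateProb (M.goodProb j c 1) (s' j) * (if j = i then (if c = b then 1 else 0) else 1)]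
  rw [prior, ← Finset.mul_prod_erase univ _ (mem_univ i),
    ← Finset.mul_prod_erase univ (fun j => stateProb _ (s' j)) (mem_univ i), ← mul_assoc]
  congr 1
  · cases b <;> simp [belief, Info.update]
  · refine Finset.prod_congr rfl fun j hj => ?_
    have hj : j ≠ i := (Finset.mem_erase.1 hj).1
    simp only [hj, if_false, mul_one, Info.update, stateProb_step]

lemma sum_prior (x : Info n) : ∑ s, M.prior x s = 1 := by
  simp only [prior]
  rw [Fintype.sum_prod_apply fun j b => stateProb (M.goodProb j (x j).1 (x j).2) b]
  simp [stateProb]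

lemma sum_prior_mul_reward (x : Info n) (i : Fin n) :
    ∑ s, M.prior x s * M.reward s (some i) = M.r i * M.belief x i := by
  have h1 : ∀ s : Hidden n, M.prior x s * M.reward s (some i) =
      M.r i * ∏ j, (stateProb (M.goodProb j (x j).1 (x j).2) (s j) *
          (if j = i then (if s j = true then 1 else 0) else 1)) := by
    intro s
    rw [Finset.prod_mul_distrib, Finset.prod_ite_eq' univ i]
    simp only [mem_univ, if_true, prior, reward]
    split_ifs <;> ring
  simp only [h1]
  rw [← Finset.mul_sum, Fintype.sum_prod_apply fun j c =>
    stateProb (M.goodProb j (x j).1 (x j).2) c *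
        (if j = i then (if c = true then 1 else 0) else 1),
    ← Finset.mul_prod_erase univ _ (mem_univ i), Finset.prod_eq_one]
  · simp [belief, stateProb]
  · intro j hj
    have hj : j ≠ i := (Finset.mem_erase.1 hj).1
    simp [hj, stateProb]

/-- The expectation of a function of the event, if the action `a` is taken in information state
`x`. -/
def expEvent (x : Info n) (a : Option (Fin n)) (V : Event n → ℝ) : ℝ :=
  match a with
  | none => V none
  | some i => M.belief x i * V (some (i, true)) + (1 - M.belief x i) * V (some (i, false))

lemma expEvent_mono (x : Info n) (a : Option (Fin n)) {V V' : Event n → ℝ}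
    (h : ∀ e, e.map Prod.fst = a → V e ≤ V' e) : M.expEvent x a V ≤ M.expEvent x a V' := by
  rcases a with _ | i
  · exact h _ rfl
  · have h1 := M.goodProb_nonneg i (x i).1 (x i).2
    have h2 := M.goodProb_le_one i (x i).1 (x i).2
    exact add_le_add (mul_le_mul_of_nonneg_left (h _ rfl) h1)
      (mul_le_mul_of_nonneg_left (h _ rfl) (sub_nonneg.2 h2))

lemma expEvent_add_const (x : Info n) (a : Option (Fin n)) (V : Event n → ℝ) (c : ℝ) :
    M.expEvent x a (fun e => V e + c) = M.expEvent x a V + c := by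
  rcases a with _ | i <;> simp only [expEvent]; ring

lemma sum_prior_mul_expTotal_succ (π : Policy n) (w : Hidden n → Option (Fin n) → ℝ) (T : ℕ)
    (h : History n) (x : Info n) :
    ∑ s, M.prior x s * M.expTotal π w (T + 1) h s =
      ∑ a, π.prob h a * (∑ s, M.prior x s * w s a + M.expEvent x a fun e =>
        ∑ s, M.prior (x.update e) s * M.expTotal π w T (e :: h) s) := by
  simp only [expTotal, Finset.mul_sum]
  rw [Finset.sum_comm]
  refine Finset.sum_congr rfl fun a _ => ?_
  simp only [mul_left_comm _ (π.prob h a), ← Finset.mul_sum]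
  congr 1
  simp only [mul_add, Finset.sum_add_distrib]
  congr 1
  rcases a with _ | i
  · simp only [expEvent, Option.map_none, Finset.mul_sum, ← mul_assoc]
    rw [Finset.sum_comm]
    simp only [← Finset.sum_mul, sum_prior_mul_trans]
  · simp only [expEvent, Option.map_some]
    have h1 : ∀ s : Hidden n, M.prior x s * ∑ s', M.trans s s' *
        M.expTotal π w T (some (i, s i) :: h) s' =
        ∑ s', (M.prior x s * (if s i = true then M.trans s s' else 0) *
          M.expTotal π w T (some (i, true) :: h) s' +
          M.prior x s * (if s i = false then M.trans s s' else 0) *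
          M.expTotal π w T (some (i, false) :: h) s') := by
      intro s
      rw [Finset.mul_sum]
      refine Finset.sum_congr rfl fun s' _ => ?_
      cases s i <;> simp [mul_assoc]
    simp only [h1]
    rw [Finset.sum_comm]
    simp only [Finset.sum_add_distrib, ← Finset.sum_mul, sum_prior_mul_trans_observed,
      stateProb_true, stateProb_false]
    simp only [Finset.mul_sum, mul_assoc]

lemma expTotal_neg (π : Policy n) (w : Hidden n → Option (Fin n) → ℝ) (T : ℕ) (h : History n)
    (s : Hidden n) : M.expTotal π (fun s a => - w s a) T h s = - M.expTotal π w T h s := by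
  induction T generalizing h s with
  | zero => simp [expTotal]
  | succ T ih =>
    simp only [expTotal, ih, mul_neg, Finset.sum_neg_distrib, ← neg_add]

lemma expAverage_neg (σ : Info n) (π : Policy n) (w : Hidden n → Option (Fin n) → ℝ) (T : ℕ) :
    M.expAverage σ π (fun s a => - w s a) T = - M.expAverage σ π w T := by
  simp only [expAverage, expTotal_neg, mul_neg, Finset.sum_neg_distrib, neg_div]

/-- `Φ` certifies that, as long as the information state satisfies `I`, the policy `π` gains at
least `c` per slot, up to the change of the potential `Φ`. -/
structure LowerPotential (σ : Info n) (π : Policy n) (w : Hidden n → Option (Fin n) → ℝ) (c B : ℝ)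
    (I : Info n → Prop) (Φ : Info n → ℝ) : Prop where
  init : I σ
  le_bound : ∀ x, I x → Φ x ≤ B
  step : ∀ h a, I (Info.after σ h) → 0 < π.prob h a →
    ∀ e, e.map Prod.fst = a → I ((Info.after σ h).update e)
  gain : ∀ h a, I (Info.after σ h) → 0 < π.prob h a →
    c + Φ (Info.after σ h) ≤ ∑ s, M.prior (Info.after σ h) s * w s a +
      M.expEvent (Info.after σ h) a fun e => Φ ((Info.after σ h).update e)

variable {M}

lemma LowerPotential.le_expTotal {σ : Info n} {π : Policy n} {w : Hidden n → Option (Fin n) → ℝ}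
    {c B : ℝ} {I : Info n → Prop} {Φ : Info n → ℝ} (P : M.LowerPotential σ π w c B I Φ) (T : ℕ) :
    ∀ h, I (Info.after σ h) → c * T + Φ (Info.after σ h) - B ≤
      ∑ s, M.prior (Info.after σ h) s * M.expTotal π w T h s := by
  induction T with
  | zero => intro h hI; simp only [expTotal]; simpa using P.le_bound _ hI
  | succ T ih =>
    intro h hI
    rw [sum_prior_mul_expTotal_succ]
    have h1 : c * (T + 1 : ℕ) + Φ (Info.after σ h) - B =
        ∑ a, π.prob h a * (c * (T + 1 : ℕ) + Φ (Info.after σ h) - B) := by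
      rw [← Finset.sum_mul, π.sum_eq_one, one_mul]
    rw [h1]
    refine Finset.sum_le_sum fun a _ => ?_
    rcases (π.nonneg h a).eq_or_lt with h0 | h0
    · rw [← h0]; simp
    refine mul_le_mul_of_nonneg_left ?_ h0.le
    have h2 := P.gain h a hI h0
    have h3 := M.expEvent_mono (Info.after σ h) a
      (V := fun e => Φ ((Info.after σ h).update e) + (c * T - B))
      (V' := fun e => ∑ s, M.prior ((Info.after σ h).update e) s * M.expTotal π w T (e :: h) s)
      (fun e he => by
        have := ih (e :: h) (P.step h a hI h0 e he)
        simp only [Info.after] at this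
        linarith)
    rw [expEvent_add_const] at h3
    push_cast
    linarith

lemma LowerPotential.le_expAverage {σ : Info n} {π : Policy n}
    {w : Hidden n → Option (Fin n) → ℝ}
    {c B : ℝ} {I : Info n → Prop} {Φ : Info n → ℝ} (P : M.LowerPotential σ π w c B I Φ) {T : ℕ}
    (hT : 0 < T) : c + (Φ σ - B) / T ≤ M.expAverage σ π w T := by
  have h := P.le_expTotal T [] P.init
  have hT' : (0 : ℝ) < T := by exact_mod_cast hT
  rw [expAverage, le_div_iff₀ hT', add_mul, div_mul_cancel₀ _ hT'.ne']
  simp only [Info.after] at h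
  linarith

lemma tendsto_const_add_div (c d : ℝ) : Tendsto (fun T : ℕ => c + d / T) atTop (nhds c) := by
  simpa using (tendsto_const_nhds (x := c)).add (tendsto_const_div_atTop_nhds_zero_nat d)

lemma sum_prior_mul_le (x : Info n) {w : Hidden n → Option (Fin n) → ℝ} {C : ℝ}
    (a : Option (Fin n)) (hw : ∀ s, w s a ≤ C) : ∑ s, M.prior x s * w s a ≤ C := by
  have h1 : C = ∑ s, M.prior x s * C := by rw [← Finset.sum_mul, sum_prior, one_mul]
  rw [h1]
  refine Finset.sum_le_sum fun s _ => mul_le_mul_of_nonneg_left (hw s) ?_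
  refine Finset.prod_nonneg fun i _ => ?_
  have h2 := M.goodProb_nonneg i (x i).1 (x i).2
  have h3 := M.goodProb_le_one i (x i).1 (x i).2
  cases s i <;> simp [stateProb, h2, h3]

lemma lowerPotential_zero (σ : Info n) (π : Policy n) {w : Hidden n → Option (Fin n) → ℝ} {C : ℝ}
    (hw : ∀ s a, C ≤ w s a) : M.LowerPotential σ π w C 0 (fun _ => True) 0 := by
  refine ⟨trivial, fun _ _ => le_rfl, fun _ _ _ _ _ _ => trivial, fun h a _ _ => ?_⟩
  have h1 := M.sum_prior_mul_le (Info.after σ h) (w := fun s a => - w s a) (C := -C) a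
    fun s => neg_le_neg (hw s a)
  simp only [mul_neg, Finset.sum_neg_distrib, neg_le_neg_iff] at h1
  have h2 : M.expEvent (Info.after σ h) a (fun e => (0 : Info n → ℝ)
      ((Info.after σ h).update e)) = 0 := by
    rcases a with _ | i <;> simp [expEvent]
  rw [h2]; simpa using h1

lemma expAverage_mem_Icc (σ : Info n) (π : Policy n) {w : Hidden n → Option (Fin n) → ℝ} {C : ℝ}
    (h0 : ∀ s a, 0 ≤ w s a) (hC : ∀ s a, w s a ≤ C) (hC0 : 0 ≤ C) (T : ℕ) :
    M.expAverage σ π w T ∈ Set.Icc 0 C := by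
  rcases Nat.eq_zero_or_pos T with rfl | hT
  · simp [expAverage, hC0]
  have h1 := (M.lowerPotential_zero σ π h0).le_expAverage hT
  have h2 := (M.lowerPotential_zero σ π (w := fun s a => - w s a) (C := -C)
    fun s a => neg_le_neg (hC s a)).le_expAverage hT
  rw [expAverage_neg] at h2
  simp only [Pi.zero_apply, sub_zero, zero_div, add_zero] at h1 h2
  exact ⟨h1, by linarith⟩

lemma reward_nonneg (s : Hidden n) (a : Option (Fin n)) : 0 ≤ M.reward s a := by
  rcases a with _ | i
  · rfl
  · simp only [reward]; split_ifs
    exacts [M.r_nonneg i, le_rfl]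

lemma reward_le (s : Hidden n) (a : Option (Fin n)) : M.reward s a ≤ ∑ i, M.r i := by
  rcases a with _ | i
  · exact Finset.sum_nonneg fun i _ => M.r_nonneg i
  · refine le_trans ?_ (Finset.single_le_sum (f := M.r) (fun i _ => M.r_nonneg i) (mem_univ i))
    simp only [reward]; split_ifs
    exacts [le_rfl, M.r_nonneg i]

lemma expAverage_reward_mem (σ : Info n) (π : Policy n) (T : ℕ) :
    M.expAverage σ π M.reward T ∈ Set.Icc 0 (∑ i, M.r i) :=
  expAverage_mem_Icc σ π reward_nonneg reward_le
    (Finset.sum_nonneg fun i _ => M.r_nonneg i) T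

lemma LowerPotential.le_lowerReward {σ : Info n} {π : Policy n} {c B : ℝ} {I : Info n → Prop}
    {Φ : Info n → ℝ} (P : M.LowerPotential σ π M.reward c B I Φ) : c ≤ M.lowerReward σ π := by
  rw [← (tendsto_const_add_div c (Φ σ - B)).liminf_eq, lowerReward]
  refine liminf_le_liminf ?_ (tendsto_const_add_div c (Φ σ - B)).isBoundedUnder_ge ?_
  · filter_upwards [eventually_gt_atTop 0] with T hT using P.le_expAverage hT
  · exact IsBoundedUnder.isCoboundedUnder_ge
      (isBoundedUnder_of ⟨_, fun T => (expAverage_reward_mem σ π T).2⟩)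

lemma LowerPotential.upperReward_le {σ : Info n} {π : Policy n} {c B : ℝ} {I : Info n → Prop}
    {Φ : Info n → ℝ} (P : M.LowerPotential σ π (fun s a => - M.reward s a) (-c) B I Φ) :
    M.upperReward σ π ≤ c := by
  rw [← (tendsto_const_add_div c (B - Φ σ)).limsup_eq, upperReward]
  refine limsup_le_limsup ?_ ?_ (tendsto_const_add_div c (B - Φ σ)).isBoundedUnder_le
  · filter_upwards [eventually_gt_atTop 0] with T hT
    have h := P.le_expAverage hT
    rw [expAverage_neg] at h
    have : (Φ σ - B) / T = - ((B - Φ σ) / T) := by ring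
    linarith
  · exact IsBoundedUnder.isCoboundedUnder_le
      (isBoundedUnder_of ⟨_, fun T => (expAverage_reward_mem σ π T).1⟩)

lemma tendsto_expAverage {σ : Info n} {π : Policy n} {w : Hidden n → Option (Fin n) → ℝ}
    {c B B' : ℝ} {I : Info n → Prop} {Φ : Info n → ℝ} (P : M.LowerPotential σ π w c B I Φ)
    (P' : M.LowerPotential σ π (fun s a => - w s a) (-c) B' I (fun x => - Φ x)) :
    Tendsto (M.expAverage σ π w) atTop (nhds c) := by
  refine tendsto_of_tendsto_of_tendsto_of_le_of_le' (tendsto_const_add_div c (Φ σ - B))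
    (tendsto_const_add_div c (Φ σ + B')) ?_ ?_
  · filter_upwards [eventually_gt_atTop 0] with T hT using P.le_expAverage hT
  · filter_upwards [eventually_gt_atTop 0] with T hT
    have h := P'.le_expAverage hT
    rw [expAverage_neg] at h
    have : (- Φ σ - B') / T = - ((Φ σ + B') / T) := by ring
    linarith

end FeedbackMAB

namespace FeedbackMAB

variable {n : ℕ} (M : FeedbackMAB n)

/-- The sum of single-arm potentials. -/
def sumPotential (ψ : Fin n → Bool × ℕ → ℝ) (x : Info n) : ℝ := ∑ i, ψ i (x i)

lemma expEvent_sumPotential (ψ : Fin n → Bool × ℕ → ℝ) (x : Info n) (i : Fin n) :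
    M.expEvent x (some i) (fun e => sumPotential ψ (x.update e)) =
      M.belief x i * ψ i (true, 1) + (1 - M.belief x i) * ψ i (false, 1) +
        ∑ j ∈ univ.erase i, ψ j ((x j).1, (x j).2 + 1) := by
  have h : ∀ b, sumPotential ψ (x.update (some (i, b))) =
      ψ i (b, 1) + ∑ j ∈ univ.erase i, ψ j ((x j).1, (x j).2 + 1) := fun b => by
    rw [sumPotential, ← Finset.add_sum_erase univ _ (mem_univ i)]
    congr 1
    · simp [Info.update]
    · refine Finset.sum_congr rfl fun j hj => ?_
      simp [Info.update, (Finset.mem_erase.1 hj).1]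
  simp only [expEvent, h]; ring

lemma sum_prior_mul_reward_none (x : Info n) : ∑ s, M.prior x s * M.reward s none = 0 := by
  simp [reward]

lemma expEvent_neg (x : Info n) (a : Option (Fin n)) (V : Event n → ℝ) :
    M.expEvent x a (fun e => - V e) = - M.expEvent x a V := by
  rcases a with _ | i <;> simp only [expEvent]; ring

/-! ### The upper bound on all policies -/

/-- Lagrangian relaxation of the constraint of at most one play per slot. -/
theorem upperReward_le {lam : ℝ} (h0 : 0 ≤ lam) {σ : Info n} (hσ : ∀ i, 1 ≤ (σ i).2)
    (π : Policy n) : M.upperReward σ π ≤ lam + ∑ i, M.armOpt i lam := by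
  choose φ D using fun i => M.exists_armDual i h0
  set ψ : Fin n → Bool × ℕ → ℝ := fun i y =>
    M.armOpt i lam * (y.2 - 1) + if y.1 then φ i - M.r i else 0 with hψ
  refine LowerPotential.upperReward_le (B := ∑ i, M.r i) (I := fun x => ∀ i, 1 ≤ (x i).2)
    (Φ := fun x => - sumPotential ψ x) ⟨hσ, ?_, ?_, ?_⟩
  · intro x hx
    rw [sumPotential, ← Finset.sum_neg_distrib]
    refine Finset.sum_le_sum fun i _ => ?_
    have h1 : (1 : ℝ) ≤ (x i).2 := by exact_mod_cast hx i
    have h2 := (D i).nonneg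
    have h3 := (D i).φ_nonneg
    have h4 := M.r_nonneg i
    simp only [hψ]
    have : 0 ≤ M.armOpt i lam * ((x i).2 - 1) := mul_nonneg h2 (by linarith)
    split_ifs <;> linarith
  · intro h a hI _ e _ j
    rcases e with _ | ⟨i, s⟩
    · simp [Info.update]
    · simp only [Info.update]; split_ifs <;> simp
  · intro h a hI _
    set x := Info.after σ h
    have hstep : ∀ j, ψ j ((x j).1, (x j).2 + 1) = ψ j (x j) + M.armOpt j lam := fun j => by
      simp only [hψ]; push_cast; ring
    rw [expEvent_neg]
    simp only [mul_neg, Finset.sum_neg_distrib]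
    rcases a with _ | i
    · rw [sum_prior_mul_reward_none]
      simp only [expEvent, sumPotential, Info.update, hstep, Finset.sum_add_distrib]
      linarith
    · rw [sum_prior_mul_reward, expEvent_sumPotential]
      simp only [hstep, Finset.sum_add_distrib]
      have e1 := Finset.add_sum_erase univ (fun j => ψ j (x j)) (mem_univ i)
      have e2 := Finset.add_sum_erase univ (fun j => M.armOpt j lam) (mem_univ i)
      have e3 : sumPotential ψ x = ∑ j, ψ j (x j) := rfl
      have key : M.belief x i * φ i ≤ lam + M.armOpt i lam + ψ i (x i) := by
        simp only [belief, hψ]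
        have hI := hI i
        rcases hx : x i with ⟨s, t⟩
        have ht : 1 ≤ t := by rw [hx] at hI; exact hI
        cases s
        · have := (D i).bad_le t ht
          simp only [Bool.false_eq_true, if_false]; linarith
        · have := (D i).good_le' ht
          simp only [if_true]; linarith
      have e4 : ψ i (true, 1) = φ i - M.r i := by simp [hψ]
      have e5 : ψ i (false, 1) = 0 := by simp [hψ]
      rw [e4, e5]
      linarith

/-! ### The value of the policies that play a single arm -/

/-- The long-run payoff per slot of `armPolicy i t`, if every play of arm `i` with belief `q` has
the expected payoff `ρ * q + κ`. -/
theorem tendsto_expAverage_armPolicy (i : Fin n) {t : ℕ} (ht : 1 ≤ t)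
    {w : Hidden n → Option (Fin n) → ℝ} {ρ κ : ℝ} (hw0 : ∀ s, w s none = 0)
    (hw : ∀ x, ∑ s, M.prior x s * w s (some i) = ρ * M.belief x i + κ) :
    Tendsto (M.expAverage allBad (armPolicy i t) w) atTop
      (nhds ((ρ * M.goodProb i false t + κ * (M.goodProb i false t + M.β i)) /
        M.cycleTime i t)) := by
  set v := M.goodProb i false t with hv
  set c := (ρ * v + κ * (v + M.β i)) / M.cycleTime i t with hc
  have hD := M.cycleTime_pos i ht
  have ht0 : (0 : ℝ) < t := by exact_mod_cast ht
  have hcD : c * (v + t * M.β i) = ρ * v + κ * (v + M.β i) := by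
    rw [hc, cycleTime, div_mul_cancel₀]; exact hD.ne'
  obtain ⟨ψg, h1, h2⟩ : ∃ ψg, ρ * v + κ + v * ψg = c * t ∧
      ρ * (1 - M.β i) + κ + (1 - M.β i) * ψg = c + ψg := by
    rcases (M.goodProb_nonneg i false t).eq_or_lt with h0 | h0
    · have hv0 : v = 0 := h0.symm
      have hβ : 0 < M.β i := by
        rw [cycleTime, ← h0, zero_add] at hD
        exact pos_of_mul_pos_right hD ht0.le
      refine ⟨(ρ * (1 - M.β i) + κ - c) / M.β i, ?_, ?_⟩
      · rw [hv0] at hcD ⊢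
        have : M.β i * (c * t) = M.β i * κ := by linarith
        have := mul_left_cancel₀ hβ.ne' this
        linarith
      · field_simp; ring
    · refine ⟨(c * t - ρ * v - κ) / v, ?_, ?_⟩
      · have : v ≠ 0 := h0.ne'
        field_simp; ring
      · have : v ≠ 0 := h0.ne'
        field_simp; linear_combination - hcD
  set ψ : Bool × ℕ → ℝ := fun y => if y.1 then ψg else c * (y.2 - 1) with hψ
  set I : Info n → Prop := fun x => x i = (true, 1) ∨ ((x i).1 = false ∧ 1 ≤ (x i).2 ∧ (x i).2 ≤ t)
    with hIdef
  have hbound : ∀ x, I x → |ψ (x i)| ≤ |ψg| + |c| * t := by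
    intro x hx
    rcases hx with hx | ⟨h1, h2, h3⟩
    · rw [hx]; simp only [hψ, if_true]
      have : 0 ≤ |c| * t := by positivity
      linarith
    · simp only [hψ, h1, Bool.false_eq_true, if_false]
      rw [abs_mul]
      have h2' : (1 : ℝ) ≤ (x i).2 := by exact_mod_cast h2
      have h3' : ((x i).2 : ℝ) ≤ t := by exact_mod_cast h3
      have : |((x i).2 : ℝ) - 1| ≤ t := by rw [abs_of_nonneg] <;> linarith
      have := mul_le_mul_of_nonneg_left this (abs_nonneg c)
      have := abs_nonneg ψg
      linarith
  have hact : ∀ h a, 0 < (armPolicy i t).prob h a → a = if Info.after allBad h i = (true, 1) ∨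
        ((Info.after allBad h i).1 = false ∧ t ≤ (Info.after allBad h i).2)
      then some i else none := by
    intro h a ha
    by_contra hne
    simp only [armPolicy, Policy.ofFun] at ha
    rw [if_neg hne] at ha
    exact lt_irrefl _ ha
  have hinit : I (allBad : Info n) := Or.inr ⟨rfl, le_rfl, ht⟩
  have hpres : ∀ h a, I (Info.after allBad h) → 0 < (armPolicy i t).prob h a →
      ∀ e, e.map Prod.fst = a → I ((Info.after allBad h).update e) := by
    intro h a hI ha e he
    have ha := hact h a ha
    split_ifs at ha with hc
    · rw [ha] at he
      rcases e with _ | ⟨j, b⟩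
      · simp at he
      · simp only [Option.map_some, Option.some.injEq] at he
        subst he
        cases b
        · exact Or.inr ⟨by simp [Info.update], by simp [Info.update], by simpa [Info.update]⟩
        · exact Or.inl (by simp [Info.update])
    · rw [ha] at he
      rcases e with _ | e
      · push Not at hc
        rcases hI with hI | ⟨h1, h2, h3⟩
        · exact absurd hI hc.1
        · have := hc.2 h1
          exact Or.inr ⟨h1, by simp [Info.update], by simp only [Info.update]; omega⟩
      · simp at he
  have hgain : ∀ h a, I (Info.after allBad h) → 0 < (armPolicy i t).prob h a →
      c + ψ (Info.after allBad h i) = ∑ s, M.prior (Info.after allBad h) s * w s a +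
        M.expEvent (Info.after allBad h) a fun e => ψ ((Info.after allBad h).update e i) := by
    intro h a hI ha
    have ha := hact h a ha
    split_ifs at ha with hc
    · rw [ha, hw]
      simp only [expEvent, Info.update, if_true]
      have hI' : Info.after allBad h i = (true, 1) ∨ Info.after allBad h i = (false, t) := by
        rcases hI with hI | ⟨h1, h2, h3⟩
        · exact Or.inl hI
        · right
          rcases hc with hc | hc
          · rw [hc] at h1; simp at h1
          · exact Prod.ext h1 (le_antisymm h3 hc.2)
      rcases hI' with h3 | h3
      · rw [belief, h3]
        simp only [hψ, goodProb_true_one, if_true, Bool.false_eq_true, if_false]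
        push_cast; linarith
      · rw [belief, h3]
        simp only [hψ, if_true, Bool.false_eq_true, if_false]
        push_cast; linarith
    · push Not at hc
      rcases hI with hI | ⟨h1, h2, h3⟩
      · exact absurd hI hc.1
      · rw [ha]
        simp only [expEvent, Info.update, hw0, mul_zero, Finset.sum_const_zero, hψ, h1,
          Bool.false_eq_true, if_false]
        push_cast; ring
  have P : M.LowerPotential allBad (armPolicy i t) w c (|ψg| + |c| * t) I (fun x => ψ (x i)) :=
    ⟨hinit, fun x hx => (le_abs_self _).trans (hbound x hx), hpres,
      fun h a hI ha => (hgain h a hI ha).le⟩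
  refine tendsto_expAverage (B' := |ψg| + |c| * t) P ⟨hinit, fun x hx =>
    (neg_le_abs _).trans (hbound x hx), hpres, fun h a hI ha => ?_⟩
  rw [expEvent_neg]
  simp only [mul_neg, Finset.sum_neg_distrib]
  have := hgain h a hI ha
  linarith

theorem armReward_eq (i : Fin n) {t : ℕ} (ht : 1 ≤ t) :
    M.armReward i t = M.r i * M.goodProb i false t / M.cycleTime i t := by
  have h := M.tendsto_expAverage_armPolicy i ht (w := M.reward) (ρ := M.r i) (κ := 0)
    (fun _ => rfl) (fun x => by rw [sum_prior_mul_reward, add_zero])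
  rw [armReward, h.liminf_eq, zero_mul, add_zero]

theorem armRate_eq (i : Fin n) {t : ℕ} (ht : 1 ≤ t) :
    M.armRate i t = (M.goodProb i false t + M.β i) / M.cycleTime i t := by
  have h := M.tendsto_expAverage_armPolicy i ht (w := plays) (ρ := 0) (κ := 1)
    (fun _ => rfl) (fun x => by simp [plays, sum_prior])
  rw [armRate, h.liminf_eq, zero_mul, zero_add, one_mul]

theorem armValue_eq (i : Fin n) (lam : ℝ) {t : ℕ} (ht : 1 ≤ t) :
    M.armValue i lam t = M.cycleValue i lam t := by
  rw [armValue, armReward_eq M i ht, armRate_eq M i ht, cycleValue]; ring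

theorem exists_isThreshold {lam : ℝ} (h0 : 0 ≤ lam) (i : Fin n) : ∃ t, M.IsThreshold lam i t := by
  rcases (M.armOpt_nonneg i h0).eq_or_lt with h | h
  · exact ⟨0, Or.inr ⟨h.symm, rfl⟩⟩
  · obtain ⟨t, ht, hmax⟩ := M.exists_optimal_wait i h0 ((M.armOpt_pos_iff i h0).1 h)
    refine ⟨t, Or.inl ⟨h, ht, fun s hs => ?_⟩⟩
    rw [armValue_eq M i lam ht, armValue_eq M i lam hs]
    exact hmax s hs

/-! ### The balanced index policy -/

theorem exists_isBalancedIndex (lam : ℝ) (t : Fin n → ℕ) (σ : Info n) :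
    ∃ π, M.IsBalancedIndex lam t σ π := by
  classical
  have h : ∀ x : Info n, ∃ a, IndexRule {i | 0 < M.armOpt i lam} t x a := by
    intro x
    by_cases h1 : ∃ j ∈ {i | 0 < M.armOpt i lam}, IsGood x j
    · obtain ⟨j, hj, hg⟩ := h1
      exact ⟨some j, hj, Or.inl hg⟩
    · push Not at h1
      by_cases h2 : ∃ j ∈ {i | 0 < M.armOpt i lam}, IsReady t x j
      · obtain ⟨j, hj, hg⟩ := h2
        exact ⟨some j, hj, Or.inr ⟨h1, hg⟩⟩
      · push Not at h2
        exact ⟨none, fun j hj => ⟨h1 j hj, h2 j hj⟩⟩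
  choose f hf using h
  refine ⟨Policy.ofFun fun h => f (Info.after σ h), fun h a ha => ?_⟩
  by_cases hne : a = f (Info.after σ h)
  · rw [hne]; exact hf _
  · simp only [Policy.ofFun] at ha
    rw [if_neg hne] at ha
    exact absurd ha (lt_irrefl _)

theorem le_lowerReward_of_isBalancedIndex {lam : ℝ} (h0 : 0 ≤ lam)
    (hlam : lam ≤ ∑ i, M.armOpt i lam) {t : Fin n → ℕ} (ht : ∀ i, M.IsThreshold lam i (t i))
    {σ : Info n} (hσ : σ.IsInitial) {π : Policy n} (hπ : M.IsBalancedIndex lam t σ π) :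
    lam ≤ M.lowerReward σ π := by
  classical
  have hex : ∀ i, ∃ φ, 0 ≤ φ ∧ (0 < M.armOpt i lam → 1 ≤ t i ∧
      M.goodProb i false (t i) * φ = lam + M.armOpt i lam * t i ∧
      M.r i - lam = M.armOpt i lam + M.β i * φ) := by
    intro i
    rcases ht i with ⟨h1, h2, h3⟩ | ⟨h1, -⟩
    · have hm := (M.armOpt_pos_iff i h0).1 h1
      have hmax : ∀ s, 1 ≤ s → M.cycleValue i lam s ≤ M.cycleValue i lam (t i) := fun s hs => by
        rw [← armValue_eq M i lam hs, ← armValue_eq M i lam h2]; exact h3 s hs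
      obtain ⟨-, -, φ, h4, h5, h6⟩ := M.armDual_of_optimal i h0 hm h2 hmax
      rw [← M.armOpt_eq_cycleValue i h0 hm h2 hmax] at h5 h6
      exact ⟨φ, h4, fun _ => ⟨h2, h5, h6⟩⟩
    · exact ⟨0, le_rfl, fun h => by rw [h1] at h; exact absurd h (lt_irrefl _)⟩
  choose φ hφ0 hφ using hex
  have hopt : ∀ i, 0 ≤ M.armOpt i lam := fun i => M.armOpt_nonneg i h0
  set ψ : Fin n → Bool × ℕ → ℝ := fun i y => if 0 < M.armOpt i lam then
    (if y.1 then φ i - M.r i else M.armOpt i lam * ((min y.2 (t i) : ℕ) - 1)) else 0 with hψ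
  set S : Set (Fin n) := {i | 0 < M.armOpt i lam} with hS
  set I : Info n → Prop := fun x => (∀ i, 1 ≤ (x i).2) ∧
    (∀ i ∈ S, (x i).1 = true → (x i).2 = 1) ∧
    ∀ i ∈ S, ∀ j ∈ S, (x i).1 = true → (x j).1 = true → i = j with hIdef
  have hgood : ∀ x, I x → ∀ j ∈ S, (x j).1 = true → IsGood x j := fun x hx j hj h =>
    Prod.ext h (hx.2.1 j hj h)
  have hother : ∀ x, I x → ∀ i, IndexRule S t x (some i) → ∀ j ∈ S, j ≠ i → (x j).1 = false := by
    intro x hx i hi j hj hji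
    by_contra hne
    have hne : (x j).1 = true := by simpa using hne
    rcases hi.2 with h | h
    · exact hji (hx.2.2 j hj i hi.1 hne (by rw [h]))
    · exact h.1 j hj (hgood x hx j hj hne)
  refine LowerPotential.le_lowerReward (B := ∑ i, (φ i + M.armOpt i lam * t i)) (I := I)
    (Φ := sumPotential ψ) ⟨⟨hσ.1, fun i _ => hσ.2.1 i, fun i _ j _ => hσ.2.2 i j⟩, ?_, ?_, ?_⟩
  · intro x hx
    refine Finset.sum_le_sum fun i _ => ?_
    have h1 := hφ0 i
    have h2 := M.r_nonneg i
    have h3 : 0 ≤ M.armOpt i lam * t i := mul_nonneg (hopt i) (by positivity)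
    simp only [hψ]
    split_ifs
    · linarith
    · have h4 : ((min (x i).2 (t i) : ℕ) : ℝ) ≤ t i := by exact_mod_cast min_le_right _ _
      nlinarith [hopt i]
    · linarith
  · intro h a hI ha e he
    have hrule := hπ h a ha
    refine ⟨fun j => ?_, ?_⟩
    · rcases e with _ | ⟨i, s⟩
      · simp [Info.update]
      · simp only [Info.update]; split_ifs <;> simp
    rcases e with _ | ⟨i, s⟩
    · simp only [Option.map_none] at he
      subst he
      have hno : ∀ j ∈ S, (Info.after σ h j).1 = true → False := fun j hj hjt =>
        (hrule j hj).1 (hgood _ hI j hj hjt)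
      exact ⟨fun j hj hjt => (hno j hj hjt).elim, fun j hj _ _ hjt _ => (hno j hj hjt).elim⟩
    · simp only [Option.map_some] at he
      subst he
      have hno : ∀ j ∈ S, ((Info.after σ h).update (some (i, s)) j).1 = true → j = i := by
        intro j hj hjt
        by_contra hji
        simp only [Info.update, hji, if_false] at hjt
        rw [hother _ hI i hrule j hj hji] at hjt
        exact Bool.false_ne_true hjt
      refine ⟨fun j hj hjt => ?_, fun j hj k hk hjt hkt => ?_⟩
      · have := hno j hj hjt
        simp [Info.update, this]
      · rw [hno j hj hjt, hno k hk hkt]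
  · intro h a hI ha
    have hrule := hπ h a ha
    set x := Info.after σ h
    rcases a with _ | i
    · rw [sum_prior_mul_reward_none]
      have hstep : ∀ j, ψ j ((x j).1, (x j).2 + 1) = ψ j (x j) + M.armOpt j lam := by
        intro j
        simp only [hψ]
        split_ifs with h1 h2
        · exact ((hrule j h1).1 (hgood x hI j h1 h2)).elim
        · have h3 : (x j).2 < t j := by
            by_contra h4
            exact (hrule j h1).2 ⟨by simpa using h2, not_lt.1 h4⟩
          rw [min_eq_left h3.le, min_eq_left (by omega)]
          push_cast; ring
        · have := hopt j
          linarith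
      simp only [expEvent, sumPotential, Info.update, hstep, Finset.sum_add_distrib]
      linarith
    · rw [sum_prior_mul_reward, expEvent_sumPotential]
      have e1 := Finset.add_sum_erase univ (fun j => ψ j (x j)) (mem_univ i)
      have e3 : sumPotential ψ x = ∑ j, ψ j (x j) := rfl
      have e2 : ∑ j ∈ univ.erase i, ψ j (x j) ≤
          ∑ j ∈ univ.erase i, ψ j ((x j).1, (x j).2 + 1) := by
        refine Finset.sum_le_sum fun j hj => ?_
        simp only [hψ]
        split_ifs with h1 h2
        · exact le_rfl
        · have h3 : min (x j).2 (t j) ≤ min ((x j).2 + 1) (t j) :=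
            min_le_min (Nat.le_succ _) le_rfl
          have h4 : ((min (x j).2 (t j) : ℕ) : ℝ) ≤ (min ((x j).2 + 1) (t j) : ℕ) := by
            exact_mod_cast h3
          exact mul_le_mul_of_nonneg_left (by linarith) (hopt j)
        · exact le_rfl
      have hi : 0 < M.armOpt i lam := hrule.1
      obtain ⟨h2, h3, h4⟩ := hφ i hi
      have e4 : ψ i (true, 1) = φ i - M.r i := by simp [hψ, hi]
      have e5 : ψ i (false, 1) = 0 := by simp [hψ, hi, h2]
      have key : lam + ψ i (x i) ≤ M.belief x i * φ i := by
        rcases hrule.2 with hg | ⟨-, hr1, hr2⟩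
        · rw [belief, hg]
          simp only [hψ, hi, if_true, goodProb_true_one]
          linarith
        · have h5 := M.goodProb_false_mono i hr2
          have h6 := mul_le_mul_of_nonneg_right h5 (hφ0 i)
          rw [h3] at h6
          simp only [hψ, hi, if_true, belief, hr1, Bool.false_eq_true, if_false, min_eq_right hr2]
          linarith
      rw [e4, e5]
      linarith

/-- Every balanced index policy is a `(2 + ε)`-approximation. -/
theorem upperReward_le_mul_lowerReward {ε lam : ℝ} (hε : 0 < ε) (hb : M.IsBalanced (ε / 2) lam)
    {t : Fin n → ℕ} (ht : ∀ i, M.IsThreshold lam i (t i)) {σ : Info n} (hσ : σ.IsInitial)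
    {π : Policy n} (hπ : M.IsBalancedIndex lam t σ π) (π' : Policy n) :
    M.upperReward σ π' ≤ (2 + ε) * M.lowerReward σ π := by
  obtain ⟨h0, h1, h2⟩ := hb
  have h3 := M.upperReward_le (lam := (1 + ε / 2) * lam) (by positivity) hσ.1 π'
  have h4 := M.le_lowerReward_of_isBalancedIndex h0 h1 ht hσ hπ
  have h5 := mul_le_mul_of_nonneg_left h4 (by linarith : (0 : ℝ) ≤ 2 + ε)
  linarith

end FeedbackMAB

/-! ### Costs of programs -/

lemma one_le_bitLen (z : ℤ) : 1 ≤ bitLen z := Nat.le_add_left _ _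

lemma bitLen_le_bitLen {x y : ℤ} (h : |x| ≤ |y|) : bitLen x ≤ bitLen y :=
  Nat.add_le_add_right (Nat.size_le_size (by
    rw [Int.abs_eq_natAbs, Int.abs_eq_natAbs] at h; exact_mod_cast h)) 1

lemma bitLen_le_iff {z : ℤ} {k : ℕ} : bitLen z ≤ k + 1 ↔ z.natAbs < 2 ^ k := by
  rw [bitLen, Nat.add_le_add_iff_right, Nat.size_le]

lemma natAbs_lt_two_pow_bitLen (z : ℤ) : z.natAbs < 2 ^ (bitLen z - 1) :=
  bitLen_le_iff.1 (by have := one_le_bitLen z; omega)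

lemma bitLen_add_le (x y : ℤ) : bitLen (x + y) ≤ bitLen x + bitLen y := by
  have h1 := natAbs_lt_two_pow_bitLen x
  have h2 := natAbs_lt_two_pow_bitLen y
  have h3 := one_le_bitLen x
  have h4 := one_le_bitLen y
  obtain ⟨a, ha⟩ := Nat.exists_eq_add_of_le' h3
  obtain ⟨b, hb⟩ := Nat.exists_eq_add_of_le' h4
  rw [ha, Nat.add_sub_cancel] at h1
  rw [hb, Nat.add_sub_cancel] at h2
  refine (bitLen_le_iff (k := a + b + 1)).2 ?_ |>.trans (by omega)
  have h5 := Int.natAbs_add_le x y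
  have h6 : 2 ^ a ≤ 2 ^ (a + b) := Nat.pow_le_pow_right (by norm_num) (by omega)
  have h7 : 2 ^ b ≤ 2 ^ (a + b) := Nat.pow_le_pow_right (by norm_num) (by omega)
  rw [pow_succ]; omega

lemma bitLen_neg (x : ℤ) : bitLen (-x) = bitLen x := by simp [bitLen]

lemma bitLen_sub_le (x y : ℤ) : bitLen (x - y) ≤ bitLen x + bitLen y := by
  rw [sub_eq_add_neg, ← bitLen_neg y]; exact bitLen_add_le _ _

lemma bitLen_mul_le (x y : ℤ) : bitLen (x * y) ≤ bitLen x + bitLen y := by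
  have h1 := natAbs_lt_two_pow_bitLen x
  have h2 := natAbs_lt_two_pow_bitLen y
  have h3 := one_le_bitLen x
  have h4 := one_le_bitLen y
  obtain ⟨a, ha⟩ := Nat.exists_eq_add_of_le' h3
  obtain ⟨b, hb⟩ := Nat.exists_eq_add_of_le' h4
  rw [ha, Nat.add_sub_cancel] at h1
  rw [hb, Nat.add_sub_cancel] at h2
  refine (bitLen_le_iff (k := a + b)).2 ?_ |>.trans (by omega)
  rw [Int.natAbs_mul, pow_add]
  exact Nat.mul_lt_mul'' h1 h2

lemma bitLen_ediv_le (x y : ℤ) : bitLen (x / y) ≤ bitLen x :=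
  Nat.add_le_add_right (Nat.size_le_size (Int.natAbs_ediv_le_natAbs x y)) 1

/-- All entries of the memory have at most `B` bits. -/
def Mem.Bdd (B : ℕ) (m : Mem) : Prop := ∀ a j, bitLen (m a j) ≤ B

lemma Mem.Bdd.one_le {B : ℕ} {m : Mem} (h : m.Bdd B) : 1 ≤ B := (one_le_bitLen _).trans (h 0 0)

lemma Mem.Bdd.mono {B B' : ℕ} {m : Mem} (h : m.Bdd B) (h' : B ≤ B') : m.Bdd B' :=
  fun a j => (h a j).trans h'

lemma Mem.Bdd.store {B : ℕ} {m : Mem} (h : m.Bdd B) {z : ℤ} (hz : bitLen z ≤ B) (a k : ℕ) :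
    (m.store a k z).Bdd B := fun b j => by
  unfold Mem.store; split_ifs
  exacts [hz, h b j]

namespace Expr

/-- Scalar variables are the entries `0` of arrays. -/
abbrev var (a : ℕ) : Expr := get a (const 0)

/-- A bound for the length of the value, in units of the length of the entries of the memory. -/
def bits : Expr → ℕ
  | const z => bitLen z
  | get _ _ => 1
  | add e f => e.bits + f.bits
  | sub e f => e.bits + f.bits
  | mul e f => e.bits + f.bits
  | div e f => e.bits + f.bits

/-- A bound for the cost, in units of the square of the length of the entries of the memory. -/
def work : Expr → ℕ
  | const z => bitLen z
  | get _ e => e.work + e.bits + 1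
  | add e f => e.work + f.work + e.bits + f.bits
  | sub e f => e.work + f.work + e.bits + f.bits
  | mul e f => e.work + f.work + e.bits * f.bits
  | div e f => e.work + f.work + e.bits * f.bits

lemma one_le_bits (e : Expr) : 1 ≤ e.bits := by
  induction e with
  | const z => exact one_le_bitLen z
  | get a e _ => exact le_rfl
  | add e f he hf => simp only [bits]; omega
  | sub e f he hf => simp only [bits]; omega
  | mul e f he hf => simp only [bits]; omega
  | div e f he hf => simp only [bits]; omega

variable {B : ℕ} {m : Mem}

lemma bitLen_eval_le (h : m.Bdd B) (e : Expr) : bitLen (e.eval m) ≤ e.bits * B := by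
  have hB := h.one_le
  induction e with
  | const z => exact Nat.le_mul_of_pos_right _ hB
  | get a e _ => simpa [eval, bits] using h a _
  | add e f he hf =>
    simp only [bits, eval, add_mul]; exact (bitLen_add_le _ _).trans (Nat.add_le_add he hf)
  | sub e f he hf =>
    simp only [bits, eval, add_mul]; exact (bitLen_sub_le _ _).trans (Nat.add_le_add he hf)
  | mul e f he hf =>
    simp only [bits, eval, add_mul]; exact (bitLen_mul_le _ _).trans (Nat.add_le_add he hf)
  | div e f he hf =>
    simp only [bits, eval, add_mul]
    exact (bitLen_ediv_le _ _).trans (he.trans (Nat.le_add_right _ _))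

lemma cost_le (h : m.Bdd B) (e : Expr) : e.cost m ≤ e.work * B ^ 2 := by
  have hB := h.one_le
  have hB2 : B ≤ B ^ 2 := by nlinarith
  have key : ∀ f : Expr, bitLen (f.eval m) ≤ f.bits * B ^ 2 := fun f =>
    (bitLen_eval_le h f).trans (Nat.mul_le_mul_left _ hB2)
  have key2 : ∀ f g : Expr, bitLen (f.eval m) * bitLen (g.eval m) ≤ f.bits * g.bits * B ^ 2 :=
    fun f g => (Nat.mul_le_mul (bitLen_eval_le h f) (bitLen_eval_le h g)).trans
      (le_of_eq (by ring))
  induction e with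
  | const z => exact Nat.le_mul_of_pos_right _ (by positivity)
  | get a e he =>
    simp only [cost, work, add_mul, one_mul]
    have := key e
    have := (h a (e.eval m).toNat).trans hB2
    omega
  | add e f he hf =>
    simp only [cost, work, add_mul]; have := key e; have := key f; omega
  | sub e f he hf =>
    simp only [cost, work, add_mul]; have := key e; have := key f; omega
  | mul e f he hf => simp only [cost, work, add_mul]; have := key2 e f; omega
  | div e f he hf => simp only [cost, work, add_mul]; have := key2 e f; omega

end Expr

namespace Prog

/-- Programs without loops. -/
def LoopFree : Prog → Prop
  | skip => True
  | set _ _ _ => True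
  | seq p q => p.LoopFree ∧ q.LoopFree
  | ite _ p q => p.LoopFree ∧ q.LoopFree
  | loop _ _ => False

/-- The effect of a program without loops. -/
def run : Prog → Mem → Mem
  | skip, m => m
  | set a e f, m => m.store a (e.eval m).toNat (f.eval m)
  | seq p q, m => q.run (p.run m)
  | ite e p q, m => if 0 < e.eval m then p.run m else q.run m
  | loop _ _, m => m

/-- A bound for the growth of the length of the entries of the memory. -/
def growth : Prog → ℕ
  | skip => 1
  | set _ _ f => f.bits
  | seq p q => q.growth * p.growth
  | ite _ p q => p.growth * q.growth
  | loop _ _ => 1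

/-- A bound for the cost, in units of the square of the length of the entries of the memory. -/
def work : Prog → ℕ
  | skip => 1
  | set _ e f => 1 + e.work + f.work + e.bits + f.bits
  | seq p q => 1 + p.work + q.work * p.growth ^ 2
  | ite e p q => 1 + e.work + p.work + q.work
  | loop _ _ => 0

lemma one_le_growth (p : Prog) : 1 ≤ p.growth := by
  induction p with
  | skip => exact le_rfl
  | set a e f => exact f.one_le_bits
  | seq p q hp hq => exact Nat.mul_pos hq hp
  | ite e p q hp hq => exact Nat.mul_pos hp hq
  | loop e p _ => exact le_rfl

lemma exec_run {p : Prog} (hp : p.LoopFree) {B : ℕ} {m : Mem} (h : m.Bdd B) :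
    (∃ c, Exec p m c (p.run m) ∧ c ≤ p.work * B ^ 2) ∧ (p.run m).Bdd (p.growth * B) := by
  have hB' : ∀ {B : ℕ} {m : Mem}, m.Bdd B → 1 ≤ B ^ 2 := fun h => Nat.one_le_pow _ _ h.one_le
  induction p generalizing m B with
  | skip => exact ⟨⟨1, .skip m, by simpa [work] using hB' h⟩, by simpa [growth, run] using h⟩
  | set a e f =>
    have h2 := hB' h
    refine ⟨⟨_, .set a e f m, ?_⟩, ?_⟩
    · simp only [work, add_mul, one_mul]
      have hB2 : B ≤ B ^ 2 := by have := h.one_le; nlinarith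
      have := e.cost_le h
      have := f.cost_le h
      have := (e.bitLen_eval_le h).trans (Nat.mul_le_mul_left _ hB2)
      have := (f.bitLen_eval_le h).trans (Nat.mul_le_mul_left _ hB2)
      omega
    · exact (h.mono (Nat.le_mul_of_pos_left _ f.one_le_bits)).store (f.bitLen_eval_le h) _ _
  | seq p q ihp ihq =>
    obtain ⟨⟨c, h1, h2⟩, h3⟩ := ihp hp.1 h
    obtain ⟨⟨c', h4, h5⟩, h6⟩ := ihq hp.2 h3
    refine ⟨⟨_, .seq h1 h4, ?_⟩, ?_⟩
    · have := hB' h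
      simp only [work, add_mul, one_mul]
      rw [mul_pow, ← mul_assoc] at h5
      omega
    · simp only [growth, mul_assoc]; exact h6
  | ite e p q ihp ihq =>
    have h1 := hB' h
    have h2 := e.cost_le h
    by_cases he : 0 < e.eval m
    · obtain ⟨⟨c, h3, h4⟩, h5⟩ := ihp hp.1 h
      simp only [run, if_pos he]
      refine ⟨⟨_, .ite_pos he h3, ?_⟩, h5.mono ?_⟩
      · simp only [work, add_mul, one_mul]; omega
      · exact Nat.mul_le_mul_right _ (Nat.le_mul_of_pos_right _ q.one_le_growth)
    · obtain ⟨⟨c, h3, h4⟩, h5⟩ := ihq hp.2 h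
      simp only [run, if_neg he]
      refine ⟨⟨_, .ite_neg he h3, ?_⟩, h5.mono ?_⟩
      · simp only [work, add_mul, one_mul]; omega
      · exact Nat.mul_le_mul_right _ (Nat.le_mul_of_pos_left _ p.one_le_growth)
  | loop e p _ => exact hp.elim

end Prog

/-- The program `p`, started with memory `m`, halts at cost at most `k * B ^ 2` with a memory that
satisfies `Q`. -/
def Ensures (B : ℕ) (p : Prog) (m : Mem) (k : ℕ) (Q : Mem → Prop) : Prop :=
  ∃ c m', Exec p m c m' ∧ c ≤ k * B ^ 2 ∧ Q m'

namespace Ensures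

variable {B : ℕ} {p q : Prog} {m : Mem} {Q R : Mem → Prop}

lemma of_run (hp : p.LoopFree) (h : m.Bdd B) (hQ : Q (p.run m)) : Ensures B p m p.work Q := by
  obtain ⟨c, h1, h2⟩ := (Prog.exec_run hp h).1
  exact ⟨c, _, h1, h2, hQ⟩

lemma mono {k k' : ℕ} (h : Ensures B p m k R) (hk : k ≤ k') (hQ : ∀ m', R m' → Q m') :
    Ensures B p m k' Q := by
  obtain ⟨c, m', h1, h2, h3⟩ := h
  exact ⟨c, m', h1, h2.trans (Nat.mul_le_mul_right _ hk), hQ _ h3⟩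

lemma seq {k k' : ℕ} (hB : 1 ≤ B) (h : Ensures B p m k R) (h' : ∀ m', R m' → Ensures B q m' k' Q) :
    Ensures B (.seq p q) m (1 + k + k') Q := by
  obtain ⟨c, m', h1, h2, h3⟩ := h
  obtain ⟨c', m'', h4, h5, h6⟩ := h' m' h3
  refine ⟨_, m'', .seq h1 h4, ?_, h6⟩
  have : 1 ≤ B ^ 2 := Nat.one_le_pow _ _ hB
  simp only [add_mul, one_mul]; omega

lemma ite {e : Expr} {k : ℕ} (h : m.Bdd B) (h1 : 0 < e.eval m → Ensures B p m k Q)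
    (h2 : ¬ 0 < e.eval m → Ensures B q m k Q) : Ensures B (.ite e p q) m (1 + e.work + k) Q := by
  have h3 : 1 ≤ B ^ 2 := Nat.one_le_pow _ _ h.one_le
  have h4 := e.cost_le h
  by_cases he : 0 < e.eval m
  · obtain ⟨c, m', h5, h6, h7⟩ := h1 he
    refine ⟨_, m', .ite_pos he h5, ?_, h7⟩
    simp only [add_mul, one_mul]; omega
  · obtain ⟨c, m', h5, h6, h7⟩ := h2 he
    refine ⟨_, m', .ite_neg he h5, ?_, h7⟩
    simp only [add_mul, one_mul]; omega

/-- The rule for loops with a decreasing measure. -/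
lemma loop {e : Expr} {k : ℕ} (I : Mem → Prop) (μ : Mem → ℕ) (hI : ∀ m, I m → m.Bdd B)
    (h : ∀ m, I m → 0 < e.eval m → Ensures B p m k fun m' => I m' ∧ μ m' < μ m) (hm : I m) :
    Ensures B (.loop e p) m (μ m * (k + e.work + 1) + (e.work + 1))
      fun m' => I m' ∧ ¬ 0 < e.eval m' := by
  induction hN : μ m using Nat.strong_induction_on generalizing m with
  | _ N ih =>
    have h3 : 1 ≤ B ^ 2 := Nat.one_le_pow _ _ (hI m hm).one_le
    have h4 := e.cost_le (hI m hm)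
    by_cases he : 0 < e.eval m
    · obtain ⟨c, m', h5, h6, h7, h8⟩ := h m hm he
      obtain ⟨c', m'', h9, h10, h11⟩ := ih (μ m') (hN ▸ h8) h7 rfl
      refine ⟨_, m'', .loop_pos he h5 h9, ?_, h11⟩
      have h12 : μ m' + 1 ≤ N := hN ▸ h8
      have h13 := Nat.mul_le_mul_right ((k + e.work + 1) * B ^ 2) h12
      simp only [add_mul, one_mul, mul_add, mul_assoc] at h10 h13 ⊢
      omega
    · refine ⟨_, m, .loop_neg he, ?_, hm, he⟩
      simp only [add_mul, one_mul]; omega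

/-- The rule for loops with a counter. -/
lemma loop_count {e : Expr} {k N : ℕ} (I : ℕ → Mem → Prop) (hI : ∀ i m, I i m → m.Bdd B)
    (h1 : ∀ i m, i < N → I i m → 0 < e.eval m ∧ Ensures B p m k (I (i + 1)))
    (h2 : ∀ m, I N m → ¬ 0 < e.eval m) (hm : I 0 m) :
    Ensures B (.loop e p) m (N * (k + e.work + 1) + (e.work + 1)) (I N) := by
  suffices h : ∀ d i m, i + d = N → I i m →
      Ensures B (.loop e p) m (d * (k + e.work + 1) + (e.work + 1)) (I N) from
    h N 0 m (zero_add N) hm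
  intro d
  induction d with
  | zero =>
    intro i m hi hm
    have hi : i = N := hi
    subst hi
    have h3 : 1 ≤ B ^ 2 := Nat.one_le_pow _ _ (hI _ m hm).one_le
    have h4 := e.cost_le (hI _ m hm)
    refine ⟨_, m, .loop_neg (h2 m hm), ?_, hm⟩
    simp only [add_mul, one_mul]; omega
  | succ d ih =>
    intro i m hi hm
    have h3 : 1 ≤ B ^ 2 := Nat.one_le_pow _ _ (hI _ m hm).one_le
    have h4 := e.cost_le (hI _ m hm)
    obtain ⟨he, c, m', h5, h6, h7⟩ := h1 i m (by omega) hm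
    obtain ⟨c', m'', h9, h10, h11⟩ := ih (i + 1) m' (by omega) h7
    refine ⟨_, m'', .loop_pos he h5 h9, ?_, h11⟩
    simp only [add_mul, one_mul, mul_add, mul_assoc] at h10 ⊢
    omega

end Ensures

lemma toArray_apply {n : ℕ} (f : Fin n → ℤ) (i : Fin n) : toArray f i = f i := by
  simp [toArray, i.2]

lemma toArray_fin {n : ℕ} (f : Fin n → ℤ) {k : ℕ} (hk : k < n) : toArray f k = f ⟨k, hk⟩ := by
  simp [toArray, hk]

lemma bitLen_toArray_le {n : ℕ} {f : Fin n → ℤ} {B : ℕ} (hB : 1 ≤ B) (hf : ∀ i, bitLen (f i) ≤ B)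
    (j : ℕ) : bitLen (toArray f j) ≤ B := by
  unfold toArray; split_ifs
  exacts [hf _, hB]

lemma one_le_ite_bitLen (b : Bool) : bitLen (if b then 1 else 0) ≤ 2 := by
  cases b <;> decide

section StepProgram
open Expr Prog

/-- Inspects the arm whose index is in array `5`; the action is built up in array `4`, and array `6`
tells whether it plays a good arm. -/
def stepInspect : Prog :=
  ite (get 1 (var 5))
    (ite (get 2 (var 5))
      (ite (get 3 (var 5)) (ite (sub (const 2) (get 3 (var 5)))
        (seq (set 4 (const 0) (add (var 5) (const 1))) (set 6 (const 0) (const 1))) skip) skip)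
      (ite (var 6) skip (ite (sub (add (get 3 (var 5)) (const 1)) (get 1 (var 5)))
        (set 4 (const 0) (add (var 5) (const 1))) skip)))
    skip

/-- Goes on to the next arm. -/
def nextArm : Prog := set 5 (const 0) (add (var 5) (const 1))

/-- The program that executes a step of the policy. -/
def stepProg : Prog := loop (sub (var 0) (var 5)) (seq stepInspect nextArm)

/-- The action `a` is right if only the first `i` arms are taken into account, and `b` tells whether
it plays a good arm. -/
def PartialRule {n : ℕ} (t : Fin n → ℕ) (x : Info n) (i : ℕ) (a : Option (Fin n)) (b : ℤ) : Prop :=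
  (b = 1 ∧ ∃ j, a = some j ∧ t j ≠ 0 ∧ IsGood x j) ∨
  (b = 0 ∧ (∀ j : Fin n, (j : ℕ) < i → t j ≠ 0 → ¬ IsGood x j) ∧
    ((a = none ∧ ∀ j : Fin n, (j : ℕ) < i → t j ≠ 0 → ¬ IsReady t x j) ∨
      ∃ j, a = some j ∧ t j ≠ 0 ∧ IsReady t x j))

/-- The memory after the inspection of `i` arms, if the counter is `k`. -/
structure StepInv {n : ℕ} (t : Fin n → ℕ) (x : Info n) (B k i : ℕ) (m : Mem) : Prop where
  bdd : m.Bdd B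
  le : k ≤ n
  size : m 0 0 = n
  thresholds : m 1 = toArray fun i => (t i : ℤ)
  states : m 2 = toArray fun i => if (x i).1 then 1 else 0
  times : m 3 = toArray fun i => ((x i).2 : ℤ)
  index : m 5 0 = k
  rule : ∃ a, m 4 0 = actionCode a ∧ PartialRule t x i a (m 6 0)

lemma bitLen_index_le {n i B : ℕ} (hi : i ≤ n) (h : bitLen (n : ℤ) ≤ B) : bitLen (i : ℤ) ≤ B :=
  (bitLen_le_bitLen (by simpa using hi)).trans h

lemma StepInv.inspect {n : ℕ} {t : Fin n → ℕ} {x : Info n} {B i : ℕ} {m : Mem} (hB : 2 ≤ B)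
    (h : StepInv t x B i i m) (hi : i < n) :
    Ensures B stepInspect m stepInspect.work (StepInv t x B i (i + 1)) := by
  refine Ensures.of_run (by simp [stepInspect, LoopFree]) h.bdd ?_
  obtain ⟨a, ha, hr⟩ := h.rule
  have e1 : m 1 i = (t ⟨i, hi⟩ : ℤ) := by rw [h.thresholds, toArray_fin _ hi]
  have e2 : m 2 i = if (x ⟨i, hi⟩).1 then 1 else 0 := by rw [h.states, toArray_fin _ hi]
  have e3 : m 3 i = ((x ⟨i, hi⟩).2 : ℤ) := by rw [h.times, toArray_fin _ hi]
  have hbi : bitLen ((i : ℤ) + 1) ≤ B := by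
    have := bitLen_index_le (i := i + 1) hi (by simpa [h.size] using h.bdd 0 0)
    simpa using this
  have hb1 : bitLen 1 ≤ B := by simpa [bitLen] using hB
  have next : ∀ {j : Fin n}, (j : ℕ) < i + 1 → (j : ℕ) < i ∨ j = ⟨i, hi⟩ := fun {j} hj => by
    rcases Nat.lt_succ_iff_lt_or_eq.1 hj with h | h
    · exact Or.inl h
    · exact Or.inr (Fin.ext h)
  -- the three possible results of the inspection
  have keep : PartialRule t x (i + 1) a (m 6 0) →
      StepInv t x B i (i + 1) m := fun hk =>
    ⟨h.bdd, h.le, h.size, h.thresholds, h.states, h.times, h.index, a, ha, hk⟩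
  simp only [stepInspect, run, Expr.eval, h.index, Int.toNat_zero, Int.toNat_natCast, e1, e2, e3]
  by_cases ht : 0 < (t ⟨i, hi⟩ : ℤ)
  swap
  · simp only [if_neg ht]
    refine keep ?_
    have ht0 : t ⟨i, hi⟩ = 0 := by omega
    rcases hr with hr | ⟨h1, h2, h3⟩
    · exact Or.inl hr
    · refine Or.inr ⟨h1, fun j hj htj => ?_, ?_⟩
      · rcases next hj with hj | rfl
        exacts [h2 j hj htj, absurd ht0 htj]
      · rcases h3 with ⟨h3, h4⟩ | h3
        · refine Or.inl ⟨h3, fun j hj htj => ?_⟩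
          rcases next hj with hj | rfl
          exacts [h4 j hj htj, absurd ht0 htj]
        · exact Or.inr h3
  simp only [if_pos ht]
  have ht0 : t ⟨i, hi⟩ ≠ 0 := by omega
  rcases hx : x ⟨i, hi⟩ with ⟨s, τ⟩
  cases s
  · simp only [Bool.false_eq_true, if_false, lt_self_iff_false]
    have hng : ¬ IsGood x ⟨i, hi⟩ := by rw [IsGood, hx]; simp
    rcases hr with ⟨h1, hr⟩ | ⟨h1, h2, h3⟩
    · rw [h1]
      simp only [zero_lt_one, if_true]
      exact keep (Or.inl ⟨h1, hr⟩)
    · rw [h1]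
      simp only [lt_self_iff_false, if_false]
      have h2' : ∀ j : Fin n, (j : ℕ) < i + 1 → t j ≠ 0 → ¬ IsGood x j := fun j hj htj => by
        rcases next hj with hj | rfl
        exacts [h2 j hj htj, hng]
      by_cases hrd : 0 < (τ : ℤ) + 1 - t ⟨i, hi⟩
      · rw [if_pos hrd]
        refine ⟨h.bdd.store hbi _ _, h.le, h.size, h.thresholds, h.states, h.times, h.index, some ⟨i, hi⟩, by simp [Mem.store, actionCode],
          Or.inr ⟨?_, h2', Or.inr ⟨_, rfl, ht0, ?_⟩⟩⟩
        · simpa [Mem.store] using h1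
        · exact ⟨by rw [hx], by rw [hx]; simp only; omega⟩
      · simp only [if_neg hrd]
        refine keep (Or.inr ⟨h1, h2', ?_⟩)
        rcases h3 with ⟨h3, h4⟩ | h3
        · refine Or.inl ⟨h3, fun j hj htj => ?_⟩
          rcases next hj with hj | rfl
          · exact h4 j hj htj
          · intro hrdy
            have := hrdy.2
            rw [hx] at this
            simp only at this
            omega
        · exact Or.inr h3
  · simp only [if_true, zero_lt_one]
    have hnr : ¬ IsReady t x ⟨i, hi⟩ := by rw [IsReady, hx]; simp
    have other : ¬ IsGood x ⟨i, hi⟩ → PartialRule t x (i + 1) a (m 6 0) := fun hng => by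
      rcases hr with hr | ⟨h1, h2, h3⟩
      · exact Or.inl hr
      · refine Or.inr ⟨h1, fun j hj htj => ?_, ?_⟩
        · rcases next hj with hj | rfl
          exacts [h2 j hj htj, hng]
        · rcases h3 with ⟨h3, h4⟩ | h3
          · refine Or.inl ⟨h3, fun j hj htj => ?_⟩
            rcases next hj with hj | rfl
            exacts [h4 j hj htj, hnr]
          · exact Or.inr h3
    by_cases hτ : τ = 1
    · subst hτ
      simp only [Nat.cast_one, zero_lt_one, if_true]
      simp only [show (0 : ℤ) < 2 - 1 by norm_num, if_true]
      exact ⟨(h.bdd.store hbi _ _).store hb1 _ _, h.le, h.size, h.thresholds, h.states,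
        h.times, h.index, some ⟨i, hi⟩, by simp [Mem.store, actionCode],
        Or.inl ⟨by simp [Mem.store], _, rfl, ht0, hx⟩⟩
    · have hng : ¬ IsGood x ⟨i, hi⟩ := by rw [IsGood, hx]; simpa using hτ
      have := keep (other hng)
      split_ifs
      · omega
      · exact this
      · exact this

lemma StepInv.next {n : ℕ} {t : Fin n → ℕ} {x : Info n} {B i : ℕ} {m : Mem}
    (h : StepInv t x B i (i + 1) m) (hi : i < n) :
    Ensures B nextArm m nextArm.work (StepInv t x B (i + 1) (i + 1)) := by
  refine Ensures.of_run trivial h.bdd ?_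
  have hbi : bitLen ((i : ℤ) + 1) ≤ B := by
    have := bitLen_index_le (i := i + 1) hi (by simpa [h.size] using h.bdd 0 0)
    simpa using this
  simp only [nextArm, run, Expr.eval, h.index, Int.toNat_zero]
  exact ⟨h.bdd.store hbi _ _, hi, h.size, h.thresholds, h.states, h.times, by simp [Mem.store],
    h.rule⟩

lemma StepInv.ensures {n : ℕ} {t : Fin n → ℕ} {x : Info n} {B i : ℕ} {m : Mem} (hB : 2 ≤ B)
    (h : StepInv t x B i i m) (hi : i < n) : Ensures B (seq stepInspect nextArm) m
      (1 + stepInspect.work + nextArm.work) (StepInv t x B (i + 1) (i + 1)) :=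
  Ensures.seq h.bdd.one_le (h.inspect hB hi) fun _ h' => h'.next hi

lemma PartialRule.indexRule {n : ℕ} {t : Fin n → ℕ} {x : Info n} {a : Option (Fin n)} {b : ℤ}
    (h : PartialRule t x n a b) : IndexRule {i | t i ≠ 0} t x a := by
  rcases h with ⟨-, j, rfl, h1, h2⟩ | ⟨-, h1, ⟨rfl, h2⟩ | ⟨j, rfl, h2, h3⟩⟩
  · exact ⟨h1, Or.inl h2⟩
  · exact fun j hj => ⟨h1 j j.2 hj, h2 j j.2 hj⟩
  · exact ⟨h2, Or.inr ⟨fun k hk => h1 k k.2 hk, h3⟩⟩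

lemma stepMem_bdd {n : ℕ} (t : Fin n → ℕ) (x : Info n) :
    Mem.Bdd (stepLen t x + 1) (stepMem t x) := by
  have h1 : ∀ i, bitLen (t i : ℤ) + 1 + bitLen ((x i).2 : ℤ) ≤ stepLen t x := fun i =>
    (Finset.single_le_sum (f := fun i => bitLen (t i : ℤ) + 1 + bitLen ((x i).2 : ℤ))
      (fun _ _ => Nat.zero_le _) (mem_univ i)).trans (Nat.le_add_left _ _)
  have h2 : bitLen (n : ℤ) ≤ stepLen t x := Nat.le_add_right _ _
  have h3 : 1 ≤ stepLen t x + 1 := Nat.le_add_left _ _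
  intro a j
  match a with
  | 0 =>
    refine bitLen_toArray_le h3 (fun i => ?_) j
    simp only [Matrix.cons_val_fin_one]; omega
  | 1 => exact bitLen_toArray_le (f := fun i => (t i : ℤ)) h3 (fun i => by have := h1 i; omega) j
  | 2 =>
    refine bitLen_toArray_le (f := fun i => if (x i).1 then 1 else 0) h3 (fun i => ?_) j
    have := h1 i
    have := one_le_bitLen (t i : ℤ)
    have := one_le_ite_bitLen (x i).1
    have := one_le_bitLen ((x i).2 : ℤ)
    omega
  | 3 => exact bitLen_toArray_le (f := fun i => ((x i).2 : ℤ)) h3 (fun i => by have := h1 i; omega) j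
  | (a + 4) => exact le_trans (by simp [stepMem, bitLen]) h3

/-- Each step of the policy is executed in polynomial time. -/
theorem exists_stepProg : ∃ (P : Prog) (p : Polynomial ℕ), ∀ (n : ℕ) (t : Fin n → ℕ) (x : Info n),
    ∃ (c : ℕ) (m : Mem) (a : Option (Fin n)), Exec P (stepMem t x) c m ∧
      c ≤ p.eval (stepLen t x) ∧ m 4 0 = actionCode a ∧ IndexRule {i | t i ≠ 0} t x a := by
  set e : Expr := sub (var 0) (var 5) with he
  refine ⟨stepProg, Polynomial.C (1 + stepInspect.work + nextArm.work + e.work + 1) * (Polynomial.X + 1) ^ 3,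
    fun n t x => ?_⟩
  have hb1 := one_le_bitLen (n : ℤ)
  have hs : bitLen (n : ℤ) ≤ stepLen t x := Nat.le_add_right _ _
  have hn : n ≤ stepLen t x := by
    have h1 : ∑ _i : Fin n, 1 ≤ ∑ i, (bitLen (t i : ℤ) + 1 + bitLen ((x i).2 : ℤ)) :=
      Finset.sum_le_sum fun i _ => by omega
    have h2 : ∑ _i : Fin n, 1 = n := by simp
    unfold stepLen; omega
  have hinit : StepInv t x (stepLen t x + 1) 0 0 (stepMem t x) := by
    refine ⟨stepMem_bdd t x, Nat.zero_le _, by simp [stepMem, toArray], rfl, rfl, rfl,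
      by simp [stepMem], none, by simp [stepMem, actionCode], Or.inr ⟨by simp [stepMem], ?_,
      Or.inl ⟨rfl, ?_⟩⟩⟩ <;> exact fun j hj => absurd hj (Nat.not_lt_zero _)
  obtain ⟨c, m, h1, h2, h3⟩ := Ensures.loop_count (B := stepLen t x + 1) (N := n) (e := e)
    (fun i m => StepInv t x (stepLen t x + 1) i i m)
    (fun i m h => h.bdd) (fun i m hi h => ⟨by simp [he, Expr.eval, h.size, h.index, hi],
      h.ensures (by omega) hi⟩) (fun m h => by simp [he, Expr.eval, h.size, h.index]) hinit
  obtain ⟨a, h4, h5⟩ := h3.rule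
  refine ⟨c, m, a, h1, h2.trans ?_, h4, h5.indexRule⟩
  simp only [Polynomial.eval_mul, Polynomial.eval_C, Polynomial.eval_pow, Polynomial.eval_add,
    Polynomial.eval_X, Polynomial.eval_one]
  rw [pow_succ' (stepLen t x + 1) 2, ← mul_assoc]
  refine Nat.mul_le_mul_right _ ?_
  nlinarith

end StepProgram

/-! ### Separation of multipliers from ties -/

namespace FeedbackMAB

variable {n : ℕ} (M : FeedbackMAB n) (i : Fin n)

lemma decay_pow_mul_le_one (k : ℕ) : (1 - M.mix i) ^ k * (1 + k * M.mix i) ≤ 1 := by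
  have h1 := M.mix_pos i
  have h2 := M.mix_lt_one i
  have h3 : 1 + k * M.mix i ≤ (1 + M.mix i) ^ k := one_add_mul_le_pow (by linarith) k
  calc (1 - M.mix i) ^ k * (1 + k * M.mix i) ≤ (1 - M.mix i) ^ k * (1 + M.mix i) ^ k :=
        mul_le_mul_of_nonneg_left h3 (M.decay_pow_nonneg i k)
    _ = (1 - M.mix i ^ 2) ^ k := by rw [← mul_pow]; ring_nf
    _ ≤ 1 := pow_le_one₀ (by nlinarith) (by nlinarith)

/-- The rate at which `waitGap` decreases with the multiplier. -/
def gapSlope (s : ℕ) : ℝ :=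
  M.α i * (1 - (1 - M.mix i) ^ (s + 1) * (1 + s * M.mix i)) + M.β i * M.mix i

lemma waitGap_sub_waitGap (lam lam' : ℝ) (s : ℕ) :
    M.waitGap i lam (s + 1) - M.waitGap i lam' (s + 1) = (lam' - lam) * M.gapSlope i s := by
  simp only [waitGap, waitCoeff, margin, gapSlope]; push_cast; ring

lemma le_gapSlope (s : ℕ) : M.α i * M.mix i ≤ M.gapSlope i s := by
  have h1 := M.decay_pow_mul_le_one i s
  have h2 := M.mix_lt_one i
  have h3 := M.mix_pos i
  have h4 := mul_nonneg (M.β_nonneg i) h3.le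
  have h5 : (1 - M.mix i) ^ (s + 1) * (1 + s * M.mix i) ≤ 1 - M.mix i := by
    rw [pow_succ]; nlinarith
  have := mul_le_mul_of_nonneg_left h5 (M.α_nonneg i)
  unfold gapSlope; linarith

lemma gapSlope_nonneg (s : ℕ) : 0 ≤ M.gapSlope i s :=
  (mul_nonneg (M.α_nonneg i) (M.mix_pos i).le).trans (M.le_gapSlope i s)

lemma gapSlope_le (s : ℕ) : M.gapSlope i s ≤ 2 := by
  have h1 : 0 ≤ (1 - M.mix i) ^ (s + 1) * (1 + s * M.mix i) :=
    mul_nonneg (M.decay_pow_nonneg i _) (by have := M.mix_pos i; positivity)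
  have h2 := M.mix_lt_one i
  have h3 := M.mix_pos i
  have h4 := M.α_le_mix i
  have h5 := M.β_le_mix i
  have h6 := M.α_nonneg i
  have h7 := M.β_nonneg i
  unfold gapSlope; nlinarith

lemma margin_sub_margin (lam lam' : ℝ) : M.margin i lam - M.margin i lam' =
    (lam' - lam) * (M.α i + M.β i * M.mix i) := by
  simp only [margin]; ring

lemma margin_anti {lam lam' : ℝ} (h : lam ≤ lam') : M.margin i lam' ≤ M.margin i lam := by
  have h1 := M.margin_sub_margin i lam lam'
  have h2 := M.α_nonneg i
  have h3 := M.β_nonneg i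
  have h4 := M.mix_pos i
  have : 0 ≤ (lam' - lam) * (M.α i + M.β i * M.mix i) := mul_nonneg (by linarith) (by positivity)
  linarith

lemma margin_le_add {lam lam' : ℝ} (h : lam ≤ lam') :
    M.margin i lam ≤ M.margin i lam' + 2 * (lam' - lam) := by
  have h1 := M.margin_sub_margin i lam lam'
  have h2 := M.mix_lt_one i
  have h4 := M.α_le_mix i
  have h5 := M.β_le_mix i
  have h7 := M.β_nonneg i
  have h8 := M.mix_pos i
  have : M.α i + M.β i * M.mix i ≤ 2 := by nlinarith
  nlinarith

lemma waitCoeff_nonneg {lam : ℝ} (h0 : 0 ≤ lam) (hr : lam ≤ M.r i) (t : ℕ) :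
    0 ≤ M.waitCoeff i lam t := by
  have h2 := M.α_nonneg i
  have h4 := M.mix_pos i
  have h5 : 0 ≤ M.r i - lam := by linarith
  unfold waitCoeff; positivity

lemma waitCoeff_le {lam : ℝ} (h0 : 0 ≤ lam) (t : ℕ) :
    M.waitCoeff i lam t ≤ M.r i * M.α i * (1 + t * M.mix i) := by
  have h2 := M.α_nonneg i
  have h4 := M.mix_pos i
  have h5 := M.mix_lt_one i
  have h6 : 0 ≤ lam * M.α i := by positivity
  have h7 : 0 ≤ (t : ℝ) * M.mix i := by positivity
  unfold waitCoeff; nlinarith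

lemma waitCoeff_le' {lam : ℝ} (h0 : 0 ≤ lam) (t : ℕ) :
    M.waitCoeff i lam t ≤ M.r i * (t + 1) := by
  refine (M.waitCoeff_le i h0 t).trans ?_
  rw [mul_assoc]
  refine mul_le_mul_of_nonneg_left ?_ (M.r_nonneg i)
  have h1 := M.α_le_mix i
  have h2 := M.α_nonneg i
  have h4 := M.mix_pos i
  have h5 := M.mix_lt_one i
  have h6 : (0 : ℝ) ≤ t := by positivity
  have h7 : 1 + t * M.mix i ≤ t + 1 := by nlinarith
  have h8 : 0 ≤ 1 + t * M.mix i := by positivity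
  nlinarith

/-- As long as waiting pays, the wait is not much longer than the inverse of the margin. -/
lemma wait_mul_margin_le {lam : ℝ} (h0 : 0 ≤ lam) {t : ℕ} (h : M.waitGap i lam t ≤ 0) :
    t * M.margin i lam ≤ 2 * M.r i := by
  have hγ := M.mix_pos i
  have hγ1 := M.mix_lt_one i
  set y : ℝ := t * M.mix i with hy
  have hy0 : 0 ≤ y := by positivity
  have h1 : (1 - M.mix i) ^ t ≤ Real.exp (-y) := by
    have : 1 - M.mix i ≤ Real.exp (-M.mix i) := by
      have := Real.add_one_le_exp (-M.mix i); linarith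
    calc (1 - M.mix i) ^ t ≤ Real.exp (-M.mix i) ^ t := pow_le_pow_left₀ (by linarith) this t
      _ = Real.exp (-y) := by rw [← Real.exp_nat_mul, hy]; ring_nf
  have h2 : Real.exp (-y) * ((1 + y) * y) ≤ 2 := by
    have h3 := Real.quadratic_le_exp_of_nonneg hy0
    rw [Real.exp_neg, inv_mul_le_iff₀ (Real.exp_pos y)]
    nlinarith
  have h3 : (1 - M.mix i) ^ t * ((1 + y) * y) ≤ 2 :=
    (mul_le_mul_of_nonneg_right h1 (by positivity)).trans h2
  have h4 := mul_le_mul_of_nonneg_left (M.waitCoeff_le i h0 t) (M.decay_pow_nonneg i t)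
  have hrα : 0 ≤ M.r i * M.α i := mul_nonneg (M.r_nonneg i) (M.α_nonneg i)
  have h5 : M.margin i lam ≤ (1 - M.mix i) ^ t * (M.r i * M.α i * (1 + y)) := by
    unfold waitGap at h; linarith
  have h6 : M.margin i lam * y ≤ 2 * (M.r i * M.mix i) := by
    have h7 := mul_le_mul_of_nonneg_right h5 hy0
    have h8 := mul_le_mul_of_nonneg_left h3 hrα
    have h9 := mul_le_mul_of_nonneg_left (M.α_le_mix i) (M.r_nonneg i)
    nlinarith
  refine le_of_mul_le_mul_right (a := M.mix i) ?_ hγ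
  rw [hy] at h6; linarith

/-- The parameters of the arm are neither much larger than `U` nor much smaller than `1 / U`. -/
structure Scaled (U : ℝ) : Prop where
  large : 32 ≤ U
  mix_ge : U⁻¹ ≤ M.mix i
  α_ge : 0 < M.α i → U⁻¹ ≤ M.α i
  r_ge : 0 < M.r i → U⁻¹ ≤ M.r i
  r_le : M.r i ≤ U

/-- For the multiplier `lam` two waits up to `N` are optimal or nearly so. -/
def NearTie (N δ lam : ℝ) : Prop :=
  ∃ t : ℕ, (t : ℝ) + 1 ≤ N ∧ 0 < M.margin i lam ∧ M.waitGap i lam t ≤ 0 ∧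
    |M.waitGap i lam (t + 1)| ≤ δ

variable {M i}

lemma Scaled.margin_ge {U : ℝ} (S : M.Scaled i U) {lam₀ lam : ℝ} (h1 : lam₀ ≤ lam)
    (h2 : lam ≤ lam₀ + U⁻¹ ^ 35) (h3 : 0 < M.margin i lam₀ → U⁻¹ ^ 11 ≤ M.margin i lam₀)
    (h : 0 < M.margin i lam) : U⁻¹ ^ 12 ≤ M.margin i lam := by
  have hU := S.large
  have hκ0 : 0 < U⁻¹ := by positivity
  have hκ : U⁻¹ ≤ 1 / 32 := by rw [one_div]; exact inv_anti₀ (by norm_num) hU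
  have h4 := h3 (h.trans_le (M.margin_anti i h1))
  have h5 := M.margin_le_add i h1
  set κ := U⁻¹
  have h6 : κ ^ 12 ≤ κ ^ 11 * (1 / 32) := by rw [pow_succ]; gcongr
  have h7 : κ ^ 35 ≤ κ ^ 12 := pow_le_pow_of_le_one hκ0.le (by linarith) (by norm_num)
  have : 0 < κ ^ 12 := by positivity
  linarith

lemma Scaled.gap_ge {U : ℝ} (S : M.Scaled i U) {lam : ℝ} (h0 : 0 ≤ lam)
    (hm : U⁻¹ ^ 12 ≤ M.margin i lam) {t : ℕ} (htN : (t : ℝ) + 1 ≤ 2 * U ^ 14)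
    (ht : M.waitGap i lam t ≤ 0) :
    U⁻¹ ^ 32 ≤ M.waitGap i lam (t + 1) - M.waitGap i lam t := by
  have hU := S.large
  have hU0 : 0 < U := by linarith
  have hκ0 : 0 < U⁻¹ := by positivity
  have hκ : U⁻¹ ≤ 1 / 32 := by rw [one_div]; exact inv_anti₀ (by norm_num) hU
  have hκU : U⁻¹ * U = 1 := inv_mul_cancel₀ hU0.ne'
  have hm0 : 0 < M.margin i lam := (pow_pos hκ0 12).trans_le hm
  obtain ⟨hr, hα⟩ := M.lam_le_of_margin_pos i h0 hm0
  have hr0 : 0 < M.r i := by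
    rcases (M.r_nonneg i).eq_or_lt with h | h
    · have h1 : lam = 0 := le_antisymm (by linarith) h0
      rw [margin, ← h, h1] at hm0; simp at hm0
    · exact h
  have hα' := S.α_ge hα
  have hr' := S.r_ge hr0
  have hγ' := S.mix_ge
  refine le_trans ?_ (M.waitGap_le_succ i hr t)
  have hw := M.decay_pow_nonneg i t
  -- a lower bound for the decaying factor
  have h1 : U⁻¹ ^ 12 ≤ (1 - M.mix i) ^ t * (U * (2 * U ^ 14)) := by
    have h2 : M.margin i lam ≤ (1 - M.mix i) ^ t * M.waitCoeff i lam t := by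
      unfold waitGap at ht; linarith
    refine hm.trans (h2.trans (mul_le_mul_of_nonneg_left ?_ hw))
    refine (M.waitCoeff_le' i h0 t).trans ?_
    exact mul_le_mul S.r_le htN (by positivity) hU0.le
  set κ := U⁻¹
  have h3 : κ ^ 28 ≤ (1 - M.mix i) ^ t := by
    have h4 : κ ^ 12 * κ ^ 15 ≤ (1 - M.mix i) ^ t * 2 := by
      have h5 := mul_le_mul_of_nonneg_right h1 (pow_nonneg hκ0.le 15)
      have h6 : U * (2 * U ^ 14) * κ ^ 15 = 2 := by
        have : U * (2 * U ^ 14) * κ ^ 15 = 2 * (κ * U) ^ 15 := by ring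
        rw [this, hκU]; norm_num
      rw [mul_assoc, h6] at h5
      exact h5
    have h7 : κ ^ 28 ≤ κ ^ 27 * (1 / 32) := by rw [pow_succ]; gcongr
    rw [← pow_add] at h4
    have : 0 < κ ^ 27 := by positivity
    norm_num at h4
    linarith
  calc κ ^ 32 = κ * κ ^ 2 * κ ^ 28 * κ := by ring
    _ ≤ M.α i * M.mix i ^ 2 * (1 - M.mix i) ^ t * M.r i := by gcongr

/-- In a short window of multipliers that are not too close to each other, an arm has a near tie for
at most one of them. -/
lemma Scaled.nearTie_unique {U : ℝ} (S : M.Scaled i U) {lam₀ lam lam' : ℝ} (h0 : 0 ≤ lam₀)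
    (h1 : lam₀ ≤ lam) (h2 : lam + U⁻¹ ^ 36 ≤ lam') (h3 : lam' ≤ lam₀ + U⁻¹ ^ 35)
    (hm : 0 < M.margin i lam₀ → U⁻¹ ^ 11 ≤ M.margin i lam₀)
    (hn : M.NearTie i (2 * U ^ 14) (U⁻¹ ^ 46) lam)
    (hn' : M.NearTie i (2 * U ^ 14) (U⁻¹ ^ 46) lam') : False := by
  obtain ⟨t, htN, htm, ht, hgap⟩ := hn
  obtain ⟨t', htN', htm', ht', hgap'⟩ := hn'
  have hU := S.large
  have hU0 : 0 < U := by linarith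
  have hκ0 : 0 < U⁻¹ := by positivity
  have hκ : U⁻¹ ≤ 1 / 32 := by rw [one_div]; exact inv_anti₀ (by norm_num) hU
  have hκp : 0 < U⁻¹ ^ 36 := pow_pos hκ0 _
  have hlam : 0 ≤ lam := h0.trans h1
  have hlam' : 0 ≤ lam' := by linarith
  have hM := S.margin_ge h1 (by linarith) hm htm
  have hM' := S.margin_ge (by linarith) h3 hm htm'
  obtain ⟨hr, hα⟩ := M.lam_le_of_margin_pos i hlam htm
  obtain ⟨hr', -⟩ := M.lam_le_of_margin_pos i hlam' htm'
  have hg := S.gap_ge hlam hM htN ht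
  have hg' := S.gap_ge hlam' hM' htN' ht'
  rw [abs_le] at hgap hgap'
  have p38 : U⁻¹ ^ 46 ≤ U⁻¹ ^ 38 * (1 / 32) := by
    calc U⁻¹ ^ 46 ≤ U⁻¹ ^ 39 := pow_le_pow_of_le_one hκ0.le (by linarith) (by norm_num)
      _ ≤ U⁻¹ ^ 38 * (1 / 32) := by rw [pow_succ]; gcongr
  have p38' : 0 < U⁻¹ ^ 38 := pow_pos hκ0 _
  have p35 : U⁻¹ ^ 35 ≤ U⁻¹ ^ 32 * (1 / 32) := by
    calc U⁻¹ ^ 35 ≤ U⁻¹ ^ 33 := pow_le_pow_of_le_one hκ0.le (by linarith) (by norm_num)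
      _ ≤ U⁻¹ ^ 32 * (1 / 32) := by rw [pow_succ]; gcongr
  have p32 : U⁻¹ ^ 38 ≤ U⁻¹ ^ 32 := pow_le_pow_of_le_one hκ0.le (by linarith) (by norm_num)
  rcases lt_trichotomy t t' with h | h | h
  · have e1 := M.waitGap_mono i hr' (show t + 1 ≤ t' by omega)
    have e2 := M.waitGap_sub_waitGap i lam lam' t
    have e3 := M.gapSlope_le i t
    have e4 : (lam' - lam) * M.gapSlope i t ≤ U⁻¹ ^ 35 * 2 :=
      mul_le_mul (by linarith) e3 (M.gapSlope_nonneg i t) (by positivity)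
    linarith
  · subst h
    have e2 := M.waitGap_sub_waitGap i lam lam' t
    have e3 := M.le_gapSlope i t
    have e5 : U⁻¹ * U⁻¹ ≤ M.α i * M.mix i :=
      mul_le_mul (S.α_ge hα) S.mix_ge hκ0.le (M.α_nonneg i)
    have e4 : U⁻¹ ^ 36 * (U⁻¹ * U⁻¹) ≤ (lam' - lam) * M.gapSlope i t :=
      mul_le_mul (by linarith) (e5.trans e3) (by positivity) (by linarith)
    have e6 : U⁻¹ ^ 38 = U⁻¹ ^ 36 * (U⁻¹ * U⁻¹) := by ring
    linarith
  · have e1 := M.waitGap_mono i hr (show t' + 1 ≤ t by omega)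
    have e2 := M.waitGap_sub_waitGap i lam lam' t'
    have e3 := M.gapSlope_nonneg i t'
    have e4 : 0 ≤ (lam' - lam) * M.gapSlope i t' := mul_nonneg (by linarith) e3
    linarith

end FeedbackMAB

/-! ### Integer arithmetic with rounding -/

lemma intCast_ediv_le (a : ℤ) {b : ℤ} (hb : 0 < b) : ((a / b : ℤ) : ℝ) ≤ a / b := by
  rw [le_div_iff₀ (by exact_mod_cast hb)]
  exact_mod_cast Int.ediv_mul_le a hb.ne'

lemma div_le_intCast_ediv_add_one (a : ℤ) {b : ℤ} (hb : 0 < b) :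
    (a : ℝ) / b ≤ ((a / b : ℤ) : ℝ) + 1 := by
  rw [div_le_iff₀ (by exact_mod_cast hb)]
  exact_mod_cast (Int.lt_ediv_add_one_mul_self a hb).le

/-- `x / Q` is a lower bound for `u`, with an error of at most `d / Q`. -/
structure Approx (Q : ℤ) (u : ℝ) (d x : ℤ) : Prop where
  nonneg : 0 ≤ x
  le : (x : ℝ) ≤ Q * u
  ge : Q * u ≤ x + d

lemma Approx.one {Q : ℤ} (hQ : 0 ≤ Q) : Approx Q 1 0 Q := ⟨hQ, by simp, by simp⟩

lemma Approx.of_div {Q a b : ℤ} (hQ : 0 ≤ Q) (ha : 0 ≤ a) (hb : 0 < b) {u : ℝ}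
    (hu : u * b = a) : Approx Q u 1 (Q * a / b) := by
  have hb' : (0 : ℝ) < b := by exact_mod_cast hb
  have e : ((Q * a : ℤ) : ℝ) / b = Q * u := by
    rw [div_eq_iff hb'.ne']; push_cast; rw [← hu]; ring
  refine ⟨Int.ediv_nonneg (mul_nonneg hQ ha) hb.le, ?_, ?_⟩
  · rw [← e]; exact intCast_ediv_le _ hb
  · rw [← e]; simpa using div_le_intCast_ediv_add_one (Q * a) hb

lemma Approx.mul {Q : ℤ} (hQ : 0 < Q) {u v : ℝ} {d e x y : ℤ} (hx : Approx Q u d x)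
    (hy : Approx Q v e y) (hu : u ≤ 1) (hv : v ≤ 1) (hu0 : 0 ≤ u) (hd : 0 ≤ d)
    (he : 0 ≤ e) : Approx Q (u * v) (d + e + 1) (x * y / Q) := by
  have hQ' : (0 : ℝ) < Q := by exact_mod_cast hQ
  have hx0 : (0 : ℝ) ≤ x := by exact_mod_cast hx.nonneg
  have hy0 : (0 : ℝ) ≤ y := by exact_mod_cast hy.nonneg
  have hd0 : (0 : ℝ) ≤ d := by exact_mod_cast hd
  have he0 : (0 : ℝ) ≤ e := by exact_mod_cast he
  have hyQ : (y : ℝ) ≤ Q := hy.le.trans (mul_le_of_le_one_right hQ'.le hv)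
  refine ⟨Int.ediv_nonneg (mul_nonneg hx.nonneg hy.nonneg) hQ.le, ?_, ?_⟩
  · refine (intCast_ediv_le _ hQ).trans ?_
    rw [div_le_iff₀ hQ']; push_cast
    calc (x : ℝ) * y ≤ (Q * u) * (Q * v) := mul_le_mul hx.le hy.le hy0 (by positivity)
      _ = _ := by ring
  · have h1 := div_le_intCast_ediv_add_one (x * y) hQ
    have h2 : Q * (u * v) - (d + e) ≤ ((x * y : ℤ) : ℝ) / Q := by
      rw [le_div_iff₀ hQ']; push_cast
      have h3 : (Q * u - x) * y ≤ d * Q :=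
        mul_le_mul (by linarith [hx.ge]) hyQ hy0 hd0
      have h4 : Q * u * (Q * v - y) ≤ Q * u * e :=
        mul_le_mul_of_nonneg_left (by linarith [hy.ge]) (by positivity)
      have h5 : Q * u * e ≤ Q * 1 * e := by gcongr
      linarith
    push_cast; linarith

lemma inv_le_of_mul_eq {U : ℤ} {x : ℝ} {a d : ℤ} (hx : 0 < x) (hd : 0 < d) (hdU : d ≤ U)
    (h : x * d = a) :
    (U : ℝ)⁻¹ ≤ x := by
  have hd' : (0 : ℝ) < d := by exact_mod_cast hd
  have hU' : (d : ℝ) ≤ U := by exact_mod_cast hdU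
  have ha : (0 : ℝ) < a := by rw [← h]; positivity
  have ha1 : (1 : ℝ) ≤ a := by exact_mod_cast (by exact_mod_cast ha : (0 : ℤ) < a)
  rw [inv_le_iff_one_le_mul₀ (by linarith), mul_comm]
  nlinarith

/-! ### The integer data of an arm -/

/-- Numerators and denominators of the parameters of an arm. -/
structure ArmCode where
  an : ℤ
  ad : ℤ
  bn : ℤ
  bd : ℤ
  rn : ℤ
  rd : ℤ

namespace ArmCode

variable (R : ArmCode)

/-- The numerator of `α` over the denominator `D`. -/
def X : ℤ := R.an * R.bd

/-- The numerator of `β` over the denominator `D`. -/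
def Y : ℤ := R.bn * R.ad

/-- The common denominator of `α` and `β`. -/
def D : ℤ := R.ad * R.bd

/-- A positive multiple of `margin`, for the multiplier `L / Λ`. -/
def margin (Λ L : ℤ) : ℤ :=
  (R.rn * Λ - L * R.rd) * R.X * R.D - L * R.rd * R.Y * (R.X + R.Y)

/-- A positive multiple of `waitCoeff`, for the multiplier `L / Λ`. -/
def coeff (Λ L t : ℤ) : ℤ :=
  (R.rn * Λ - L * R.rd) * R.X * (R.D + t * (R.X + R.Y)) + L * R.rd * R.X * (R.X + R.Y)

/-- A lower bound for `Λ` times the value of the arm, for the wait `t` and the multiplier `L / Λ`,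
if `ω / Q` is an upper bound for the decaying factor. -/
def value (Q Λ L t ω : ℤ) : ℤ :=
  ((R.rn * Λ - L * R.rd) * R.X * R.D * (Q - ω) - L * R.rd * R.Y * (R.X + R.Y) * Q) /
    (R.rd * (R.X * R.D * (Q - ω) + t * R.Y * (R.X + R.Y) * Q))

end ArmCode

namespace FeedbackMAB

variable {n : ℕ} {M : FeedbackMAB n} {i : Fin n}

/-- The integers `R` encode the arm `i`, and are at most `U`. -/
structure Encodes (M : FeedbackMAB n) (i : Fin n) (R : ArmCode) (U : ℤ) : Prop where
  large : 32 ≤ U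
  α_eq : M.α i * R.ad = R.an
  β_eq : M.β i * R.bd = R.bn
  r_eq : M.r i * R.rd = R.rn
  ad_pos : 0 < R.ad
  bd_pos : 0 < R.bd
  rd_pos : 0 < R.rd
  D_le : R.D ≤ U
  rn_le : R.rn ≤ U
  rd_le : R.rd ≤ U

namespace Encodes

variable {R : ArmCode} {U : ℤ} (E : M.Encodes i R U)
include E

lemma D_pos : 0 < R.D := mul_pos E.ad_pos E.bd_pos
lemma α_mul : M.α i * R.D = R.X := by
  simp only [ArmCode.D, ArmCode.X]; push_cast; rw [← E.α_eq]; ring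
lemma β_mul : M.β i * R.D = R.Y := by
  simp only [ArmCode.D, ArmCode.Y]; push_cast; rw [← E.β_eq]; ring
lemma mix_mul : M.mix i * R.D = ((R.X + R.Y : ℤ) : ℝ) := by
  push_cast; rw [mix, add_mul, E.α_mul, E.β_mul]

lemma Y_nonneg : 0 ≤ R.Y := by
  have h : (0 : ℝ) ≤ R.Y := by
    rw [← E.β_mul]; exact mul_nonneg (M.β_nonneg i) (by exact_mod_cast E.D_pos.le)
  exact_mod_cast h

lemma scaled : M.Scaled i (U : ℝ) := by
  refine ⟨by exact_mod_cast E.large, inv_le_of_mul_eq (M.mix_pos i) E.D_pos E.D_le E.mix_mul,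
    fun h => inv_le_of_mul_eq h E.D_pos E.D_le E.α_mul, fun h => inv_le_of_mul_eq h E.rd_pos E.rd_le E.r_eq, ?_⟩
  have h1 : (1 : ℝ) ≤ R.rd := by exact_mod_cast E.rd_pos
  have h2 : (R.rn : ℝ) ≤ U := by exact_mod_cast E.rn_le
  have h3 := E.r_eq
  have h4 := M.r_nonneg i
  nlinarith

lemma margin_mul {Λ : ℤ} (hΛ : 0 < Λ) (L : ℤ) :
    M.margin i (L / Λ) * (R.rd * Λ * R.D ^ 2) = R.margin Λ L := by
  have hΛ' : (Λ : ℝ) ≠ 0 := by exact_mod_cast hΛ.ne'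
  have h1 := E.mix_mul
  push_cast at h1
  have : M.margin i (L / Λ) * (R.rd * Λ * R.D ^ 2) =
      ((M.r i * R.rd) * Λ - L * R.rd) * (M.α i * R.D) * R.D -
        L * R.rd * (M.β i * R.D) * (M.mix i * R.D) := by
    simp only [FeedbackMAB.margin]; field_simp
  rw [this, E.r_eq, E.α_mul, E.β_mul, h1]
  simp only [ArmCode.margin]; push_cast; ring

lemma waitCoeff_mul {Λ : ℤ} (hΛ : 0 < Λ) (L : ℤ) (t : ℕ) :
    M.waitCoeff i (L / Λ) t * (R.rd * Λ * R.D ^ 2) = R.coeff Λ L t := by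
  have hΛ' : (Λ : ℝ) ≠ 0 := by exact_mod_cast hΛ.ne'
  have h1 := E.mix_mul
  push_cast at h1
  have : M.waitCoeff i (L / Λ) t * (R.rd * Λ * R.D ^ 2) =
      ((M.r i * R.rd) * Λ - L * R.rd) * (M.α i * R.D) * (R.D + t * (M.mix i * R.D)) +
        L * R.rd * (M.α i * R.D) * (M.mix i * R.D) := by
    simp only [waitCoeff]; field_simp
  rw [this, E.r_eq, E.α_mul, h1]
  simp only [ArmCode.coeff]; push_cast; ring

lemma scale_pos {Λ : ℤ} (hΛ : 0 < Λ) : (0 : ℝ) < R.rd * Λ * R.D ^ 2 := by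
  have h1 : (0 : ℝ) < R.rd := by exact_mod_cast E.rd_pos
  have h2 : (0 : ℝ) < Λ := by exact_mod_cast hΛ
  have h3 : (0 : ℝ) < R.D := by exact_mod_cast E.D_pos
  positivity

lemma margin_pos_iff {Λ : ℤ} (hΛ : 0 < Λ) (L : ℤ) :
    0 < R.margin Λ L ↔ 0 < M.margin i (L / Λ) := by
  have h := E.margin_mul hΛ L
  have hs := E.scale_pos hΛ
  rw [← mul_pos_iff_of_pos_right hs, h]
  norm_cast

lemma test_iff {Λ : ℤ} (hΛ : 0 < Λ) (L x Q : ℤ) (t : ℕ) :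
    0 < x * R.coeff Λ L t - R.margin Λ L * Q ↔
      M.margin i (L / Λ) * Q < x * M.waitCoeff i (L / Λ) t := by
  have h := E.margin_mul hΛ L
  have h' := E.waitCoeff_mul hΛ L t
  have hs := E.scale_pos hΛ
  rw [sub_pos, ← mul_lt_mul_iff_of_pos_right hs]
  have e1 : M.margin i (L / Λ) * Q * (R.rd * Λ * R.D ^ 2) = ((R.margin Λ L * Q : ℤ) : ℝ) := by
    push_cast; rw [← h]; ring
  have e2 : x * M.waitCoeff i (L / Λ) t * (R.rd * Λ * R.D ^ 2) =
      ((x * R.coeff Λ L t : ℤ) : ℝ) := by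
    push_cast; rw [← h']; ring
  rw [e1, e2]
  norm_cast

/-- At multiples of `1 / U ^ 8` the margin is not tiny. -/
lemma margin_ge_of_coarse (G : ℤ) (h : 0 < M.margin i (G / (U ^ 8 : ℤ))) :
    (U : ℝ)⁻¹ ^ 11 ≤ M.margin i (G / (U ^ 8 : ℤ)) := by
  have hU : 0 < U := by have := E.large; omega
  have hU' : (0 : ℝ) < U := by exact_mod_cast hU
  have hΛ : 0 < U ^ 8 := by positivity
  have h1 : 1 ≤ R.margin (U ^ 8) G := (E.margin_pos_iff hΛ G).2 h
  have h2 : (1 : ℝ) ≤ R.margin (U ^ 8) G := by exact_mod_cast h1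
  rw [← E.margin_mul hΛ G] at h2
  have h3 : (R.rd : ℝ) * (U ^ 8 : ℤ) * R.D ^ 2 ≤ (U : ℝ) ^ 11 := by
    have h4 : (R.rd : ℝ) ≤ U := by exact_mod_cast E.rd_le
    have h5 : (R.D : ℝ) ≤ U := by exact_mod_cast E.D_le
    have h6 : (0 : ℝ) < R.D := by exact_mod_cast E.D_pos
    have h7 : (0 : ℝ) < R.rd := by exact_mod_cast E.rd_pos
    push_cast
    calc (R.rd : ℝ) * U ^ 8 * R.D ^ 2 ≤ U * U ^ 8 * U ^ 2 := by gcongr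
      _ = (U : ℝ) ^ 11 := by ring
  rw [inv_pow, inv_le_iff_one_le_mul₀ (by positivity)]
  nlinarith

lemma approx_decay {Q : ℤ} (hQ : 0 ≤ Q) :
    Approx Q (1 - M.mix i) 1 (Q * (R.D - (R.X + R.Y)) / R.D) := by
  have h1 := E.mix_mul
  have hD : (0 : ℝ) < R.D := by exact_mod_cast E.D_pos
  refine Approx.of_div hQ ?_ E.D_pos ?_
  · have : ((R.X + R.Y : ℤ) : ℝ) ≤ R.D := by
      rw [← h1]; have := M.mix_lt_one i; nlinarith
    have : R.X + R.Y ≤ R.D := by exact_mod_cast this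
    omega
  · push_cast at h1 ⊢; linarith

end Encodes

/-- `s` is `Λ` times the value of the arm, up to rounding, and `t` is optimal, for the multiplier
`L / Λ`. -/
def ArmDone (M : FeedbackMAB n) (i : Fin n) (Λ L : ℤ) (t : ℕ) (s : ℤ) : Prop :=
  M.IsThreshold (L / Λ) i t ∧ (s : ℝ) ≤ Λ * M.armOpt i (L / Λ) ∧ Λ * M.armOpt i (L / Λ) ≤ s + 2

lemma armDone_zero {Λ L : ℤ} (hΛ : 0 < Λ) (hL : 0 ≤ L) (h : M.margin i (L / Λ) ≤ 0) :
    M.ArmDone i Λ L 0 0 := by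
  have hlam : (0 : ℝ) ≤ L / Λ := div_nonneg (by exact_mod_cast hL) (by exact_mod_cast hΛ.le)
  have h1 := M.armOpt_eq_zero_of_margin_nonpos i hlam h
  exact ⟨Or.inr ⟨h1, rfl⟩, by simp [h1], by simp [h1]⟩

/-- The value of the arm with the wait `t`, if `1 - M.mix i` to the power `t` is replaced by `y`. -/
def roundedValue (M : FeedbackMAB n) (i : Fin n) (lam : ℝ) (t : ℕ) (y : ℝ) : ℝ :=
  ((M.r i - lam) * M.α i * (1 - y) - lam * M.β i * M.mix i) /
    (M.α i * (1 - y) + t * M.β i * M.mix i)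

lemma roundedValue_eq (lam : ℝ) (t : ℕ) :
    M.roundedValue i lam t ((1 - M.mix i) ^ t) = M.cycleValue i lam t := by
  have h := M.mix_mul_goodProb_false i t
  have hγ := (M.mix_pos i).ne'
  have e1 : (M.r i - lam) * M.α i * (1 - (1 - M.mix i) ^ t) - lam * M.β i * M.mix i =
      M.mix i * ((M.r i - lam) * M.goodProb i false t - lam * M.β i) := by
    linear_combination - (M.r i - lam) * h
  have e2 : M.α i * (1 - (1 - M.mix i) ^ t) + t * M.β i * M.mix i =
      M.mix i * M.cycleTime i t := by
    rw [cycleTime]; linear_combination - h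
  rw [roundedValue, e1, e2, mul_div_mul_left _ _ hγ, cycleValue]

lemma roundedValue_le {lam : ℝ} (h0 : 0 ≤ lam) (hr : lam ≤ M.r i) (hα : 0 < M.α i) (t : ℕ)
    {w y : ℝ} (hwy : w ≤ y) (hy : y < 1) :
    M.roundedValue i lam t y ≤ M.roundedValue i lam t w ∧
      (0 ≤ M.roundedValue i lam t w →
        M.roundedValue i lam t w ≤ M.roundedValue i lam t y + M.r i * ((y - w) / (1 - y))) := by
  have hβ := M.β_nonneg i
  have hγ := M.mix_pos i
  set c := M.r i - lam with hc
  have hc0 : 0 ≤ c := by linarith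
  set e := t * M.β i * M.mix i with he
  have he0 : 0 ≤ e := by positivity
  set d := lam * M.β i * M.mix i with hd
  have hd0 : 0 ≤ d := by positivity
  have h1y : 0 < 1 - y := by linarith
  have h1w : 0 < 1 - w := by linarith
  have hDy : 0 < M.α i * (1 - y) + e := by positivity
  have hDw : 0 < M.α i * (1 - w) + e := by positivity
  have key : M.roundedValue i lam t w - M.roundedValue i lam t y =
      M.α i * (y - w) * (c * e + d) / ((M.α i * (1 - w) + e) * (M.α i * (1 - y) + e)) := by
    simp only [roundedValue, ← hc, ← he, ← hd]
    rw [div_sub_div _ _ hDw.ne' hDy.ne']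
    congr 1; ring
  constructor
  · have : 0 ≤ M.α i * (y - w) * (c * e + d) /
        ((M.α i * (1 - w) + e) * (M.α i * (1 - y) + e)) := by
      have : 0 ≤ y - w := by linarith
      positivity
    linarith
  · intro hw
    have hN : 0 ≤ c * M.α i * (1 - w) - d := by
      simp only [roundedValue, ← hc, ← he, ← hd] at hw
      by_contra hneg
      exact absurd hw (not_le.2 (div_neg_of_neg_of_pos (not_le.1 hneg) hDw))
    have h2 : M.α i * (y - w) * (c * e + d) / ((M.α i * (1 - w) + e) * (M.α i * (1 - y) + e)) ≤
        M.r i * ((y - w) / (1 - y)) := by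
      rw [div_le_iff₀ (mul_pos hDw hDy)]
      have h3 : c * e + d ≤ M.r i * (M.α i * (1 - w) + e) := by nlinarith
      have h4 : M.α i * (y - w) * (c * e + d) ≤
          M.α i * (y - w) * (M.r i * (M.α i * (1 - w) + e)) :=
        mul_le_mul_of_nonneg_left h3 (mul_nonneg hα.le (by linarith))
      refine h4.trans ?_
      have h5 : M.r i * ((y - w) / (1 - y)) * ((M.α i * (1 - w) + e) * (M.α i * (1 - y) + e)) =
          M.r i * (y - w) * (M.α i * (1 - w) + e) * (M.α i + e / (1 - y)) := by
        field_simp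
      rw [h5]
      have h6 : 0 ≤ M.r i * (y - w) * (M.α i * (1 - w) + e) :=
        mul_nonneg (mul_nonneg (M.r_nonneg i) (by linarith)) hDw.le
      have h7 : 0 ≤ e / (1 - y) := by positivity
      nlinarith
    linarith

lemma Encodes.value_bounds {R : ArmCode} {U : ℤ} (E : M.Encodes i R U) {Q Λ : ℤ} (hΛ : 0 < Λ)
    (hQ : 0 < Q) (L : ℤ) (t : ℕ) (hα : 0 < M.α i) {ω : ℤ} (hω : ω < Q) :
    (R.value Q Λ L t ω : ℝ) ≤ Λ * M.roundedValue i (L / Λ) t (ω / Q) ∧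
      Λ * M.roundedValue i (L / Λ) t (ω / Q) ≤ R.value Q Λ L t ω + 1 := by
  have hΛ' : (0 : ℝ) < Λ := by exact_mod_cast hΛ
  have hQ' : (0 : ℝ) < Q := by exact_mod_cast hQ
  have hD : (0 : ℝ) < R.D := by exact_mod_cast E.D_pos
  have hrd : (0 : ℝ) < R.rd := by exact_mod_cast E.rd_pos
  have hω' : (0 : ℝ) < Q - ω := by have : (ω : ℝ) < Q := by exact_mod_cast hω
                                   linarith
  have hX : 0 < R.X := by
    have : (0 : ℝ) < R.X := by rw [← E.α_mul]; positivity
    exact_mod_cast this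
  have h1 := E.mix_mul
  push_cast at h1
  have hβ := M.β_nonneg i
  have hγ := M.mix_pos i
  have hden : 0 < R.rd * (R.X * R.D * (Q - ω) + t * R.Y * (R.X + R.Y) * Q) := by
    have := E.rd_pos
    have := E.D_pos
    have := E.Y_nonneg
    have : 0 < Q - ω := by omega
    positivity
  have e : Λ * M.roundedValue i (L / Λ) t (ω / Q) =
      (((R.rn * Λ - L * R.rd) * R.X * R.D * (Q - ω) - L * R.rd * R.Y * (R.X + R.Y) * Q : ℤ) : ℝ) /
        ((R.rd * (R.X * R.D * (Q - ω) + t * R.Y * (R.X + R.Y) * Q) : ℤ) : ℝ) := by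
    push_cast
    rw [← h1, ← E.α_mul, ← E.β_mul, ← E.r_eq, roundedValue]
    have h2 : M.α i * (1 - ω / Q) + t * M.β i * M.mix i ≠ 0 := by
      have : 0 < 1 - (ω : ℝ) / Q := by
        rw [sub_pos, div_lt_one hQ']; linarith
      positivity
    have h3 : (R.rd : ℝ) * (M.α i * R.D * R.D * (Q - ω) + t * (M.β i * R.D) * (M.mix i * R.D) * Q)
        ≠ 0 := by positivity
    rw [mul_div_assoc', div_eq_div_iff h2 h3]
    field_simp
  rw [e]
  exact ⟨intCast_ediv_le _ hden, div_le_intCast_ediv_add_one _ hden⟩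

/-- The outcome of the search for the optimal wait: waits up to `T` are too short, and waits from
`T + h` on seem to be long enough. -/
structure Search (M : FeedbackMAB n) (i : Fin n) (Q : ℤ) (lam : ℝ) (N T h : ℕ)
    (W : ℤ) : Prop where
  le : T + h ≤ N
  approx : Approx Q ((1 - M.mix i) ^ T) (2 * T) W
  short : M.waitGap i lam T ≤ 0
  long : T + h = N ∨ ∃ x : ℤ, Approx Q ((1 - M.mix i) ^ (T + h)) (2 * (T + h)) x ∧
    x * M.waitCoeff i lam (T + h) ≤ M.margin i lam * Q

section Certify

variable {R : ArmCode} {U : ℤ}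

lemma Search.certify (E : M.Encodes i R U) {L : ℤ} (hL : 0 ≤ L)
    (hm : (U : ℝ)⁻¹ ^ 12 ≤ M.margin i (L / (U ^ 36 : ℤ))) {N T : ℕ} {W : ℤ}
    (hN : (U : ℝ) ^ 14 ≤ N)
    (hN' : (N : ℝ) ≤ 2 * U ^ 14) (S : M.Search i (U ^ 80) (L / (U ^ 36 : ℤ)) N T 1 W) {P : ℤ}
    (hP : Approx (U ^ 80) (1 - M.mix i) 1 P) {ω : ℤ} (hω : ω = W * P / U ^ 80 + 2 * (T + 1)) :
    (0 < ω * R.coeff (U ^ 36) L (T + 1 : ℕ) - R.margin (U ^ 36) L * U ^ 80 →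
      M.NearTie i (2 * (U : ℝ) ^ 14) ((U : ℝ)⁻¹ ^ 46) (L / (U ^ 36 : ℤ))) ∧
    (¬ 0 < ω * R.coeff (U ^ 36) L (T + 1 : ℕ) - R.margin (U ^ 36) L * U ^ 80 →
      M.ArmDone i (U ^ 36) L (T + 1) (R.value (U ^ 80) (U ^ 36) L (T + 1 : ℕ) ω)) := by
  have hS := E.scaled
  have hU32 : (32 : ℝ) ≤ U := hS.large
  have hU0 : (0 : ℝ) < U := by linarith
  have hUi : 0 < U := by have := E.large; omega
  have hΛ : 0 < U ^ 36 := by positivity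
  have hQ : 0 < U ^ 80 := by positivity
  have hQ' : (0 : ℝ) < ((U ^ 80 : ℤ) : ℝ) := by exact_mod_cast hQ
  have hΛ' : (0 : ℝ) < ((U ^ 36 : ℤ) : ℝ) := by exact_mod_cast hΛ
  have hlam : (0 : ℝ) ≤ L / (U ^ 36 : ℤ) := div_nonneg (by exact_mod_cast hL) hΛ'.le
  have hκ0 : (0 : ℝ) < (U : ℝ)⁻¹ := by positivity
  have hκ : (U : ℝ)⁻¹ ≤ 1 / 32 := by rw [one_div]; exact inv_anti₀ (by norm_num) hU32
  have hκU : (U : ℝ)⁻¹ * U = 1 := inv_mul_cancel₀ hU0.ne'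
  have hm0 : 0 < M.margin i (L / (U ^ 36 : ℤ)) := (pow_pos hκ0 12).trans_le hm
  obtain ⟨hr, hα⟩ := M.lam_le_of_margin_pos i hlam hm0
  rw [E.test_iff hΛ]
  have hωle : Approx (U ^ 80) ((1 - M.mix i) ^ (T + 1)) (2 * (T + 1)) (W * P / U ^ 80) := by
    have h1 := S.approx.mul hQ hP (M.decay_pow_le_one i T) (by linarith [M.mix_pos i])
      (M.decay_pow_nonneg i T) (by positivity) (by norm_num)
    rw [pow_succ (1 - M.mix i) T]
    have e : (2 * (T : ℤ) + 1 + 1) = 2 * (T + 1) := by ring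
    rwa [e] at h1
  have hTN : (T : ℝ) + 1 ≤ N := by exact_mod_cast S.le
  have hTU : (T : ℝ) + 1 ≤ 2 * U ^ 14 := hTN.trans hN'
  -- the search does not end at the upper limit
  have hTne : T + 1 ≠ N := by
    intro h
    have h1 := M.wait_mul_margin_le i hlam S.short
    have h2 := mul_le_mul_of_nonneg_left hm (by positivity : (0 : ℝ) ≤ T)
    have h3 : (T : ℝ) * (U : ℝ)⁻¹ ^ 12 ≤ 2 * U := by
      have := hS.r_le; linarith
    have h4 := mul_le_mul_of_nonneg_right h3 (by positivity : (0 : ℝ) ≤ U ^ 12)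
    have h5 : (T : ℝ) * (U : ℝ)⁻¹ ^ 12 * U ^ 12 = T := by
      rw [mul_assoc, ← mul_pow, hκU]; ring
    have h6 : (U : ℝ) ^ 14 = U * (U * U ^ 12) := by ring
    have h7 : (N : ℝ) = T + 1 := by rw [← h]; push_cast; ring
    have h8 : (1 : ℝ) ≤ U ^ 12 := one_le_pow₀ (by linarith)
    have h9 : 32 * (U * U ^ 12) ≤ U * ((U : ℝ) * U ^ 12) :=
      mul_le_mul_of_nonneg_right hU32 (by positivity)
    have h10 : (1 : ℝ) ≤ U * U ^ 12 := by nlinarith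
    linarith
  obtain ⟨x, hx, hxle⟩ := S.long.resolve_left hTne
  set lam : ℝ := L / (U ^ 36 : ℤ) with hlamdef
  have hcoeff := M.waitCoeff_nonneg i hlam hr (T + 1)
  -- the rounding error is small
  have herr : 2 * ((T : ℝ) + 1) / ((U ^ 80 : ℤ) : ℝ) ≤ (U : ℝ)⁻¹ ^ 65 := by
    rw [div_le_iff₀ hQ']
    have e : (U : ℝ)⁻¹ ^ 65 * ((U ^ 80 : ℤ) : ℝ) = U * U ^ 14 := by
      push_cast
      have : (U : ℝ)⁻¹ ^ 65 * U ^ 80 = ((U : ℝ)⁻¹ * U) ^ 65 * (U * U ^ 14) := by ring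
      rw [this, hκU]; ring
    rw [e]
    have : (0 : ℝ) ≤ U ^ 14 := by positivity
    nlinarith
  have herr2 : 2 * ((T : ℝ) + 1) / ((U ^ 80 : ℤ) : ℝ) * M.waitCoeff i lam (T + 1) ≤
      (U : ℝ)⁻¹ ^ 46 := by
    have h1 : M.waitCoeff i lam (T + 1) ≤ U * (4 * U ^ 14) := by
      refine (M.waitCoeff_le' i hlam (T + 1)).trans ?_
      refine mul_le_mul hS.r_le ?_ (by positivity) hU0.le
      push_cast
      have : (1 : ℝ) ≤ U ^ 14 := one_le_pow₀ (by linarith)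
      linarith
    calc _ ≤ (U : ℝ)⁻¹ ^ 65 * (U * (4 * U ^ 14)) :=
          mul_le_mul herr h1 hcoeff (by positivity)
      _ = (U : ℝ)⁻¹ ^ 50 * 4 * ((U : ℝ)⁻¹ * U) ^ 15 := by ring
      _ = (U : ℝ)⁻¹ ^ 49 * ((U : ℝ)⁻¹ * 4) := by rw [hκU]; ring
      _ ≤ (U : ℝ)⁻¹ ^ 49 * 1 := by gcongr; linarith
      _ ≤ (U : ℝ)⁻¹ ^ 46 := by
          rw [mul_one]; exact pow_le_pow_of_le_one hκ0.le (by linarith) (by norm_num)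
  have hgap : M.waitGap i lam (T + 1) =
      M.margin i lam - (1 - M.mix i) ^ (T + 1) * M.waitCoeff i lam (T + 1) := rfl
  have hωr : (ω : ℝ) = ((W * P / U ^ 80 : ℤ) : ℝ) + 2 * ((T : ℝ) + 1) := by rw [hω]; push_cast; rfl
  set w := (1 - M.mix i) ^ (T + 1) with hw
  have hle : (((W * P / U ^ 80 : ℤ) : ℝ)) / ((U ^ 80 : ℤ) : ℝ) ≤ w := by
    rw [div_le_iff₀ hQ', mul_comm w]; exact hωle.le
  have hge : w ≤ (ω : ℝ) / ((U ^ 80 : ℤ) : ℝ) := by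
    rw [le_div_iff₀ hQ', mul_comm, hωr]
    have := hωle.ge; push_cast at this ⊢; linarith
  have hωw : (ω : ℝ) / ((U ^ 80 : ℤ) : ℝ) ≤ w + 2 * ((T : ℝ) + 1) / ((U ^ 80 : ℤ) : ℝ) := by
    rw [hωr, add_div]; linarith
  refine ⟨fun htie => ⟨T, hTU, hm0, S.short, ?_⟩, fun hok => ?_⟩
  · rw [hgap, abs_le]
    constructor
    · have h1 : w - 2 * ((T : ℝ) + 1) / ((U ^ 80 : ℤ) : ℝ) ≤ x / ((U ^ 80 : ℤ) : ℝ) := by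
        rw [sub_le_iff_le_add, ← add_div, le_div_iff₀ hQ', mul_comm]
        have := hx.ge; push_cast at this ⊢; linarith
      have h2 : x / ((U ^ 80 : ℤ) : ℝ) * M.waitCoeff i lam (T + 1) ≤ M.margin i lam := by
        rw [div_mul_eq_mul_div, div_le_iff₀ hQ']; exact hxle
      have h3 := mul_le_mul_of_nonneg_right h1 hcoeff
      linarith
    · have h2 : M.margin i lam ≤ (ω : ℝ) / ((U ^ 80 : ℤ) : ℝ) * M.waitCoeff i lam (T + 1) := by
        rw [div_mul_eq_mul_div, le_div_iff₀ hQ']; exact htie.le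
      have h3 := mul_le_mul_of_nonneg_right hωw hcoeff
      linarith
  · have hgap0 : 0 ≤ M.waitGap i lam (T + 1) := by
      have h2 : (ω : ℝ) / ((U ^ 80 : ℤ) : ℝ) * M.waitCoeff i lam (T + 1) ≤ M.margin i lam := by
        rw [div_mul_eq_mul_div, div_le_iff₀ hQ']; exact not_lt.1 hok
      have h3 := mul_le_mul_of_nonneg_right hge hcoeff
      rw [hgap]; linarith
    have hmax : ∀ s, 1 ≤ s → M.cycleValue i lam s ≤ M.cycleValue i lam (T + 1) := fun s hs =>
      M.cycleValue_le_of_waitGap i hr S.short hgap0 hs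
    have hT1 : 1 ≤ T + 1 := Nat.le_add_left _ _
    have hopt := M.armOpt_eq_cycleValue i hlam hm0 hT1 hmax
    have hpos := (M.armOpt_pos_iff i hlam).2 hm0
    have hw1 : w ≤ 1 - (U : ℝ)⁻¹ := by
      have h1 := M.decay_pow_anti i hT1
      simp only [pow_one] at h1
      have := hS.mix_ge
      linarith
    have herr3 : (U : ℝ)⁻¹ ^ 65 ≤ (U : ℝ)⁻¹ * (1 / 32) := by
      calc (U : ℝ)⁻¹ ^ 65 ≤ (U : ℝ)⁻¹ ^ 2 := pow_le_pow_of_le_one hκ0.le (by linarith) (by norm_num)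
        _ ≤ (U : ℝ)⁻¹ * (1 / 32) := by rw [pow_two]; gcongr
    have hy1 : (U : ℝ)⁻¹ / 2 ≤ 1 - (ω : ℝ) / ((U ^ 80 : ℤ) : ℝ) := by linarith
    have hωQ : ω < U ^ 80 := by
      have : (ω : ℝ) / ((U ^ 80 : ℤ) : ℝ) < 1 := by linarith
      rw [div_lt_one hQ'] at this
      exact_mod_cast this
    obtain ⟨hv1, hv2⟩ := E.value_bounds hΛ hQ L (T + 1) hα hωQ
    obtain ⟨hr1, hr2⟩ := roundedValue_le (M := M) hlam hr hα (T + 1) hge (by linarith)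
    have hcv := roundedValue_eq (M := M) (i := i) lam (T + 1)
    have hr2 := hr2 (by rw [hcv, ← hopt]; exact hpos.le)
    rw [hcv, ← hopt] at hr1 hr2
    refine ⟨Or.inl ⟨hpos, hT1, fun s hs => ?_⟩, ?_, ?_⟩
    · rw [M.armValue_eq i lam hs, M.armValue_eq i lam hT1]; exact hmax s hs
    · exact hv1.trans (mul_le_mul_of_nonneg_left hr1 hΛ'.le)
    · have h1 : M.r i * (((ω : ℝ) / ((U ^ 80 : ℤ) : ℝ) - w) / (1 - (ω : ℝ) / ((U ^ 80 : ℤ) : ℝ))) ≤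
          U * ((U : ℝ)⁻¹ ^ 65 / ((U : ℝ)⁻¹ / 2)) := by
        refine mul_le_mul hS.r_le ?_ (div_nonneg (by linarith) (by linarith)) hU0.le
        exact div_le_div₀ (by positivity) (by linarith) (by positivity) hy1
      have h2 : ((U ^ 36 : ℤ) : ℝ) * (U * ((U : ℝ)⁻¹ ^ 65 / ((U : ℝ)⁻¹ / 2))) ≤ 1 := by
        have e : ((U ^ 36 : ℤ) : ℝ) * (U * ((U : ℝ)⁻¹ ^ 65 / ((U : ℝ)⁻¹ / 2))) =
            2 * (U : ℝ)⁻¹ * (U : ℝ)⁻¹ ^ 26 := by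
          push_cast; field_simp
        rw [e]
        have : (U : ℝ)⁻¹ ^ 26 ≤ 1 := pow_le_one₀ hκ0.le (by linarith)
        have h3 : (0 : ℝ) < (U : ℝ)⁻¹ ^ 26 := by positivity
        nlinarith
      have h3 := mul_le_mul_of_nonneg_left h1 hΛ'.le
      have h4 := mul_le_mul_of_nonneg_left hr2 hΛ'.le
      linarith

end Certify

end FeedbackMAB

namespace FeedbackMAB

variable {n : ℕ} {M : FeedbackMAB n} {i : Fin n}

/-! ### The search for the optimal wait -/

lemma Search.init {Q : ℤ} (hQ : 0 ≤ Q) {lam : ℝ} (h0 : 0 ≤ lam) (N : ℕ) :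
    M.Search i Q lam N 0 N Q :=
  ⟨by simp, by simpa using Approx.one hQ, M.waitGap_zero_nonpos i h0, Or.inl (zero_add N)⟩

lemma Approx.decay_sq {Q : ℤ} (hQ : 0 < Q) {h : ℕ} (hh : 1 ≤ h) {P : ℤ}
    (hP : Approx Q ((1 - M.mix i) ^ h) (2 * h - 1) P) :
    Approx Q ((1 - M.mix i) ^ (2 * h)) (2 * (2 * h : ℕ) - 1) (P * P / Q) := by
  have h1 := hP.mul hQ hP (M.decay_pow_le_one i h) (M.decay_pow_le_one i h)
    (M.decay_pow_nonneg i h) (by omega) (by omega)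
  rw [← pow_add, ← two_mul] at h1
  convert h1 using 1
  push_cast; ring

lemma Search.candidate {Q : ℤ} (hQ : 0 < Q) {lam : ℝ} {N T h : ℕ} (hh : 1 ≤ h) {W P : ℤ}
    (S : M.Search i Q lam N T (2 * h) W) (hP : Approx Q ((1 - M.mix i) ^ h) (2 * h - 1) P) :
    Approx Q ((1 - M.mix i) ^ (T + h)) (2 * (T + h)) (W * P / Q) := by
  have h1 := S.approx.mul hQ hP (M.decay_pow_le_one i T) (M.decay_pow_le_one i h)
    (M.decay_pow_nonneg i T) (by omega) (by omega)
  rw [← pow_add] at h1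
  convert h1 using 1
  ring

lemma Search.accept {Q : ℤ} (hQ : 0 < Q) {lam : ℝ} (h0 : 0 ≤ lam) (hm : 0 < M.margin i lam)
    {N T h : ℕ} (hh : 1 ≤ h) {W P : ℤ} (S : M.Search i Q lam N T (2 * h) W)
    (hP : Approx Q ((1 - M.mix i) ^ h) (2 * h - 1) P)
    (htest : M.margin i lam * Q < ((W * P / Q : ℤ) : ℝ) * M.waitCoeff i lam (T + h)) :
    M.Search i Q lam N (T + h) h (W * P / Q) := by
  have hc := S.candidate hQ hh hP
  have hQ' : (0 : ℝ) < Q := by exact_mod_cast hQ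
  refine ⟨by have := S.le; omega, by push_cast; exact hc, ?_, ?_⟩
  · have h1 := mul_le_mul_of_nonneg_right hc.le
      (M.waitCoeff_nonneg i h0 (M.lam_le_of_margin_pos i h0 hm).1 (T + h))
    have h2 : Q * M.margin i lam ≤
        Q * ((1 - M.mix i) ^ (T + h) * M.waitCoeff i lam (T + h)) := by linarith
    have := le_of_mul_le_mul_left h2 hQ'
    unfold waitGap; linarith
  · have h3 := S.long
    have e : T + h + h = T + 2 * h := by ring
    rw [e]
    push_cast at h3 ⊢
    have e' : (2 : ℤ) * (T + h + h) = 2 * (T + 2 * h) := by ring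
    rw [e']
    exact h3

lemma Search.reject {Q : ℤ} (hQ : 0 < Q) {lam : ℝ}
    {N T h : ℕ} (hh : 1 ≤ h) {W P : ℤ} (S : M.Search i Q lam N T (2 * h) W)
    (hP : Approx Q ((1 - M.mix i) ^ h) (2 * h - 1) P)
    (htest : ¬ M.margin i lam * Q < ((W * P / Q : ℤ) : ℝ) * M.waitCoeff i lam (T + h)) :
    M.Search i Q lam N T h W :=
  ⟨by have := S.le; omega, S.approx, S.short, Or.inr ⟨_, S.candidate hQ hh hP, not_lt.1 htest⟩⟩

/-! ### The search for a balanced multiplier -/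

/-- Among `n + 1` neighbouring multipliers there is one without near ties. -/
lemma exists_not_nearTie {R : Fin n → ArmCode} {U : ℤ} (E : ∀ i, M.Encodes i (R i) U)
    (hU : 32 ≤ U) (hn : (n : ℤ) ≤ U) {G : ℤ} (hG : 0 ≤ G)
    (h : ∀ j : ℕ, j ≤ n → ∃ i, M.NearTie i (2 * (U : ℝ) ^ 14) ((U : ℝ)⁻¹ ^ 46)
      ((G * U ^ 28 + j : ℤ) / (U ^ 36 : ℤ))) : False := by
  have hU0 : (0 : ℝ) < U := by exact_mod_cast (by omega : 0 < U)
  have hκU : (U : ℝ)⁻¹ * U = 1 := inv_mul_cancel₀ hU0.ne'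
  choose f hf using fun j : Fin (n + 1) => h j (Nat.lt_succ_iff.1 j.2)
  have hval : ∀ j : ℕ, (((G * U ^ 28 + j : ℤ) : ℝ) / (U ^ 36 : ℤ)) =
      (G : ℝ) / (U ^ 8 : ℤ) + j * (U : ℝ)⁻¹ ^ 36 := by
    intro j; push_cast; field_simp
  have hκ0 : (0 : ℝ) < (U : ℝ)⁻¹ ^ 36 := by positivity
  have key : ∀ j k : Fin (n + 1), j < k → f j ≠ f k := by
    intro j k hjk hjk'
    have h1 := hf j
    have h2 := hf k
    rw [← hjk'] at h2
    rw [hval] at h1 h2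
    have hjk1 : ((j : ℕ) : ℝ) + 1 ≤ (k : ℕ) := by exact_mod_cast hjk
    have hkn : ((k : ℕ) : ℝ) ≤ U := by
      have : ((k : ℕ) : ℤ) ≤ U := by have := k.2; omega
      exact_mod_cast this
    refine (E (f j)).scaled.nearTie_unique (lam₀ := G / (U ^ 8 : ℤ)) ?_ ?_ ?_ ?_
      ((E (f j)).margin_ge_of_coarse G) h1 h2
    · push_cast; have : (0 : ℝ) ≤ G := by exact_mod_cast hG
      positivity
    · have : 0 ≤ ((j : ℕ) : ℝ) * (U : ℝ)⁻¹ ^ 36 := by positivity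
      linarith
    · nlinarith
    · have : (U : ℝ)⁻¹ ^ 35 = U * (U : ℝ)⁻¹ ^ 36 := by
        rw [pow_succ _ 35, mul_left_comm, mul_comm (U : ℝ), hκU, mul_one]
      rw [this]; nlinarith
  have hinj : Function.Injective f := by
    intro j k hjk
    rcases lt_trichotomy j k with h | h | h
    · exact absurd hjk (key j k h)
    · exact h
    · exact absurd hjk.symm (key k j h)
  have := Fintype.card_le_of_injective f hinj
  simp at this

/-- If the multiplier is large, then so is its numerator on the coarse scale. -/
lemma coarse_ge {R : Fin n → ArmCode} {U : ℤ} (E : ∀ i, M.Encodes i (R i) U) (hU : 32 ≤ U)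
    (hn : 16 * (n : ℤ) ≤ U) {i : Fin n} (hi : 0 < (R i).rn * (R i).an) {L G : ℤ} (hL : 0 ≤ L)
    (hLG : L ≤ G * U ^ 28 + n)
    (hlt : (U ^ 36 : ℤ) * ∑ i, M.armOpt i (L / (U ^ 36 : ℤ)) < L + 2 * n) : U ^ 4 ≤ G := by
  have hU32 : (32 : ℝ) ≤ U := by exact_mod_cast hU
  have hU0 : (0 : ℝ) < U := by linarith
  have hΛ' : (0 : ℝ) < ((U ^ 36 : ℤ) : ℝ) := by push_cast; positivity
  have hκU : (U : ℝ)⁻¹ * U = 1 := inv_mul_cancel₀ hU0.ne'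
  set lam : ℝ := L / (U ^ 36 : ℤ) with hlam
  have hlam0 : 0 ≤ lam := div_nonneg (by exact_mod_cast hL) hΛ'.le
  have hS := (E i).scaled
  have hrα : (U : ℝ)⁻¹ ^ 2 ≤ M.r i * M.α i := by
    have h1 : (0 : ℝ) < (R i).rn * (R i).an := by exact_mod_cast hi
    rw [← (E i).r_eq, ← (E i).α_eq] at h1
    have hd : (0 : ℝ) < (R i).rd * (R i).ad := by
      exact_mod_cast mul_pos (E i).rd_pos (E i).ad_pos
    have h2 : 0 < M.r i * M.α i := by
      have : M.r i * (R i).rd * (M.α i * (R i).ad) = M.r i * M.α i * ((R i).rd * (R i).ad) := by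
        ring
      rw [this] at h1
      exact pos_of_mul_pos_left h1 hd.le
    have hr : 0 < M.r i := pos_of_mul_pos_left h2 (M.α_nonneg i)
    have hα : 0 < M.α i := pos_of_mul_pos_right h2 (M.r_nonneg i)
    rw [pow_two]
    exact mul_le_mul (hS.r_ge hr) (hS.α_ge hα) (by positivity) hr.le
  have hopt : M.r i * M.α i - lam ≤ M.armOpt i lam := by
    rcases le_or_gt (M.r i * M.α i) lam with h | h
    · have := M.armOpt_nonneg i hlam0; linarith
    · refine le_trans ?_ (M.cycleValue_le_armOpt i hlam0 le_rfl)
      rw [cycleValue, le_div_iff₀ (M.cycleTime_pos i le_rfl), cycleTime, goodProb_false_one]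
      have h1 := M.bursty i
      have h2 := M.α_nonneg i
      have h3 := M.β_nonneg i
      have h4 := M.r_nonneg i
      push_cast
      nlinarith [mul_nonneg h4 h2]
  have hsum : M.armOpt i lam ≤ ∑ i, M.armOpt i lam :=
    Finset.single_le_sum (f := fun i => M.armOpt i lam) (fun i _ => M.armOpt_nonneg i hlam0)
      (mem_univ i)
  have hLlam : (L : ℝ) = lam * (U ^ 36 : ℤ) := by rw [hlam, div_mul_cancel₀ _ hΛ'.ne']
  have hnU : 16 * (n : ℝ) ≤ U := by exact_mod_cast hn
  have h1 : ((U ^ 36 : ℤ) : ℝ) * (U : ℝ)⁻¹ ^ 2 ≤ 2 * L + 2 * n := by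
    have := mul_le_mul_of_nonneg_left (hrα.trans (by linarith : M.r i * M.α i ≤
      ∑ i, M.armOpt i lam + lam)) hΛ'.le
    have e : ((U ^ 36 : ℤ) : ℝ) * (∑ i, M.armOpt i lam + lam) =
      ((U ^ 36 : ℤ) : ℝ) * (∑ i, M.armOpt i lam) + L := by rw [hLlam]; ring
    linarith
  have h2 : ((U ^ 36 : ℤ) : ℝ) * (U : ℝ)⁻¹ ^ 2 = (U : ℝ) ^ 34 := by
    push_cast
    have : (U : ℝ) ^ 36 * (U : ℝ)⁻¹ ^ 2 = U ^ 34 * ((U : ℝ)⁻¹ * U) ^ 2 := by ring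
    rw [this, hκU]; ring
  rw [h2] at h1
  have h3 : U ^ 34 ≤ 2 * L + 2 * n := by exact_mod_cast h1
  have hU28 : 1 ≤ U ^ 28 := one_le_pow₀ (by omega)
  by_contra hG
  have hG : G ≤ U ^ 4 := (not_le.1 hG).le
  have h4 : L ≤ U ^ 4 * U ^ 28 + n := hLG.trans (by gcongr)
  have h5 : U ^ 34 = U ^ 2 * (U ^ 4 * U ^ 28) := by ring
  have h6 : U ≤ U ^ 4 * U ^ 28 := by
    rw [← pow_add]; exact le_self_pow₀ (by omega) (by norm_num)
  have h7 : 32 * 32 ≤ U ^ 2 := by nlinarith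
  nlinarith

lemma isBalanced_of_bounds {U q L L' G G' : ℤ} (hU : 32 ≤ U) (hn : 16 * (n : ℤ) ≤ U) (hq : 1 ≤ q)
    (hqU : 16 * q ≤ U) (hG : U ^ 4 ≤ G) (hG' : G' = G - G / (8 * q)) (hL0 : 0 ≤ L)
    (hL : L ≤ G * U ^ 28 + n) (hL' : G' * U ^ 28 ≤ L')
    (h : (U ^ 36 : ℤ) * ∑ i, M.armOpt i (L / (U ^ 36 : ℤ)) ≤ L + 2 * n)
    (h' : L' ≤ (U ^ 36 : ℤ) * ∑ i, M.armOpt i (L' / (U ^ 36 : ℤ))) :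
    M.IsBalanced (1 / (2 * q)) (L' / (U ^ 36 : ℤ)) := by
  have hU0 : 0 < U := by omega
  have hΛ' : (0 : ℝ) < ((U ^ 36 : ℤ) : ℝ) := by exact_mod_cast (by positivity : 0 < U ^ 36)
  have hq' : (1 : ℝ) ≤ q := by exact_mod_cast hq
  -- the comparison of the two multipliers
  have hcmp : 2 * q * (L + 2 * n) ≤ (2 * q + 1) * L' := by
    have h1 : G * (8 * q - 1) ≤ 8 * q * G' := by
      have := Int.ediv_mul_le G (by omega : 8 * q ≠ 0)
      rw [hG']; linarith
    have hU28 : U ≤ U ^ 28 := le_self_pow₀ (by omega) (by norm_num)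
    have h2 : 8 * q * (2 * q * (L + 2 * n)) ≤ 8 * q * ((2 * q + 1) * L') := by
      have h3 : 8 * q * (2 * q * (L + 2 * n)) ≤ 8 * q * (2 * q * (G * U ^ 28 + 3 * n)) := by
        have h9 : 2 * q * (L + 2 * n) ≤ 2 * q * (G * U ^ 28 + 3 * n) :=
          mul_le_mul_of_nonneg_left (by linarith) (by omega)
        exact mul_le_mul_of_nonneg_left h9 (by omega)
      have h4 : (2 * q + 1) * (G * (8 * q - 1)) * U ^ 28 ≤ (2 * q + 1) * (8 * q * G') * U ^ 28 := by
        gcongr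
      have h5 : (2 * q + 1) * (8 * q) * (G' * U ^ 28) ≤ (2 * q + 1) * (8 * q) * L' := by
        gcongr
      have hU1 : U ≤ U ^ 4 := le_self_pow₀ (by omega) (by norm_num)
      have h6 : 16 * q * U ≤ G * U ^ 28 :=
        mul_le_mul (by linarith) hU28 (by omega) (by linarith)
      have h7 : 16 * q * (16 * n) ≤ 16 * q * U := by gcongr
      have h8 : 48 * q * q * n ≤ (6 * q - 1) * (G * U ^ 28) := by
        have h9 : 256 * (q * n) ≤ G * U ^ 28 := by linarith
        have h10 : 5 * q * (256 * (q * n)) ≤ (6 * q - 1) * (G * U ^ 28) := by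
          refine mul_le_mul (by omega) h9 (by positivity) (by omega)
        have : 0 ≤ q * q * n := by positivity
        linarith
      have e1 : 8 * q * (2 * q * (G * U ^ 28 + 3 * n)) =
        16 * q * q * (G * U ^ 28) + 48 * q * q * n := by ring
      have e2 : (2 * q + 1) * (G * (8 * q - 1)) * U ^ 28 =
        16 * q * q * (G * U ^ 28) + (6 * q - 1) * (G * U ^ 28) := by ring
      linarith
    exact le_of_mul_le_mul_left h2 (by omega)
  have hcmp' : 2 * (q : ℝ) * (L + 2 * n) ≤ (2 * q + 1) * L' := by exact_mod_cast hcmp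
  have hL0' : (0 : ℝ) ≤ L := by exact_mod_cast hL0
  have hL'0 : (0 : ℝ) ≤ L' := by
    by_contra hneg
    have h1 : 0 ≤ 2 * (q : ℝ) * (L + 2 * n) := by positivity
    nlinarith
  have hkey : ((L : ℝ) + 2 * n) / (U ^ 36 : ℤ) ≤ (1 + 1 / (2 * q)) * (L' / (U ^ 36 : ℤ)) := by
    rw [mul_div_assoc', div_le_div_iff_of_pos_right hΛ']
    have : (1 + 1 / (2 * (q : ℝ))) * L' = (2 * q + 1) * L' / (2 * q) := by field_simp
    rw [this, le_div_iff₀ (by positivity)]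
    linarith
  refine ⟨by positivity, ?_, ?_⟩
  · rw [div_le_iff₀ hΛ', mul_comm]; exact h'
  · have hle : (L : ℝ) / (U ^ 36 : ℤ) ≤ (1 + 1 / (2 * q)) * (L' / (U ^ 36 : ℤ)) := by
      refine le_trans ?_ hkey
      rw [div_le_div_iff_of_pos_right hΛ']
      have : (0 : ℝ) ≤ n := by positivity
      linarith
    refine (Finset.sum_le_sum fun i _ => M.armOpt_anti i (by positivity) hle).trans
      (le_trans ?_ hkey)
    rw [le_div_iff₀ hΛ', mul_comm]; exact h

end FeedbackMAB

/-- The logarithmic measure of the progress of the search. -/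
def progress (q G : ℤ) : ℕ := ⌊16 * (q : ℝ) * Real.log G⌋₊

lemma progress_lt {q G G' : ℤ} (hq : 1 ≤ q) (hG : 16 * q ≤ G) (hG' : G' = G - G / (8 * q)) :
    0 < G' ∧ progress q G' < progress q G := by
  have h1 : G ≤ 16 * q * (G / (8 * q)) := by
    have h2 := Int.lt_ediv_add_one_mul_self G (by omega : 0 < 8 * q)
    have h3 : 2 ≤ G / (8 * q) := by
      rw [Int.le_ediv_iff_mul_le (by omega)]; linarith
    nlinarith
  have h2 : G / (8 * q) * (8 * q) ≤ G := Int.ediv_mul_le G (by omega)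
  have hpos : 0 < G' := by
    have : 8 * q * G' ≥ (8 * q - 1) * G := by rw [hG']; nlinarith
    have h4 : 0 < (8 * q - 1) * G := by
      apply mul_pos <;> omega
    by_contra hneg
    have : 8 * q * G' ≤ 0 := mul_nonpos_of_nonneg_of_nonpos (by omega) (by omega)
    omega
  refine ⟨hpos, ?_⟩
  have hq' : (1 : ℝ) ≤ q := by exact_mod_cast hq
  have hGpos : (0 : ℝ) < G := by exact_mod_cast (by omega : 0 < G)
  have hG'pos : (0 : ℝ) < G' := by exact_mod_cast hpos
  have h3 : (16 * q : ℝ) * G' ≤ (16 * q - 1) * G := by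
    have : 16 * q * G' ≤ (16 * q - 1) * G := by rw [hG']; linarith
    exact_mod_cast this
  have h4 : Real.log G' ≤ Real.log G - 1 / (16 * q) := by
    have h5 : (G' : ℝ) / G ≤ 1 - 1 / (16 * q) := by
      rw [div_le_iff₀ hGpos]
      have : (1 - 1 / (16 * (q : ℝ))) * G = (16 * q - 1) * G / (16 * q) := by field_simp
      rw [this, le_div_iff₀ (by positivity)]; linarith
    have h6 := Real.log_le_sub_one_of_pos (div_pos hG'pos hGpos)
    rw [Real.log_div hG'pos.ne' hGpos.ne'] at h6
    linarith
  have h5 : 16 * (q : ℝ) * Real.log G' + 1 ≤ 16 * q * Real.log G := by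
    have := mul_le_mul_of_nonneg_left h4 (by positivity : (0 : ℝ) ≤ 16 * q)
    have e : 16 * (q : ℝ) * (Real.log G - 1 / (16 * q)) = 16 * q * Real.log G - 1 := by
      field_simp
    linarith
  have h6 : 0 ≤ Real.log (G' : ℝ) := Real.log_nonneg (by exact_mod_cast hpos)
  have h7 : ((progress q G' : ℕ) : ℝ) ≤ 16 * (q : ℝ) * Real.log G' :=
    Nat.floor_le (by positivity)
  refine Nat.lt_of_succ_le (Nat.le_floor ?_)
  push_cast; linarith

lemma progress_pow_le {q U : ℤ} (hq : 1 ≤ q) (hU : 1 ≤ U) (k : ℕ) :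
    progress q (U ^ k) ≤ 16 * q.toNat * (k * bitLen U) := by
  refine Nat.floor_le_of_le ?_
  have hq' : ((q.toNat : ℕ) : ℝ) = q := by
    exact_mod_cast Int.toNat_of_nonneg (by omega : 0 ≤ q)
  have hU' : (0 : ℝ) < U := by exact_mod_cast hU
  have h1 : Real.log U ≤ bitLen U := by
    have h2 : (U : ℝ) < 2 ^ (U.natAbs.size) := by
      have h3 : (U.natAbs : ℝ) = U := by
        have : (U.natAbs : ℤ) = U := Int.natAbs_of_nonneg (by omega)
        exact (Int.cast_natCast U.natAbs).symm.trans (by rw [this])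
      rw [← h3]; exact_mod_cast Nat.lt_size_self U.natAbs
    have h3 := Real.log_le_log hU' h2.le
    rw [Real.log_pow] at h3
    have h4 : Real.log 2 ≤ 1 := by have := Real.log_two_lt_d9; linarith
    have h5 : (U.natAbs.size : ℝ) ≤ bitLen U := by
      exact_mod_cast Nat.le_succ _
    have h6 : (0 : ℝ) ≤ U.natAbs.size := by positivity
    nlinarith
  push_cast
  rw [hq', Real.log_pow]
  have : (0 : ℝ) < q := by exact_mod_cast hq
  gcongr

/-! ### Frames -/

/-- The arrays that a program can change. -/
def Prog.Writes : Prog → ℕ → Prop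
  | skip, _ => False
  | set a _ _, b => b = a
  | seq p q, b => p.Writes b ∨ q.Writes b
  | ite _ p q, b => p.Writes b ∨ q.Writes b
  | loop _ p, b => p.Writes b

lemma Mem.store_ne {m : Mem} {a k b : ℕ} {z : ℤ} (h : b ≠ a) : m.store a k z b = m b := by
  funext j; simp [Mem.store, h]

lemma Mem.store_same (m : Mem) (a k j : ℕ) (z : ℤ) :
    m.store a k z a j = if j = k then z else m a j := by
  simp [Mem.store]

lemma Exec.frame {p : Prog} {m m' : Mem} {c : ℕ} (h : Exec p m c m') :
    ∀ a, ¬ p.Writes a → m' a = m a := by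
  induction h with
  | skip m => exact fun _ _ => rfl
  | set a e f m => exact fun b hb => Mem.store_ne hb
  | seq _ _ ih ih' =>
    exact fun a ha => (ih' a fun h => ha (Or.inr h)).trans (ih a fun h => ha (Or.inl h))
  | ite_pos _ _ ih => exact fun a ha => ih a fun h => ha (Or.inl h)
  | ite_neg _ _ ih => exact fun a ha => ih a fun h => ha (Or.inr h)
  | loop_pos _ _ _ ih ih' => exact fun a ha => (ih' a ha).trans (ih a ha)
  | loop_neg _ => exact fun _ _ => rfl

/-- The memory `m` differs from `m₀` only in arrays that `p` writes. -/
def Framed (p : Prog) (m₀ m : Mem) : Prop := ∀ a, ¬ p.Writes a → m a = m₀ a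

namespace Ensures

variable {B : ℕ} {p q : Prog} {m : Mem} {Q R : Mem → Prop}

lemma frame {k : ℕ} (h : Ensures B p m k Q) :
    Ensures B p m k fun m' => Q m' ∧ Framed p m m' := by
  obtain ⟨c, m', h1, h2, h3⟩ := h
  exact ⟨c, m', h1, h2, h3, h1.frame⟩

lemma loop_count' {e : Expr} {k N : ℕ} (I : ℕ → Mem → Prop) (hI : ∀ i m, I i m → m.Bdd B)
    (h1 : ∀ i m', i < N → Framed p m m' → I i m' →
      0 < e.eval m' ∧ Ensures B p m' k (I (i + 1)))
    (h2 : ∀ m', Framed p m m' → I N m' → ¬ 0 < e.eval m') (hm : I 0 m) :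
    Ensures B (.loop e p) m (N * (k + e.work + 1) + (e.work + 1))
      fun m' => I N m' ∧ Framed p m m' := by
  refine loop_count (fun i m' => I i m' ∧ Framed p m m') (fun i m h => hI i m h.1)
    (fun i m' hi h => ?_) (fun m' h => h2 m' h.2 h.1) ⟨hm, fun _ _ => rfl⟩
  obtain ⟨h3, h4⟩ := h1 i m' hi h.2 h.1
  exact ⟨h3, h4.frame.mono le_rfl fun m'' h5 => ⟨h5.1, fun a ha => (h5.2 a ha).trans (h.2 a ha)⟩⟩

lemma loop' {e : Expr} {k : ℕ} (I : Mem → Prop) (μ : Mem → ℕ) (hI : ∀ m, I m → m.Bdd B)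
    (h : ∀ m', Framed p m m' → I m' → 0 < e.eval m' →
      Ensures B p m' k fun m'' => I m'' ∧ μ m'' < μ m') (hm : I m) :
    Ensures B (.loop e p) m (μ m * (k + e.work + 1) + (e.work + 1))
      fun m' => I m' ∧ ¬ 0 < e.eval m' ∧ Framed p m m' := by
  refine (loop (fun m' => I m' ∧ Framed p m m') μ (fun m h => hI m h.1) (fun m' hm' he => ?_)
    ⟨hm, fun _ _ => rfl⟩).mono le_rfl fun m' h => ⟨h.1.1, h.2, h.1.2⟩
  exact (h m' hm'.2 hm'.1 he).frame.mono le_rfl fun m'' h5 =>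
    ⟨⟨h5.1.1, fun a ha => (h5.2 a ha).trans (hm'.2 a ha)⟩, h5.1.2⟩

end Ensures

/-! ### Expressions of the program -/

namespace Expr

/-- Powers with a fixed exponent. -/
def pow (e : Expr) : ℕ → Expr
  | 0 => const 1
  | k + 1 => mul (pow e k) e

lemma eval_pow (e : Expr) (k : ℕ) (m : Mem) : (e.pow k).eval m = e.eval m ^ k := by
  induction k with
  | zero => simp [pow, eval]
  | succ k ih => simp [pow, eval, ih, pow_succ]

/-- The numerator of `α` of the present arm, over the denominator `eD`. -/
def eX : Expr := mul (get 1 (var 9)) (get 4 (var 9))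
/-- The numerator of `β` of the present arm, over the denominator `eD`. -/
def eY : Expr := mul (get 3 (var 9)) (get 2 (var 9))
/-- The common denominator of `α` and `β` of the present arm. -/
def eD : Expr := mul (get 2 (var 9)) (get 4 (var 9))
/-- The denominator of the multiplier. -/
def eΛ : Expr := pow (var 10) 36
/-- The denominator of the approximations. -/
def eQ : Expr := pow (var 10) 80
/-- The difference of reward and multiplier, up to a factor. -/
def eC : Expr := sub (mul (get 5 (var 9)) eΛ) (mul (var 13) (get 6 (var 9)))
/-- Computes `ArmCode.margin`. -/
def eMargin : Expr := sub (mul (mul eC eX) eD)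
  (mul (mul (mul (var 13) (get 6 (var 9))) eY) (add eX eY))
/-- Computes `ArmCode.coeff`. -/
def eCoeff (t : Expr) : Expr := add (mul (mul eC eX) (add eD (mul t (add eX eY))))
  (mul (mul (mul (var 13) (get 6 (var 9))) eX) (add eX eY))
/-- Computes `ArmCode.value`. -/
def eValue (t : Expr) : Expr :=
  div (sub (mul (mul (mul eC eX) eD) (sub eQ (var 24)))
      (mul (mul (mul (mul (var 13) (get 6 (var 9))) eY) (add eX eY)) eQ))
    (mul (get 6 (var 9)) (add (mul (mul eX eD) (sub eQ (var 24)))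
      (mul (mul (mul t eY) (add eX eY)) eQ)))
/-- Positive if the approximation `x` of the decaying factor shows that the wait `t` is too short. -/
def eTest (x t : Expr) : Expr := sub (mul x (eCoeff t)) (mul eMargin eQ)

end Expr

/-- The memory holds the data of the arm `i` and the multiplier `L / U ^ 36`. -/
structure ArmView (R : ArmCode) (U L : ℤ) (i : ℕ) (m : Mem) : Prop where
  index : m 9 0 = i
  an : m 1 i = R.an
  ad : m 2 i = R.ad
  bn : m 3 i = R.bn
  bd : m 4 i = R.bd
  rn : m 5 i = R.rn
  rd : m 6 i = R.rd
  base : m 10 0 = U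
  mult : m 13 0 = L

namespace ArmView

variable {R : ArmCode} {U L : ℤ} {i : ℕ} {m : Mem}
open Expr

lemma congr (V : ArmView R U L i m) {m' : Mem}
    (h : ∀ a ∈ [1, 2, 3, 4, 5, 6, 9, 10, 13], m' a = m a) : ArmView R U L i m' := by
  obtain ⟨h1, h2, h3, h4, h5, h6, h7, h8, h9⟩ := V
  constructor <;> (rw [h _ (by simp)]; assumption)

variable (V : ArmView R U L i m)
include V

lemma eval_eX : eX.eval m = R.X := by
  simp only [eX, Expr.eval, Int.toNat_zero, V.index, Int.toNat_natCast, V.an, V.bd, ArmCode.X]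
lemma eval_eY : eY.eval m = R.Y := by
  simp only [eY, Expr.eval, Int.toNat_zero, V.index, Int.toNat_natCast, V.bn, V.ad, ArmCode.Y]
lemma eval_eD : eD.eval m = R.D := by
  simp only [eD, Expr.eval, Int.toNat_zero, V.index, Int.toNat_natCast, V.ad, V.bd, ArmCode.D]
lemma eval_eΛ : eΛ.eval m = U ^ 36 := by
  simp only [eΛ, Expr.eval_pow, Expr.eval, Int.toNat_zero, V.base]
lemma eval_eQ : eQ.eval m = U ^ 80 := by
  simp only [eQ, Expr.eval_pow, Expr.eval, Int.toNat_zero, V.base]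
lemma eval_eC : eC.eval m = R.rn * U ^ 36 - L * R.rd := by
  simp only [eC, Expr.eval, V.eval_eΛ, Int.toNat_zero, V.index, Int.toNat_natCast, V.rn, V.rd,
    V.mult]
lemma eval_eMargin : eMargin.eval m = R.margin (U ^ 36) L := by
  simp only [eMargin, Expr.eval, V.eval_eC, V.eval_eX, V.eval_eY, V.eval_eD, Int.toNat_zero,
    V.index, Int.toNat_natCast, V.rd, V.mult, ArmCode.margin]
lemma eval_eCoeff (t : Expr) : (eCoeff t).eval m = R.coeff (U ^ 36) L (t.eval m) := by
  simp only [eCoeff, Expr.eval, V.eval_eC, V.eval_eX, V.eval_eY, V.eval_eD, Int.toNat_zero,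
    V.index, Int.toNat_natCast, V.rd, V.mult, ArmCode.coeff]
lemma eval_eValue (t : Expr) :
    (eValue t).eval m = R.value (U ^ 80) (U ^ 36) L (t.eval m) (m 24 0) := by
  simp only [eValue, Expr.eval, V.eval_eC, V.eval_eX, V.eval_eY, V.eval_eD, V.eval_eQ,
    Int.toNat_zero, V.index, Int.toNat_natCast, V.rd, V.mult, ArmCode.value]
lemma eval_eTest (x t : Expr) : (eTest x t).eval m =
    x.eval m * R.coeff (U ^ 36) L (t.eval m) - R.margin (U ^ 36) L * U ^ 80 := by
  simp only [eTest, Expr.eval, V.eval_eCoeff, V.eval_eMargin, V.eval_eQ]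

end ArmView

/-- The length of the numbers in the memory of the program. -/
def memBits (U : ℤ) : ℕ := bitLen (U ^ 150)

lemma bitLen_le_memBits {U z : ℤ} (hU : 1 ≤ U) {k : ℕ} (hk : k ≤ 150) (h : |z| ≤ U ^ k) :
    bitLen z ≤ memBits U := by
  refine bitLen_le_bitLen (h.trans ?_)
  rw [abs_of_nonneg (by positivity)]
  exact pow_le_pow_right₀ hU hk

/-! ### The program for a single arm -/

section ArmProgram
open Expr Prog

/-- Starts the list of powers of the decay. -/
def armPrep : Prog := seq (set 19 (const 0) (div (mul eQ (sub eD (add eX eY))) eD))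
  (set 16 (const 0) (const 0))
/-- Squares the last power. -/
def powersBody : Prog :=
  seq (set 19 (add (var 16) (const 1)) (div (mul (get 19 (var 16)) (get 19 (var 16))) eQ))
    (set 16 (const 0) (add (var 16) (const 1)))
/-- Fills the list of powers. -/
def powersLoop : Prog := loop (sub (var 12) (var 16)) powersBody
/-- Starts the search for the optimal wait. -/
def searchInit : Prog := seq (set 17 (const 0) (const 0))
  (seq (set 18 (const 0) eQ) (set 23 (const 0) (var 11)))
/-- Computes the next candidate. -/
def searchCand : Prog := seq (set 16 (const 0) (sub (var 16) (const 1)))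
  (seq (set 23 (const 0) (div (var 23) (const 2)))
    (set 24 (const 0) (div (mul (var 18) (get 19 (var 16))) eQ)))
/-- Accepts or rejects the candidate. -/
def searchSelect : Prog := ite (eTest (var 24) (add (var 17) (var 23)))
  (seq (set 17 (const 0) (add (var 17) (var 23))) (set 18 (const 0) (var 24))) skip
/-- The search for the optimal wait. -/
def searchLoop : Prog := loop (var 16) (seq searchCand searchSelect)
/-- An upper bound for the decaying factor at the wait that was found. -/
def armBound : Prog := set 24 (const 0) (add (div (mul (var 18) (get 19 (const 0))) eQ)
  (mul (const 2) (add (var 17) (const 1))))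
/-- Stores the wait and adds the value of the arm. -/
def armStore : Prog := seq (set 8 (var 9) (add (var 17) (const 1)))
  (set 14 (const 0) (add (var 14) (eValue (add (var 17) (const 1)))))
/-- Reports a wait that is not certainly optimal, and stores it otherwise. -/
def armCertify : Prog := ite (eTest (var 24) (add (var 17) (const 1)))
  (set 15 (const 0) (const 1)) armStore
/-- The program for a profitable arm. -/
def armSearch : Prog := seq (seq armPrep powersLoop) (seq searchInit (seq searchLoop
  (seq armBound armCertify)))
/-- The program for an arm. -/
def armProg : Prog := ite eMargin armSearch (set 8 (var 9) (const 0))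

end ArmProgram

/-! ### Correctness of the program for a single arm -/

namespace FeedbackMAB

variable {n : ℕ} {M : FeedbackMAB n} {i : Fin n} {R : ArmCode} {U L : ℤ} {K : ℕ} {m : Mem}

lemma _root_.Approx.bitLen_le {u : ℝ} {d x : ℤ} (hU : 1 ≤ U) (h : Approx (U ^ 80) u d x)
    (hu : u ≤ 1) : bitLen x ≤ memBits U := by
  refine bitLen_le_memBits hU (by norm_num : 80 ≤ 150) ?_
  rw [abs_of_nonneg h.nonneg]
  have hU' : (0 : ℝ) ≤ ((U ^ 80 : ℤ) : ℝ) := by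
    have : (0 : ℤ) ≤ U ^ 80 := by positivity
    exact_mod_cast this
  exact_mod_cast h.le.trans (mul_le_of_le_one_right hU' hu)

/-- The memory is ready for the treatment of the arm `i` with the multiplier `L / U ^ 36`. -/
structure ArmReady (R : ArmCode) (U L : ℤ) (K i : ℕ) (m : Mem) : Prop
    extends ArmView R U L i m where
  bdd : m.Bdd (memBits U)
  size : m 11 0 = 2 ^ K
  log : m 12 0 = K

lemma ArmReady.congr {k : ℕ} (V : ArmReady R U L K k m) {m' : Mem} (h' : m'.Bdd (memBits U))
    {p : Prog} (hF : Framed p m m')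
    (hp : ∀ a ∈ [1, 2, 3, 4, 5, 6, 9, 10, 11, 12, 13], ¬ p.Writes a) : ArmReady R U L K k m' :=
  have h : ∀ a ∈ [1, 2, 3, 4, 5, 6, 9, 10, 11, 12, 13], m' a = m a := fun a ha => hF a (hp a ha)
  ⟨V.toArmView.congr fun a ha => h a (by simp at ha ⊢; tauto), h',
    by rw [h _ (by simp), V.size], by rw [h _ (by simp), V.log]⟩

lemma bitLen_natCast_le_memBits (hU : 32 ≤ U) {k : ℕ} (hk : (k : ℤ) ≤ 2 * U ^ 14) :
    bitLen k ≤ memBits U := by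
  refine bitLen_le_memBits (by linarith) (by norm_num : 15 ≤ 150) ?_
  rw [abs_of_nonneg (by positivity)]
  have : 2 * U ^ 14 ≤ U * U ^ 14 := mul_le_mul_of_nonneg_right (by linarith) (by positivity)
  calc (k : ℤ) ≤ U * U ^ 14 := hk.trans this
    _ = U ^ 15 := by ring

section
variable (E : M.Encodes i R U) (hK : (2 : ℤ) ^ K ≤ 2 * U ^ 14)
include E hK

lemma ensures_powers (V : ArmReady R U L K i m) :
    Ensures (memBits U) (.seq armPrep powersLoop) m
      (1 + armPrep.work + (K * (powersBody.work +
        (Expr.sub (.var 12) (.var 16)).work + 1) + ((Expr.sub (.var 12) (.var 16)).work + 1)))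
      fun m' => m'.Bdd (memBits U) ∧ m' 16 0 = K ∧ ∀ j ≤ K,
        Approx (U ^ 80) ((1 - M.mix i) ^ 2 ^ j) (2 * (2 ^ j : ℕ) - 1) (m' 19 j) := by
  have hU : 1 ≤ U := by linarith [E.large]
  have hQ : (0 : ℤ) < U ^ 80 := by positivity
  have hjb : ∀ j : ℕ, j ≤ K → bitLen j ≤ memBits U := fun j hj => by
    refine bitLen_natCast_le_memBits E.large (le_trans ?_ hK)
    exact_mod_cast hj.trans Nat.lt_two_pow_self.le
  have key : ∀ m', armPrep.run m' = (m'.store 19 0 (Expr.eval m'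
      (.div (.mul .eQ (.sub .eD (.add .eX .eY))) .eD))).store 16 0 0 := fun m' => rfl
  have h0 : Approx (U ^ 80) (1 - M.mix i) 1 (U ^ 80 * (R.D - (R.X + R.Y)) / R.D) :=
    E.approx_decay hQ.le
  refine Ensures.seq V.bdd.one_le (Ensures.frame (Ensures.of_run (Q := fun m' =>
    m'.Bdd (memBits U) ∧ m' 16 0 = 0 ∧
      m' 19 0 = U ^ 80 * (R.D - (R.X + R.Y)) / R.D) ⟨trivial, trivial⟩ V.bdd ?_)) ?_
  · rw [key]
    simp only [Expr.eval, V.eval_eQ, V.eval_eD, V.eval_eX, V.eval_eY]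
    refine ⟨(V.bdd.store (h0.bitLen_le hU ?_) _ _).store (by simpa using hjb 0 (by omega)) _ _, ?_, ?_⟩
    · simpa using M.decay_pow_le_one i 1
    · simp [Mem.store]
    · simp [Mem.store]
  · rintro m₁ ⟨⟨hb1, h16, h19⟩, hF⟩
    have V1 : ArmReady R U L K i m₁ := V.congr hb1 hF (by simp [armPrep, Prog.Writes])
    refine (Ensures.loop_count' (fun k m' => m'.Bdd (memBits U) ∧ m' 16 0 = k ∧ ∀ j ≤ k,
        Approx (U ^ 80) ((1 - M.mix i) ^ 2 ^ j) (2 * (2 ^ j : ℕ) - 1) (m' 19 j))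
        (fun _ _ h => h.1) (fun k m' hk hF h => ?_) (fun m' hF h => ?_) ?_).mono le_rfl
        fun m' h => h.1
    · obtain ⟨hb, hk', hA⟩ := h
      have V' : ArmReady R U L K i m' := V1.congr hb hF (by simp [powersBody, Prog.Writes])
      refine ⟨?_, Ensures.of_run ⟨trivial, trivial⟩ hb ?_⟩
      · simp only [Expr.eval, Int.toNat_zero, V'.log, hk']; simpa using hk
      · have e : powersBody.run m' =
            (m'.store 19 (k + 1) (m' 19 k * m' 19 k / U ^ 80)).store 16 0 ((k + 1 : ℕ) : ℤ) := by
          simp [powersBody, Prog.run, Expr.eval, hk', V'.eval_eQ, Mem.store]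
        have h1 := Approx.decay_sq hQ Nat.one_le_two_pow (hA k le_rfl)
        rw [e]
        refine ⟨(hb.store (h1.bitLen_le hU (M.decay_pow_le_one i _)) _ _).store
          (hjb _ hk) _ _, by simp [Mem.store], fun j hj => ?_⟩
        rcases Nat.lt_or_ge k j with h2 | h2
        · obtain rfl : j = k + 1 := by omega
          simpa [Mem.store, pow_succ'] using h1
        · have h3 : j ≠ k + 1 := by omega
          simpa [Mem.store, h3] using hA j h2
    · obtain ⟨hb, hk', hA⟩ := h
      have V' : ArmReady R U L K i m' := V1.congr hb hF (by simp [powersBody, Prog.Writes])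
      simp [Expr.eval, V'.log, hk']
    · refine ⟨hb1, by simpa using h16, fun j hj => ?_⟩
      obtain rfl : j = 0 := by omega
      rw [h19]; simpa using h0

lemma ensures_searchLoop (V : ArmReady R U L K i m) (hL : 0 ≤ L)
    (hm : 0 < M.margin i (L / (U ^ 36 : ℤ))) (h16 : m 16 0 = K)
    (hA : ∀ j ≤ K, Approx (U ^ 80) ((1 - M.mix i) ^ 2 ^ j) (2 * (2 ^ j : ℕ) - 1) (m 19 j))
    (h17 : m 17 0 = 0) (h18 : m 18 0 = U ^ 80) (h23 : m 23 0 = 2 ^ K) :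
    Ensures (memBits U) searchLoop m (K * (1 + searchCand.work + searchSelect.work +
        (Expr.var 16).work + 1) + ((Expr.var 16).work + 1))
      fun m' => m'.Bdd (memBits U) ∧ ∃ T : ℕ, m' 17 0 = T ∧
        M.Search i (U ^ 80) (L / (U ^ 36 : ℤ)) (2 ^ K) T 1 (m' 18 0) := by
  have hU : 1 ≤ U := by linarith [E.large]
  have hQ : (0 : ℤ) < U ^ 80 := by positivity
  have hΛ : (0 : ℤ) < U ^ 36 := by positivity
  have hlam : (0 : ℝ) ≤ L / (U ^ 36 : ℤ) :=
    div_nonneg (by exact_mod_cast hL) (by exact_mod_cast hΛ.le)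
  have hjb : ∀ j : ℕ, j ≤ 2 ^ K → bitLen j ≤ memBits U := fun j hj =>
    bitLen_natCast_le_memBits E.large (le_trans (by exact_mod_cast hj) hK)
  refine (Ensures.loop_count' (fun k m' => m'.Bdd (memBits U) ∧ ∃ j T : ℕ, k + j = K ∧
      m' 16 0 = j ∧ m' 17 0 = T ∧ m' 23 0 = (2 ^ j : ℕ) ∧
      M.Search i (U ^ 80) (L / (U ^ 36 : ℤ)) (2 ^ K) T (2 ^ j) (m' 18 0))
      (fun _ _ h => h.1) (fun k m' hk hF h => ?_) (fun m' hF h => ?_)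
      ⟨V.bdd, K, 0, by omega, h16, by simpa using h17, by simpa using h23, ?_⟩).mono le_rfl ?_
  · obtain ⟨hb, j, T, hj, h16, h17, h23, S⟩ := h
    obtain ⟨l, rfl⟩ : ∃ l, j = l + 1 := ⟨j - 1, by omega⟩
    have V' := V.congr hb hF (by simp [searchCand, searchSelect, Prog.Writes])
    have h19 : m' 19 = m 19 := hF 19 (by simp [searchCand, searchSelect, Prog.Writes])
    have hP : Approx (U ^ 80) ((1 - M.mix i) ^ 2 ^ l) (2 * (2 ^ l : ℕ) - 1) (m' 19 l) := by
      rw [h19]; exact hA l (by omega)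
    have hl := Nat.one_le_two_pow (n := l)
    rw [show 2 ^ (l + 1) = 2 * 2 ^ l from pow_succ' 2 l] at S
    have hC := S.candidate hQ hl hP
    have hlK : 2 ^ l ≤ 2 ^ K := Nat.pow_le_pow_right (by norm_num) (by omega)
    refine ⟨by simp only [Expr.eval, Int.toNat_zero, h16]; positivity, ?_⟩
    have e : searchCand.run m' = ((m'.store 16 0 l).store 23 0 (2 ^ l : ℕ)).store 24 0
        (m' 18 0 * m' 19 l / U ^ 80) := by
      have e1 : (2 : ℤ) ^ (l + 1) / 2 = 2 ^ l := by
        rw [pow_succ]; exact Int.mul_ediv_cancel _ (by norm_num)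
      simp [searchCand, Prog.run, Expr.eval, h16, h23, Mem.store, Expr.eQ, Expr.eval_pow, V'.base,
        e1]
    have hb1 : (searchCand.run m').Bdd (memBits U) := by
      rw [e]
      refine ((hb.store (hjb l ?_) _ _).store (hjb _ hlK) _ _).store
        (hC.bitLen_le hU (M.decay_pow_le_one i _)) _ _
      exact Nat.lt_two_pow_self.le.trans hlK
    refine Ensures.seq hb.one_le (Ensures.frame (Ensures.of_run
      (Q := fun m₁ => m₁ = searchCand.run m') ⟨trivial, trivial, trivial⟩ hb rfl)) ?_
    rintro m₁ ⟨hm₁, hF1⟩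
    rw [← hm₁] at hb1
    rw [e] at hm₁
    have V1 := V'.congr hb1 hF1 (by simp [searchCand, Prog.Writes])
    refine Ensures.of_run ⟨⟨trivial, trivial⟩, trivial⟩ hb1 ?_
    have g16 : m₁ 16 0 = l := by simp [hm₁, Mem.store]
    have g17 : m₁ 17 0 = T := by simp [hm₁, Mem.store, h17]
    have g18 : m₁ 18 0 = m' 18 0 := by simp [hm₁, Mem.store]
    have g23 : m₁ 23 0 = (2 ^ l : ℕ) := by simp [hm₁, Mem.store]
    have g24 : m₁ 24 0 = m' 18 0 * m' 19 l / U ^ 80 := by simp [hm₁, Mem.store]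
    have ht : 0 < (Expr.eTest (.var 24) (.add (.var 17) (.var 23))).eval m₁ ↔
        M.margin i (L / (U ^ 36 : ℤ)) * (U ^ 80 : ℤ) < ((m' 18 0 * m' 19 l / U ^ 80 : ℤ) : ℝ) *
          M.waitCoeff i (L / (U ^ 36 : ℤ)) (T + 2 ^ l : ℕ) := by
      rw [← E.test_iff hΛ, V1.eval_eTest]
      simp only [Expr.eval, Int.toNat_zero, g17, g23, g24]
      push_cast; rfl
    have hTN : T + 2 ^ l ≤ 2 ^ K := by have := S.le; omega
    simp only [searchSelect, Prog.run]
    split_ifs with hc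
    · have hc' := ht.1 hc
      have e2 : Mem.store (m₁.store 17 (Expr.eval m₁ (.const 0)).toNat
          (Expr.eval m₁ (.add (.var 17) (.var 23)))) 18 0 (m₁ 24 0) =
          (m₁.store 17 0 ((T + 2 ^ l : ℕ) : ℤ)).store 18 0 (m' 18 0 * m' 19 l / U ^ 80) := by
        simp [Expr.eval, g17, g23, g24]
      have e3 : ∀ m₂ : Mem, Mem.store m₂ 18 (Expr.eval m₂ (.const 0)).toNat
          (Expr.eval m₂ (.var 24)) = m₂.store 18 0 (m₂ 24 0) := fun m₂ => rfl
      rw [e3, Mem.store_ne (by norm_num : 24 ≠ 17), e2]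
      refine ⟨(hb1.store (hjb _ hTN) _ _).store
        (hC.bitLen_le hU (M.decay_pow_le_one i _)) _ _, l, T + 2 ^ l, by omega, ?_, ?_, ?_, ?_⟩
      · simpa [Mem.store] using g16
      · simp [Mem.store]
      · simpa [Mem.store] using g23
      · have := S.accept hQ hlam hm hl hP (by exact_mod_cast hc')
        simpa [Mem.store] using this
    · refine ⟨hb1, l, T, by omega, g16, g17, g23, ?_⟩
      rw [g18]
      exact S.reject hQ hl hP (fun h => hc (ht.2 (by exact_mod_cast h)))
  · obtain ⟨hb, j, T, hj, h16, -⟩ := h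
    simp only [Expr.eval, Int.toNat_zero, h16]; omega
  · rw [h18]; simpa using Search.init hQ.le hlam (2 ^ K)
  · rintro m' ⟨⟨hb, j, T, hj, h16, h17, h23, S⟩, -⟩
    obtain rfl : j = 0 := by omega
    exact ⟨hb, T, h17, by simpa using S⟩

end

/-- The effect of `armProg`. -/
structure ArmStep (M : FeedbackMAB n) (i : Fin n) (U L : ℤ) (m m' : Mem) : Prop where
  bdd : m'.Bdd (memBits U)
  sum_le : |m' 14 0 - m 14 0| ≤ U ^ 38
  waits : ∀ j : ℕ, j ≠ i → m' 8 j = m 8 j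
  result : (m' 15 0 = 1 ∧
      M.NearTie i (2 * (U : ℝ) ^ 14) ((U : ℝ)⁻¹ ^ 46) (L / (U ^ 36 : ℤ))) ∨
    (m' 15 0 = m 15 0 ∧ ∃ t : ℕ, m' 8 i = t ∧ M.ArmDone i (U ^ 36) L t (m' 14 0 - m 14 0))

lemma ArmDone.abs_le (E : M.Encodes i R U) (hL : 0 ≤ L) {t : ℕ} {s : ℤ}
    (h : M.ArmDone i (U ^ 36) L t s) : |s| ≤ U ^ 38 := by
  obtain ⟨-, h1, h2⟩ := h
  have hU := E.large
  have hΛ : (0 : ℤ) < U ^ 36 := by positivity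
  have hΛ' : (0 : ℝ) < (U ^ 36 : ℤ) := by exact_mod_cast hΛ
  have hlam : (0 : ℝ) ≤ L / (U ^ 36 : ℤ) := div_nonneg (by exact_mod_cast hL) hΛ'.le
  have h3 : M.armOpt i (L / (U ^ 36 : ℤ)) ≤ U := by
    have hr := E.scaled.r_le
    rcases le_total (L / (U ^ 36 : ℤ) : ℝ) U with h | h
    · have := M.armOpt_le_add i hlam h
      rw [M.armOpt_of_r_le i (by linarith [E.scaled.large]) hr] at this
      linarith
    · rw [M.armOpt_of_r_le i hlam (hr.trans h)]; linarith [E.scaled.large]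
  have h4 : (s : ℝ) ≤ ((U ^ 36 * U : ℤ) : ℝ) := by
    push_cast at h1 ⊢
    exact h1.trans (mul_le_mul_of_nonneg_left (by push_cast at h3; exact h3) (by exact_mod_cast hΛ.le))
  have h5 : s ≤ U ^ 36 * U := by exact_mod_cast h4
  have h6 : (0 : ℝ) ≤ ((s + 2 : ℤ) : ℝ) := by
    push_cast
    exact (mul_nonneg hΛ'.le (M.armOpt_nonneg i hlam)).trans (by simpa using h2)
  have h7 : 0 ≤ s + 2 := by exact_mod_cast h6
  have h8 : U ^ 36 * U ≤ U ^ 36 * (U * U) := mul_le_mul_of_nonneg_left (by nlinarith) hΛ.le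
  have h9 : (2 : ℤ) ≤ U ^ 38 := by
    calc (2 : ℤ) ≤ U := by linarith
      _ = U ^ 1 := (pow_one U).symm
      _ ≤ U ^ 38 := pow_le_pow_right₀ (by linarith) (by norm_num)
  rw [_root_.abs_le]
  constructor
  · linarith
  · calc s ≤ U ^ 36 * (U * U) := h5.trans h8
      _ = U ^ 38 := by ring

lemma ensures_armCertify (E : M.Encodes i R U) (hK : (2 : ℤ) ^ K ≤ 2 * U ^ 14)
    (hK' : U ^ 14 ≤ 2 ^ K) (V : ArmReady R U L K i m) (hL : 0 ≤ L)
    (hm : (U : ℝ)⁻¹ ^ 12 ≤ M.margin i (L / (U ^ 36 : ℤ))) (hs : |m 14 0| ≤ U ^ 60)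
    {T : ℕ} {W : ℤ} (h17 : m 17 0 = T)
    (S : M.Search i (U ^ 80) (L / (U ^ 36 : ℤ)) (2 ^ K) T 1 W) {P : ℤ}
    (hP : Approx (U ^ 80) (1 - M.mix i) 1 P) (h24 : m 24 0 = W * P / U ^ 80 + 2 * (T + 1)) :
    Ensures (memBits U) armCertify m armCertify.work (M.ArmStep i U L m) := by
  have hU : 1 ≤ U := by linarith [E.large]
  obtain ⟨c1, c2⟩ := S.certify E hL hm (by exact_mod_cast hK') (by exact_mod_cast hK) hP h24
  have ht : (Expr.eTest (.var 24) (.add (.var 17) (.const 1))).eval m =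
      m 24 0 * R.coeff (U ^ 36) L (T + 1 : ℕ) - R.margin (U ^ 36) L * U ^ 80 := by
    rw [V.eval_eTest]; simp [Expr.eval, h17]
  refine Ensures.of_run ⟨trivial, trivial, trivial⟩ V.bdd ?_
  simp only [armCertify, Prog.run]
  rw [ht]
  split_ifs with hc
  · refine ⟨V.bdd.store ((bitLen_le_memBits hU (by norm_num : 0 ≤ 150) (by simp [Expr.eval])))
      _ _, ?_, fun j _ => by simp [Mem.store], Or.inl ⟨by simp [Mem.store, Expr.eval], c1 hc⟩⟩
    simp only [Mem.store, show (14 : ℕ) ≠ 15 by norm_num, false_and, if_false, sub_self, abs_zero]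
    positivity
  · have hd := c2 hc
    set s := R.value (U ^ 80) (U ^ 36) L (T + 1 : ℕ) (m 24 0) with hsdef
    have e : armStore.run m = (m.store 8 i ((T + 1 : ℕ) : ℤ)).store 14 0 (m 14 0 + s) := by
      have V' : ArmView R U L i (m.store 8 i ((T + 1 : ℕ) : ℤ)) := V.toArmView.congr fun a ha =>
        Mem.store_ne (by rintro rfl; simp at ha)
      have e1 : armStore.run m = (m.store 8 i ((T + 1 : ℕ) : ℤ)).store 14 0
          (Expr.eval (m.store 8 i ((T + 1 : ℕ) : ℤ))
            (.add (.var 14) (Expr.eValue (.add (.var 17) (.const 1))))) := by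
        simp [armStore, Prog.run, Expr.eval, V.index, h17]
      rw [e1, Expr.eval, V'.eval_eValue]
      simp [Expr.eval, Mem.store, h17, hsdef]
    have hs' := hd.abs_le E hL
    have hT : ((T + 1 : ℕ) : ℤ) ≤ 2 * U ^ 14 := le_trans (by exact_mod_cast S.le) hK
    have hsum : |m 14 0 + s| ≤ U ^ 61 := by
      have h1 : U ^ 38 ≤ U ^ 60 := pow_le_pow_right₀ hU (by norm_num)
      have h2 : 2 * U ^ 60 ≤ U * U ^ 60 :=
        mul_le_mul_of_nonneg_right (by linarith [E.large]) (by positivity)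
      calc |m 14 0 + s| ≤ |m 14 0| + |s| := abs_add_le _ _
        _ ≤ U * U ^ 60 := by linarith
        _ = U ^ 61 := by ring
    rw [e]
    refine ⟨(V.bdd.store (bitLen_natCast_le_memBits E.large hT) _ _).store
      (bitLen_le_memBits hU (by norm_num) hsum) _ _, ?_, fun j hj => by simp [Mem.store, hj],
      Or.inr ⟨by simp [Mem.store], T + 1, by simp [Mem.store], ?_⟩⟩
    · simpa [Mem.store] using hs'
    · simpa [Mem.store] using hd

/-- The running time of `armProg`, up to the factor `K + 1`. -/
def armWork : ℕ := 10 + Expr.eMargin.work + (Prog.set 8 (.var 9) (.const 0)).work + armPrep.work +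
  powersBody.work + 2 * (Expr.sub (.var 12) (.var 16)).work + searchInit.work + searchCand.work +
  searchSelect.work + 2 * (Expr.var 16).work + armBound.work + armCertify.work

lemma ensures_armProg (E : M.Encodes i R U) (hK : (2 : ℤ) ^ K ≤ 2 * U ^ 14)
    (hK' : U ^ 14 ≤ 2 ^ K) (V : ArmReady R U L K i m) (hL : 0 ≤ L)
    (hm : 0 < M.margin i (L / (U ^ 36 : ℤ)) →
      (U : ℝ)⁻¹ ^ 12 ≤ M.margin i (L / (U ^ 36 : ℤ))) (hs : |m 14 0| ≤ U ^ 60) :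
    Ensures (memBits U) armProg m (armWork * (K + 1)) (M.ArmStep i U L m) := by
  have hU : 1 ≤ U := by linarith [E.large]
  have hQ : (0 : ℤ) < U ^ 80 := by positivity
  have hΛ : (0 : ℤ) < U ^ 36 := by positivity
  have hB := V.bdd.one_le
  refine (Ensures.ite (k := armWork * (K + 1) - (1 + Expr.eMargin.work)) V.bdd
    (fun h => ?_) (fun h => ?_)).mono ?_ fun _ h => h
  · rw [V.eval_eMargin, E.margin_pos_iff hΛ] at h
    refine (Ensures.seq hB (ensures_powers E hK V).frame
      (k' := 1 + searchInit.work + (1 + (K * (1 + searchCand.work + searchSelect.work +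
        (Expr.var 16).work + 1) + ((Expr.var 16).work + 1)) +
        (1 + armBound.work + armCertify.work))) ?_).mono ?_ fun _ h => h
    · rintro m₁ ⟨⟨hb1, h16, hA⟩, hF1⟩
      have V1 := V.congr hb1 hF1 (by simp [armPrep, powersLoop, powersBody, Prog.Writes])
      refine Ensures.seq hB (Ensures.frame (Ensures.of_run (Q := fun m' =>
        m'.Bdd (memBits U) ∧ m' 17 0 = 0 ∧ m' 18 0 = U ^ 80 ∧ m' 23 0 = 2 ^ K)
        ⟨trivial, trivial, trivial⟩ hb1 ?_)) ?_
      · have e : searchInit.run m₁ =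
            ((m₁.store 17 0 0).store 18 0 (U ^ 80)).store 23 0 (2 ^ K) := by
          simp [searchInit, Prog.run, Expr.eval, Expr.eQ, Expr.eval_pow, Mem.store, V1.base,
            V1.size]
        rw [e]
        refine ⟨((hb1.store ?_ _ _).store ?_ _ _).store ?_ _ _, ?_, ?_, ?_⟩
        · exact bitLen_le_memBits hU (by norm_num : 0 ≤ 150) (by simp)
        · exact bitLen_le_memBits hU (by norm_num : 80 ≤ 150) (abs_of_pos hQ).le
        · have := bitLen_natCast_le_memBits E.large (k := 2 ^ K) (by exact_mod_cast hK)
          exact_mod_cast this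
        · simp [Mem.store]
        · simp [Mem.store]
        · simp [Mem.store]
      rintro m₂ ⟨⟨hb2, h17, h18, h23⟩, hF2⟩
      have V2 := V1.congr hb2 hF2 (by simp [searchInit, Prog.Writes])
      rw [← hF2 16 (by simp [searchInit, Prog.Writes])] at h16
      have e19 : m₂ 19 = m₁ 19 := hF2 19 (by simp [searchInit, Prog.Writes])
      rw [← e19] at hA
      refine Ensures.seq hB (ensures_searchLoop E hK V2 hL h h16 hA h17 h18 h23).frame ?_
      rintro m₃ ⟨⟨hb3, T, h17, S⟩, hF3⟩
      have V3 := V2.congr hb3 hF3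
        (by simp [searchLoop, searchCand, searchSelect, Prog.Writes])
      have e19' : m₃ 19 = m₂ 19 :=
        hF3 19 (by simp [searchLoop, searchCand, searchSelect, Prog.Writes])
      have hP : Approx (U ^ 80) (1 - M.mix i) 1 (m₃ 19 0) := by
        rw [e19']; simpa using hA 0 (by omega)
      have hT : ((T + 1 : ℕ) : ℤ) ≤ 2 * U ^ 14 := le_trans (by exact_mod_cast S.le) hK
      have e : armBound.run m₃ =
          m₃.store 24 0 (m₃ 18 0 * m₃ 19 0 / U ^ 80 + 2 * (T + 1)) := by
        simp [armBound, Prog.run, Expr.eval, Expr.eQ, Expr.eval_pow, V3.base, h17]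
      have hC := (S.approx.mul hQ hP (M.decay_pow_le_one i T)
        (by simpa using M.decay_pow_le_one i 1)
        (pow_nonneg (by linarith [M.mix_lt_one i]) T) (by positivity) (by norm_num))
      have hCle : m₃ 18 0 * m₃ 19 0 / U ^ 80 ≤ U ^ 80 := by
        have h1 : (1 - M.mix i) ^ T * (1 - M.mix i) ≤ 1 := by
          rw [← pow_succ]; exact M.decay_pow_le_one i _
        have h2 : (0 : ℝ) ≤ ((U ^ 80 : ℤ) : ℝ) := by exact_mod_cast hQ.le
        exact_mod_cast hC.le.trans (mul_le_of_le_one_right h2 h1)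
      have hω : bitLen (m₃ 18 0 * m₃ 19 0 / U ^ 80 + 2 * (T + 1)) ≤ memBits U := by
        refine bitLen_le_memBits hU (by norm_num : 81 ≤ 150) ?_
        rw [abs_of_nonneg (add_nonneg hC.nonneg (by positivity))]
        have h1 : U ^ 14 ≤ U ^ 80 := pow_le_pow_right₀ hU (by norm_num)
        have h2 : 5 * U ^ 80 ≤ U * U ^ 80 :=
          mul_le_mul_of_nonneg_right (by linarith [E.large]) hQ.le
        push_cast at hT
        calc _ ≤ U * U ^ 80 := by linarith
          _ = U ^ 81 := by ring
      refine (Ensures.seq hB (Ensures.of_run (Q := fun m' => m' =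
        m₃.store 24 0 (m₃ 18 0 * m₃ 19 0 / U ^ 80 + 2 * (T + 1))) trivial hb3 e)
        (k' := armCertify.work) ?_)
      rintro m₄ rfl
      have e14 : m₃ 14 = m 14 :=
        (hF3 14 (by simp [searchLoop, searchCand, searchSelect, Prog.Writes])).trans
          ((hF2 14 (by simp [searchInit, Prog.Writes])).trans
            (hF1 14 (by simp [armPrep, powersLoop, powersBody, Prog.Writes])))
      have e15 : m₃ 15 = m 15 :=
        (hF3 15 (by simp [searchLoop, searchCand, searchSelect, Prog.Writes])).trans
          ((hF2 15 (by simp [searchInit, Prog.Writes])).trans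
            (hF1 15 (by simp [armPrep, powersLoop, powersBody, Prog.Writes])))
      have e8 : m₃ 8 = m 8 :=
        (hF3 8 (by simp [searchLoop, searchCand, searchSelect, Prog.Writes])).trans
          ((hF2 8 (by simp [searchInit, Prog.Writes])).trans
            (hF1 8 (by simp [armPrep, powersLoop, powersBody, Prog.Writes])))
      have e14' := fun z => Mem.store_ne (m := m₃) (a := 24) (k := 0) (z := z)
        (by norm_num : 14 ≠ 24)
      have V4 : ArmReady R U L K i
          (m₃.store 24 0 (m₃ 18 0 * m₃ 19 0 / U ^ 80 + 2 * (T + 1))) := by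
        have := V3.congr (p := .set 24 (.const 0) (.const 0)) (hb3.store hω 24 0)
          (fun a ha => Mem.store_ne ha) (by simp [Prog.Writes])
        exact this
      refine (ensures_armCertify E hK hK' V4 hL (hm h) ?_ (T := T) (W := m₃ 18 0) ?_ S hP
        ?_).mono le_rfl fun m' A => ⟨A.bdd, ?_, fun j hj => ?_, ?_⟩
      · rwa [e14', e14]
      · simpa [Mem.store] using h17
      · simp [Mem.store]
      · have := A.sum_le; rwa [e14', e14] at this
      · rw [A.waits j hj, Mem.store_ne (by norm_num : 8 ≠ 24), e8]
      · have := A.result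
        rwa [e14', e14, Mem.store_ne (by norm_num : 15 ≠ 24), e15] at this
    · have h1 : K * (powersBody.work + (Expr.sub (.var 12) (.var 16)).work + 1) +
          K * (1 + searchCand.work + searchSelect.work + (Expr.var 16).work + 1) ≤
          K * armWork := by
        rw [← mul_add]
        refine Nat.mul_le_mul_left _ ?_
        unfold armWork
        linarith [Nat.zero_le Expr.eMargin.work, Nat.zero_le armPrep.work,
          Nat.zero_le searchInit.work, Nat.zero_le armBound.work, Nat.zero_le armCertify.work,
          Nat.zero_le (Prog.set 8 (.var 9) (.const 0)).work, Nat.zero_le (Expr.var 16).work,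
          Nat.zero_le (Expr.sub (.var 12) (.var 16)).work]
      have h2 : 5 + Expr.eMargin.work + armPrep.work + (Expr.sub (.var 12) (.var 16)).work +
          searchInit.work + (Expr.var 16).work + armBound.work + armCertify.work + 5 ≤
          armWork := by
        unfold armWork
        linarith [Nat.zero_le powersBody.work, Nat.zero_le searchCand.work,
          Nat.zero_le searchSelect.work,
          Nat.zero_le (Prog.set 8 (.var 9) (.const 0)).work, Nat.zero_le (Expr.var 16).work,
          Nat.zero_le (Expr.sub (.var 12) (.var 16)).work]
      refine Nat.le_sub_of_add_le ?_
      linarith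
  · rw [V.eval_eMargin, E.margin_pos_iff hΛ, not_lt] at h
    have e : (Prog.set 8 (.var 9) (.const 0)).run m = m.store 8 i 0 := by
      simp [Prog.run, Expr.eval, V.index]
    refine (Ensures.of_run (p := .set 8 (.var 9) (.const 0)) (Q := M.ArmStep i U L m)
      trivial V.bdd ?_).mono ?_ fun _ h => h
    · rw [e]
      refine ⟨V.bdd.store (bitLen_le_memBits hU (by norm_num : 0 ≤ 150) (by simp)) _ _, ?_,
        fun j hj => by simp [Mem.store, hj],
        Or.inr ⟨by simp [Mem.store], 0, by simp [Mem.store], ?_⟩⟩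
      · simp only [Mem.store, show (14 : ℕ) ≠ 8 by norm_num, false_and, if_false, sub_self,
          abs_zero]
        positivity
      · simpa [Mem.store] using armDone_zero hΛ hL h
    · have h1 : armWork ≤ armWork * (K + 1) := Nat.le_mul_of_pos_right _ (Nat.succ_pos _)
      refine Nat.le_sub_of_add_le (le_trans ?_ h1)
      unfold armWork; omega
  · have h1 : armWork ≤ armWork * (K + 1) := Nat.le_mul_of_pos_right _ (Nat.succ_pos _)
    have : 1 + Expr.eMargin.work ≤ armWork := by unfold armWork; omega
    omega

end FeedbackMAB

/-! ### The search for a balanced multiplier -/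

section SearchProgram
open Expr Prog

/-- Treats all arms. -/
def armsLoop : Prog :=
  loop (sub (var 0) (var 9)) (seq armProg (set 9 (const 0) (add (var 9) (const 1))))
/-- Moves on to the next multiplier. -/
def retryReset : Prog := seq (set 15 (const 0) (const 0)) (seq (set 13 (const 0)
  (add (var 13) (const 1))) (seq (set 14 (const 0) (const 0)) (set 9 (const 0) (const 0))))
/-- Treats all arms, with the first multiplier for which all waits are certainly optimal. -/
def retryLoop : Prog := loop (var 15) (seq retryReset armsLoop)
/-- Decreases the coarse multiplier. -/
def decrease : Prog := seq
  (set 21 (const 0) (sub (var 21) (div (var 21) (mul (const 8) (var 20)))))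
  (seq (set 13 (const 0) (sub (mul (var 21) (pow (var 10) 28)) (const 1)))
    (set 15 (const 0) (const 1)))
/-- Decreases the multiplier until it is at most the sum of the values. -/
def outerLoop : Prog := loop (sub (var 13) (var 14)) (seq decrease retryLoop)
/-- Starts with a multiplier for which no arm is profitable. -/
def outerInit : Prog := seq (set 21 (const 0) (pow (var 10) 9))
  (seq (set 13 (const 0) (mul (var 21) (pow (var 10) 28))) (set 14 (const 0) (const 0)))
/-- Writes the multiplier that was found. -/
def outerOutput : Prog := seq (set 7 (const 0) (var 13)) (set 7 (const 1) eΛ)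
/-- The search for a balanced multiplier. -/
def searchProg : Prog := seq outerInit (seq outerLoop outerOutput)

lemma writes_armProg {a : ℕ} :
    armProg.Writes a ↔ a ∈ [8, 14, 15, 16, 17, 18, 19, 23, 24] := by
  simp only [armProg, armSearch, armPrep, powersLoop, powersBody, searchInit, searchLoop,
    searchCand, searchSelect, armBound, armCertify, armStore, Prog.Writes, List.mem_cons,
    List.not_mem_nil, or_false]
  tauto

lemma writes_armsLoop {a : ℕ} :
    armsLoop.Writes a ↔ a ∈ [8, 9, 14, 15, 16, 17, 18, 19, 23, 24] := by
  simp only [armsLoop, writes_armProg, Prog.Writes, List.mem_cons, List.not_mem_nil, or_false]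
  tauto

lemma writes_retryLoop {a : ℕ} :
    retryLoop.Writes a ↔ a ∈ [8, 9, 13, 14, 15, 16, 17, 18, 19, 23, 24] := by
  simp only [retryLoop, retryReset, writes_armsLoop, Prog.Writes, List.mem_cons,
    List.not_mem_nil, or_false]
  tauto

end SearchProgram

namespace FeedbackMAB

variable {n : ℕ} {M : FeedbackMAB n} {R : Fin n → ArmCode} {U q L G : ℤ} {K : ℕ} {m : Mem}

/-- The memory holds the data of all arms and the parameters of the search. -/
structure Setup (R : Fin n → ArmCode) (U q : ℤ) (K : ℕ) (m : Mem) : Prop where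
  count : m 0 0 = n
  an : ∀ i : Fin n, m 1 i = (R i).an
  ad : ∀ i : Fin n, m 2 i = (R i).ad
  bn : ∀ i : Fin n, m 3 i = (R i).bn
  bd : ∀ i : Fin n, m 4 i = (R i).bd
  rn : ∀ i : Fin n, m 5 i = (R i).rn
  rd : ∀ i : Fin n, m 6 i = (R i).rd
  base : m 10 0 = U
  size : m 11 0 = 2 ^ K
  log : m 12 0 = K
  ratio : m 20 0 = q

lemma Setup.congr (V : Setup R U q K m) {m' : Mem} {p : Prog} (hF : Framed p m m')
    (hp : ∀ a ∈ [0, 1, 2, 3, 4, 5, 6, 10, 11, 12, 20], ¬ p.Writes a) : Setup R U q K m' := by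
  have h : ∀ a ∈ [0, 1, 2, 3, 4, 5, 6, 10, 11, 12, 20], m' a = m a := fun a ha => hF a (hp a ha)
  obtain ⟨h0, h1, h2, h3, h4, h5, h6, h7, h8, h9, h10⟩ := V
  constructor <;> (rw [h _ (by simp)]; assumption)

lemma Setup.armReady (V : Setup R U q K m) (hb : m.Bdd (memBits U)) (i : Fin n)
    (h9 : m 9 0 = (i : ℕ)) (h13 : m 13 0 = L) : ArmReady (R i) U L K i m :=
  ⟨⟨h9, V.an i, V.ad i, V.bn i, V.bd i, V.rn i, V.rd i, V.base, h13⟩, hb, V.size, V.log⟩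

/-- All waits are stored, and the sum of the values is known up to rounding. -/
def AllDone (M : FeedbackMAB n) (U L : ℤ) (m : Mem) : Prop :=
  (∀ i : Fin n, ∃ t : ℕ, m 8 i = t ∧ M.IsThreshold (L / (U ^ 36 : ℤ)) i t) ∧
    (m 14 0 : ℝ) ≤ (U ^ 36 : ℤ) * ∑ i, M.armOpt i (L / (U ^ 36 : ℤ)) ∧
    (U ^ 36 : ℤ) * ∑ i, M.armOpt i (L / (U ^ 36 : ℤ)) ≤ m 14 0 + 2 * n

/-- Some arm has two waits that are nearly optimal. -/
def Tied (M : FeedbackMAB n) (U L : ℤ) : Prop :=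
  ∃ i, M.NearTie i (2 * (U : ℝ) ^ 14) ((U : ℝ)⁻¹ ^ 46) (L / (U ^ 36 : ℤ))

@[to_additive]
lemma prod_ite_lt_succ {β : Type*} [CommMonoid β] {k : ℕ} (hk : k < n) (f : Fin n → β) :
    ∏ i : Fin n, (if (i : ℕ) < k + 1 then f i else 1) =
      (∏ i : Fin n, (if (i : ℕ) < k then f i else 1)) * f ⟨k, hk⟩ := by
  rw [show f ⟨k, hk⟩ = ∏ i : Fin n, if i = ⟨k, hk⟩ then f i else 1 by simp,
    ← Finset.prod_mul_distrib]
  refine Finset.prod_congr rfl fun i _ => ?_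
  rcases lt_trichotomy (i : ℕ) k with h | h | h
  · have : i ≠ ⟨k, hk⟩ := fun e => by rw [e] at h; simp at h
    simp [h, this, Nat.lt_succ_of_lt h]
  · obtain rfl : i = ⟨k, hk⟩ := Fin.ext h
    simp
  · have h1 : i ≠ ⟨k, hk⟩ := fun e => by rw [e] at h; simp at h
    have h2 : ¬ (i : ℕ) < k + 1 := by omega
    have h3 : ¬ (i : ℕ) < k := by omega
    simp [h1, h2, h3]

/-- The running time of `armsLoop`, up to the factor `(K + 1) * (n + 1)`. -/
def armsWork : ℕ := armWork + (Prog.set 9 (.const 0) (.add (.var 9) (.const 1))).work +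
  (Expr.sub (.var 0) (.var 9)).work + 2

/-- The running time of `searchProg`, up to a factor that depends on the sizes. -/
def searchWork : ℕ := 8 + outerInit.work + 2 * (Expr.sub (.var 13) (.var 14)).work +
  outerOutput.work + decrease.work + 2 * (Expr.var 15).work + retryReset.work + armsWork

section
variable (E : ∀ i, M.Encodes i (R i) U) (hU : 32 ≤ U) (hn : 16 * (n : ℤ) ≤ U)
include E hU hn

lemma margin_ge_of_le {j : ℕ} (hj : j ≤ n) (hL : L = G * U ^ 28 + j) (i : Fin n)
    (h : 0 < M.margin i (L / (U ^ 36 : ℤ))) :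
    (U : ℝ)⁻¹ ^ 12 ≤ M.margin i (L / (U ^ 36 : ℤ)) := by
  have hU0 : (0 : ℝ) < U := by exact_mod_cast (by linarith : (0 : ℤ) < U)
  have e : (L : ℝ) / (U ^ 36 : ℤ) = G / (U ^ 8 : ℤ) + j * (U : ℝ)⁻¹ ^ 36 := by
    rw [hL]; push_cast; field_simp
  have hjU : (j : ℝ) ≤ U := by
    have : (j : ℤ) ≤ U := by
      have : (j : ℤ) ≤ n := by exact_mod_cast hj
      linarith
    exact_mod_cast this
  refine (E i).scaled.margin_ge (lam₀ := G / (U ^ 8 : ℤ)) ?_ ?_ ((E i).margin_ge_of_coarse G) h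
  · rw [e]; exact le_add_of_nonneg_right (by positivity)
  · rw [e]
    refine add_le_add_right ?_ _
    calc (j : ℝ) * (U : ℝ)⁻¹ ^ 36 ≤ U * (U : ℝ)⁻¹ ^ 36 :=
          mul_le_mul_of_nonneg_right hjU (by positivity)
      _ = (U : ℝ)⁻¹ ^ 35 := by field_simp

variable (hK : (2 : ℤ) ^ K ≤ 2 * U ^ 14) (hK' : U ^ 14 ≤ 2 ^ K)
include hK hK'

lemma ensures_armsLoop (V : Setup R U q K m) (hb : m.Bdd (memBits U)) (hL : 0 ≤ L)
    (h13 : m 13 0 = L)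
    (hm : ∀ i, 0 < M.margin i (L / (U ^ 36 : ℤ)) →
      (U : ℝ)⁻¹ ^ 12 ≤ M.margin i (L / (U ^ 36 : ℤ)))
    (h9 : m 9 0 = 0) (h14 : m 14 0 = 0) (h15 : m 15 0 = 0) :
    Ensures (memBits U) armsLoop m (armsWork * (K + 1) * (n + 1)) fun m' =>
      m'.Bdd (memBits U) ∧
        ((m' 15 0 = 1 ∧ M.Tied U L) ∨ (m' 15 0 = 0 ∧ M.AllDone U L m')) := by
  have hU1 : 1 ≤ U := by linarith
  set f : Fin n → ℝ := fun i => M.armOpt i (L / (U ^ 36 : ℤ)) with hf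
  refine (Ensures.loop_count' (N := n) (k := 1 + armWork * (K + 1) +
      (Prog.set 9 (.const 0) (.add (.var 9) (.const 1))).work)
      (fun k m' => m'.Bdd (memBits U) ∧ m' 9 0 = k ∧ |m' 14 0| ≤ k * U ^ 38 ∧
      ((m' 15 0 = 1 ∧ M.Tied U L) ∨ (m' 15 0 = 0 ∧
        (∀ i : Fin n, (i : ℕ) < k → ∃ t : ℕ, m' 8 i = t ∧ M.IsThreshold (L / (U ^ 36 : ℤ)) i t) ∧
        (m' 14 0 : ℝ) ≤ (U ^ 36 : ℤ) * ∑ i : Fin n, (if (i : ℕ) < k then f i else 0) ∧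
        (U ^ 36 : ℤ) * ∑ i : Fin n, (if (i : ℕ) < k then f i else 0) ≤ m' 14 0 + 2 * k)))
      (fun _ _ h => h.1) (fun k m' hk hF h => ?_) (fun m' hF h => ?_) ?_).mono ?_ ?_
  · obtain ⟨hb, h9, h14, hres⟩ := h
    have hp : ∀ a ∈ [0, 1, 2, 3, 4, 5, 6, 10, 11, 12, 13, 20], ¬ (Prog.seq armProg (.set 9 (.const 0)
        (.add (.var 9) (.const 1)))).Writes a := by
      simp [writes_armProg, Prog.Writes]
    have V' := V.congr hF fun a ha => hp a (by simp at ha ⊢; tauto)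
    have h13' : m' 13 0 = L := by rw [hF 13 (hp 13 (by simp)), h13]
    have hkU : (k : ℤ) ≤ U := by
      have : (k : ℤ) < n := by exact_mod_cast hk
      linarith
    refine ⟨by simp only [Expr.eval, Int.toNat_zero, V'.count, h9]; omega, ?_⟩
    have hs : |m' 14 0| ≤ U ^ 60 := by
      calc |m' 14 0| ≤ k * U ^ 38 := h14
        _ ≤ U * U ^ 38 := mul_le_mul_of_nonneg_right hkU (by positivity)
        _ = U ^ 39 := by ring
        _ ≤ U ^ 60 := pow_le_pow_right₀ hU1 (by norm_num)
    refine Ensures.seq hb.one_le (ensures_armProg (E ⟨k, hk⟩) hK hK'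
      (V'.armReady hb ⟨k, hk⟩ h9 h13') hL (hm _) hs).frame ?_
    rintro m₁ ⟨A, hF1⟩
    have g9 : m₁ 9 0 = k := by
      rw [hF1 9 (by simp [writes_armProg]), h9]
    refine Ensures.of_run trivial A.bdd ?_
    have e : (Prog.set 9 (.const 0) (.add (.var 9) (.const 1))).run m₁ =
        m₁.store 9 0 ((k + 1 : ℕ) : ℤ) := by
      simp [Prog.run, Expr.eval, g9]
    rw [e]
    refine ⟨A.bdd.store (bitLen_le_memBits hU1 (by norm_num : 2 ≤ 150) ?_) _ _,
      by simp [Mem.store], ?_, ?_⟩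
    · rw [abs_of_nonneg (by positivity)]; push_cast; nlinarith
    · rw [Mem.store_ne (by norm_num : 14 ≠ 9)]
      push_cast
      calc |m₁ 14 0| = |m' 14 0 + (m₁ 14 0 - m' 14 0)| := by ring_nf
        _ ≤ |m' 14 0| + |m₁ 14 0 - m' 14 0| := abs_add_le _ _
        _ ≤ (k + 1) * U ^ 38 := by linarith [A.sum_le]
    · rw [Mem.store_ne (by norm_num : 14 ≠ 9), Mem.store_ne (by norm_num : 15 ≠ 9),
        Mem.store_ne (by norm_num : 8 ≠ 9)]
      rcases A.result with ⟨g15, hT⟩ | ⟨g15, t, ht, h1, h2, h3⟩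
      · exact Or.inl ⟨g15, _, hT⟩
      · change _ ≤ _ * f _ at h2
        change _ * f _ ≤ _ at h3
        rw [Int.cast_sub] at h2 h3
        rw [g15]
        rcases hres with h | ⟨h4, h5, h6, h7⟩
        · exact Or.inl h
        · refine Or.inr ⟨h4, fun i hi => ?_, ?_, ?_⟩
          · by_cases hik : (i : ℕ) = k
            · obtain rfl : i = ⟨k, hk⟩ := Fin.ext hik
              exact ⟨t, ht, h1⟩
            · obtain ⟨t', h8, h9⟩ := h5 i (by omega)
              exact ⟨t', by rw [A.waits i hik, h8], h9⟩
          · rw [sum_ite_lt_succ hk, mul_add]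
            linarith
          · rw [sum_ite_lt_succ hk, mul_add]
            push_cast at h3 h7 ⊢; linarith
  · obtain ⟨hb, h9, -⟩ := h
    have h0 : m' 0 0 = n := by
      rw [hF 0 (by simp [writes_armProg, Prog.Writes]),
        V.count]
    simp [Expr.eval, h9, h0]
  · refine ⟨hb, by simpa using h9, by simp [h14], Or.inr ⟨h15, by simp, ?_, ?_⟩⟩ <;> simp [h14]
  · have h1 : 1 + armWork * (K + 1) + (Prog.set 9 (.const 0) (.add (.var 9) (.const 1))).work +
        (Expr.sub (.var 0) (.var 9)).work + 1 ≤ armsWork * (K + 1) := by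
      have h2 := Nat.le_mul_of_pos_right ((Prog.set 9 (.const 0) (.add (.var 9) (.const 1))).work +
        (Expr.sub (.var 0) (.var 9)).work + 2) (Nat.succ_pos K)
      rw [Nat.succ_eq_add_one] at h2
      rw [armsWork]
      linarith
    have h2 := Nat.mul_le_mul_left n h1
    have h3 : (Expr.sub (.var 0) (.var 9)).work + 1 ≤ armsWork * (K + 1) :=
      le_trans (by omega) h1
    calc _ ≤ n * (armsWork * (K + 1)) + armsWork * (K + 1) := Nat.add_le_add h2 h3
      _ = _ := by ring
  · rintro m' ⟨⟨hb, -, -, h⟩, -⟩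
    refine ⟨hb, h.imp_right fun ⟨h1, h2, h3, h4⟩ => ⟨h1, fun i => h2 i i.2, ?_⟩⟩
    simpa [hf] using And.intro h3 h4

lemma ensures_retryLoop (V : Setup R U q K m) (hb : m.Bdd (memBits U)) (hG : 0 ≤ G)
    (hGU : G ≤ U ^ 9) (h13 : m 13 0 = G * U ^ 28 - 1) (h15 : m 15 0 = 1) :
    Ensures (memBits U) retryLoop m
      ((n + 2) * (1 + retryReset.work + armsWork * (K + 1) * (n + 1) + (Expr.var 15).work + 1) +
        ((Expr.var 15).work + 1))
      fun m' => m'.Bdd (memBits U) ∧ G * U ^ 28 ≤ m' 13 0 ∧ m' 13 0 ≤ G * U ^ 28 + n ∧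
        M.AllDone U (m' 13 0) m' := by
  have hU1 : 1 ≤ U := by linarith
  have hGn : 0 ≤ G * U ^ 28 := by positivity
  have hGm : G * U ^ 28 ≤ U ^ 37 := by
    calc G * U ^ 28 ≤ U ^ 9 * U ^ 28 := mul_le_mul_of_nonneg_right hGU (by positivity)
      _ = U ^ 37 := by ring
  have hμ : (G * U ^ 28 + n + 1 - m 13 0).toNat = n + 2 := by rw [h13]; omega
  have main := Ensures.loop' (B := memBits U) (p := .seq retryReset armsLoop) (e := .var 15) (m := m)
    (k := 1 + retryReset.work + armsWork * (K + 1) * (n + 1))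
    (fun m' => m'.Bdd (memBits U) ∧ ((m' 15 0 = 1 ∧ ∃ j : ℕ, j ≤ n ∧ m' 13 0 = G * U ^ 28 + j - 1 ∧
      ∀ k < j, M.Tied U (G * U ^ 28 + k)) ∨ (m' 15 0 = 0 ∧ G * U ^ 28 ≤ m' 13 0 ∧
        m' 13 0 ≤ G * U ^ 28 + n ∧ M.AllDone U (m' 13 0) m')))
    (fun m' => (G * U ^ 28 + n + 1 - m' 13 0).toNat) (fun _ h => h.1) (fun m' hF h he => ?_)
    ⟨hb, Or.inl ⟨h15, 0, by omega, by simpa using h13, by simp⟩⟩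
  · rw [hμ] at main
    refine main.mono le_rfl ?_
    rintro m' ⟨⟨hb, h⟩, he, -⟩
    rcases h with h | h
    · simp [Expr.eval, h.1] at he
    · exact ⟨hb, h.2⟩
  · obtain ⟨hb, ⟨h15, j, hj, h13, hT⟩ | h⟩ := h
    swap
    · simp [Expr.eval, h.1] at he
    have V' := V.congr hF (by simp [retryReset, writes_armsLoop, Prog.Writes])
    have e : retryReset.run m' =
        (((m'.store 15 0 0).store 13 0 (G * U ^ 28 + j)).store 14 0 0).store 9 0 0 := by
      simp [retryReset, Prog.run, Expr.eval, Mem.store, h13]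
    have hz : bitLen 0 ≤ memBits U := bitLen_le_memBits hU1 (by norm_num : 0 ≤ 150) (by simp)
    have hjn : (j : ℤ) ≤ n := by exact_mod_cast hj
    have hLb : bitLen (G * U ^ 28 + j) ≤ memBits U := by
      refine bitLen_le_memBits hU1 (by norm_num : 38 ≤ 150) ?_
      rw [abs_of_nonneg (by positivity)]
      have h1 : U ≤ U ^ 37 := le_self_pow₀ hU1 (by norm_num)
      have h2 : 2 * U ^ 37 ≤ U * U ^ 37 := mul_le_mul_of_nonneg_right (by linarith) (by positivity)
      calc G * U ^ 28 + j ≤ U * U ^ 37 := by linarith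
        _ = U ^ 38 := by ring
    refine Ensures.seq hb.one_le (Ensures.frame (Ensures.of_run (Q := fun m₁ =>
      m₁.Bdd (memBits U) ∧ m₁ 9 0 = 0 ∧ m₁ 13 0 = G * U ^ 28 + j ∧ m₁ 14 0 = 0 ∧ m₁ 15 0 = 0)
      ⟨trivial, trivial, trivial, trivial⟩ hb ?_)) ?_
    · rw [e]
      exact ⟨(((hb.store hz _ _).store hLb _ _).store hz _ _).store hz _ _, by simp [Mem.store],
        by simp [Mem.store], by simp [Mem.store], by simp [Mem.store]⟩
    rintro m₁ ⟨⟨hb1, g9, g13, g14, g15⟩, hF1⟩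
    have V1 := V'.congr hF1 (by simp [retryReset, Prog.Writes])
    refine (ensures_armsLoop E hU hn hK hK' V1 hb1 (by positivity) g13
      (margin_ge_of_le E hU hn hj rfl) g9 g14 g15).frame.mono le_rfl ?_
    rintro m₂ ⟨⟨hb2, hres⟩, hF2⟩
    have k13 : m₂ 13 0 = G * U ^ 28 + j := by
      rw [hF2 13 (by simp [writes_armsLoop]), g13]
    refine ⟨⟨hb2, ?_⟩, by omega⟩
    rcases hres with ⟨k15, hT'⟩ | ⟨k15, hD⟩
    · have hT2 : ∀ k < j + 1, M.Tied U (G * U ^ 28 + k) := fun k hk => by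
        rcases Nat.lt_succ_iff_lt_or_eq.1 hk with h | rfl
        exacts [hT k h, hT']
      refine Or.inl ⟨k15, j + 1, ?_, by rw [k13]; push_cast; ring, hT2⟩
      by_contra hc
      refine exists_not_nearTie E hU (by linarith) hG fun k hk => ?_
      exact hT2 k (by omega)
    · exact Or.inr ⟨k15, by linarith, by linarith, by rw [k13]; exact hD⟩

/-- The state between two decreases of the coarse multiplier. -/
structure OuterState (M : FeedbackMAB n) (U q G : ℤ) (m : Mem) : Prop where
  bdd : m.Bdd (memBits U)
  coarse : m 21 0 = G
  pos : 0 < G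
  le : G ≤ U ^ 9
  ge_mult : G * U ^ 28 ≤ m 13 0
  mult_le : m 13 0 ≤ G * U ^ 28 + n
  sum_le : (U ^ 36 : ℤ) * ∑ i, M.armOpt i (m 13 0 / (U ^ 36 : ℤ)) ≤ m 14 0 + 2 * n
  result : m 13 0 ≤ m 14 0 → M.IsBalanced (1 / (2 * q)) (m 13 0 / (U ^ 36 : ℤ)) ∧
    ∀ i : Fin n, ∃ t : ℕ, m 8 i = t ∧ M.IsThreshold (m 13 0 / (U ^ 36 : ℤ)) i t

lemma ensures_outerLoop (hq : 1 ≤ q) (hqU : 16 * q ≤ U) {i : Fin n}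
    (hi : 0 < (R i).rn * (R i).an) (V : Setup R U q K m) (S : M.OuterState U q G m) :
    Ensures (memBits U) outerLoop m
      (progress q G * (1 + decrease.work + ((n + 2) * (1 + retryReset.work +
        armsWork * (K + 1) * (n + 1) + (Expr.var 15).work + 1) + ((Expr.var 15).work + 1)) +
        (Expr.sub (.var 13) (.var 14)).work + 1) + ((Expr.sub (.var 13) (.var 14)).work + 1))
      fun m' => Framed outerLoop m m' ∧ m' 13 0 ≤ m' 14 0 ∧ ∃ G, M.OuterState U q G m' := by
  have hU1 : 1 ≤ U := by linarith
  have main := Ensures.loop' (B := memBits U) (p := .seq decrease retryLoop)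
    (e := .sub (.var 13) (.var 14)) (m := m)
    (k := 1 + decrease.work + ((n + 2) * (1 + retryReset.work +
        armsWork * (K + 1) * (n + 1) + (Expr.var 15).work + 1) + ((Expr.var 15).work + 1)))
    (fun m' => ∃ G, M.OuterState U q G m')
    (fun m' => progress q (m' 21 0)) (fun _ ⟨G, h⟩ => h.bdd) (fun m' hF ⟨G, S⟩ he => ?_) ⟨G, S⟩
  · rw [S.coarse] at main
    refine main.mono le_rfl ?_
    rintro m' ⟨h, he, hF⟩
    exact ⟨hF, by simpa [Expr.eval] using he, h⟩
  · have V' := V.congr hF (by simp [decrease, writes_retryLoop, Prog.Writes])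
    have hlt : m' 14 0 < m' 13 0 := by simpa [Expr.eval] using he
    have hlt' : (m' 14 0 : ℝ) < m' 13 0 := by exact_mod_cast hlt
    have hGn : 0 ≤ G * U ^ 28 := mul_nonneg S.pos.le (by positivity)
    have hL0 : 0 ≤ m' 13 0 := hGn.trans S.ge_mult
    have hG4 : U ^ 4 ≤ G := coarse_ge E hU hn hi hL0 S.mult_le (by linarith [S.sum_le])
    have hqG : 16 * q ≤ G := hqU.trans ((le_self_pow₀ hU1 (by norm_num)).trans hG4)
    set G' := G - G / (8 * q) with hG'
    obtain ⟨h1, h2⟩ := progress_lt hq hqG hG'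
    have hG'le : G' ≤ G := by
      have := Int.ediv_nonneg S.pos.le (by positivity : 0 ≤ 8 * q)
      omega
    have e : decrease.run m' = ((m'.store 21 0 G').store 13 0 (G' * U ^ 28 - 1)).store 15 0 1 := by
      simp [decrease, Prog.run, Expr.eval, Expr.eval_pow, Mem.store, S.coarse, V'.base, V'.ratio,
        hG']
    have hGm : G' * U ^ 28 ≤ U ^ 37 := by
      calc G' * U ^ 28 ≤ U ^ 9 * U ^ 28 :=
            mul_le_mul_of_nonneg_right (hG'le.trans S.le) (by positivity)
        _ = U ^ 37 := by ring
    have hGp : 0 < G' * U ^ 28 := by positivity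
    refine Ensures.seq S.bdd.one_le (Ensures.frame (Ensures.of_run (Q := fun m₁ =>
      m₁.Bdd (memBits U) ∧ m₁ 21 0 = G' ∧ m₁ 13 0 = G' * U ^ 28 - 1 ∧ m₁ 15 0 = 1)
      ⟨trivial, trivial, trivial⟩ S.bdd ?_)) ?_
    · rw [e]
      refine ⟨((S.bdd.store ?_ _ _).store ?_ _ _).store ?_ _ _, by simp [Mem.store],
        by simp [Mem.store], by simp [Mem.store]⟩
      · refine bitLen_le_memBits hU1 (by norm_num : 9 ≤ 150) ?_
        rw [abs_of_pos h1]; exact hG'le.trans S.le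
      · refine bitLen_le_memBits hU1 (by norm_num : 37 ≤ 150) ?_
        rw [abs_of_nonneg (by omega)]; omega
      · exact bitLen_le_memBits hU1 (by norm_num : 0 ≤ 150) (by simp)
    rintro m₁ ⟨⟨hb1, g21, g13, g15⟩, hF1⟩
    have V1 := V'.congr hF1 (by simp [decrease, Prog.Writes])
    refine (ensures_retryLoop E hU hn hK hK' V1 hb1 h1.le (hG'le.trans S.le) g13
      g15).frame.mono le_rfl ?_
    rintro m₂ ⟨⟨hb2, h3, h4, h5, h6, h7⟩, hF2⟩
    have k21 : m₂ 21 0 = G' := by rw [hF2 21 (by simp [writes_retryLoop]), g21]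
    refine ⟨⟨G', hb2, k21, h1, hG'le.trans S.le, h3, h4, h7, fun h8 => ⟨?_, h5⟩⟩, ?_⟩
    · refine isBalanced_of_bounds hU hn hq hqU hG4 hG' hL0 S.mult_le h3
        (by linarith [S.sum_le]) (le_trans (by exact_mod_cast h8) h6)
    · rw [k21, S.coarse]; exact h2

lemma ensures_searchProg (hq : 1 ≤ q) (hqU : 16 * q ≤ U) {i : Fin n}
    (hi : 0 < (R i).rn * (R i).an) (V : Setup R U q K m) (hb : m.Bdd (memBits U)) :
    Ensures (memBits U) searchProg m
      (searchWork * ((progress q (U ^ 9) + 1) * ((n + 2) ^ 2 * (K + 1))))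
      fun m' => 0 < m' 7 1 ∧ M.IsBalanced (1 / (2 * q)) (m' 7 0 / m' 7 1) ∧
        ∀ i : Fin n, ∃ t : ℕ, m' 8 i = t ∧ M.IsThreshold (m' 7 0 / m' 7 1) i t := by
  have hU1 : 1 ≤ U := by linarith
  have e : outerInit.run m = ((m.store 21 0 (U ^ 9)).store 13 0 (U ^ 9 * U ^ 28)).store 14 0 0 := by
    simp [outerInit, Prog.run, Expr.eval, Expr.eval_pow, Mem.store, V.base]
  have hsum : ∑ i, M.armOpt i ((U ^ 9 * U ^ 28 : ℤ) / (U ^ 36 : ℤ)) = 0 := by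
    have hU0 : (0 : ℝ) < U := by exact_mod_cast (by linarith : (0 : ℤ) < U)
    have e1 : ((U ^ 9 * U ^ 28 : ℤ) : ℝ) / (U ^ 36 : ℤ) = U := by push_cast; field_simp
    rw [e1]
    exact Finset.sum_eq_zero fun i _ => M.armOpt_of_r_le i hU0.le (E i).scaled.r_le
  have hpos : 0 < U ^ 9 * U ^ 28 := by positivity
  refine (Ensures.seq hb.one_le (Ensures.frame (Ensures.of_run (p := outerInit) (Q := fun m₁ =>
    M.OuterState U q (U ^ 9) m₁) ⟨trivial, trivial, trivial⟩ hb ?_))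
    (fun m₁ ⟨S, hF1⟩ => Ensures.seq hb.one_le (ensures_outerLoop E hU hn hK hK' hq hqU hi
      (V.congr hF1 (by simp [outerInit, Prog.Writes])) S)
      fun m₂ ⟨hF2, hle, G, S2⟩ => Ensures.of_run (p := outerOutput) ⟨trivial, trivial⟩ S2.bdd ?_)).mono ?_
    fun _ h => h
  · rw [e]
    refine ⟨((hb.store ?_ _ _).store ?_ _ _).store ?_ _ _, by simp [Mem.store], by positivity, le_rfl,
      by simp [Mem.store], by simp [Mem.store], ?_, fun h => ?_⟩
    · exact bitLen_le_memBits hU1 (by norm_num : 9 ≤ 150) (abs_of_nonneg (by positivity)).le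
    · refine bitLen_le_memBits hU1 (by norm_num : 37 ≤ 150) ?_
      rw [abs_of_pos hpos]; exact le_of_eq (by ring)
    · exact bitLen_le_memBits hU1 (by norm_num : 0 ≤ 150) (by simp)
    · have e13 : (((m.store 21 0 (U ^ 9)).store 13 0 (U ^ 9 * U ^ 28)).store 14 0 0) 13 0 =
        U ^ 9 * U ^ 28 := by simp [Mem.store]
      rw [e13, hsum]
      simp [Mem.store]
    · simp only [Mem.store] at h
      norm_num at h
      linarith
  · have V2 := (V.congr hF1 (by simp [outerInit, Prog.Writes])).congr hF2
      (by simp [outerLoop, decrease, writes_retryLoop, Prog.Writes])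
    have e2 : outerOutput.run m₂ = (m₂.store 7 0 (m₂ 13 0)).store 7 1 (U ^ 36) := by
      simp [outerOutput, Prog.run, Expr.eval, Expr.eΛ, Expr.eval_pow, Mem.store, V2.base]
    have e70 : ((m₂.store 7 0 (m₂ 13 0)).store 7 1 (U ^ 36)) 7 0 = m₂ 13 0 := by simp [Mem.store]
    have e71 : ((m₂.store 7 0 (m₂ 13 0)).store 7 1 (U ^ 36)) 7 1 = U ^ 36 := by simp [Mem.store]
    rw [e2, e70, e71, Mem.store_ne (by norm_num : 8 ≠ 7), Mem.store_ne (by norm_num : 8 ≠ 7)]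
    exact ⟨by positivity, S2.result hle⟩
  · set w := progress q (U ^ 9)
    set X := (n + 2) ^ 2 * (K + 1) with hX
    have hX1 : 1 ≤ X := Nat.mul_pos (by positivity) (Nat.succ_pos K)
    have h1 : (n + 2) * (1 + retryReset.work + armsWork * (K + 1) * (n + 1) +
        (Expr.var 15).work + 1) ≤ (2 + retryReset.work + armsWork + (Expr.var 15).work) * X := by
      have h2 : (n + 2) * 1 ≤ X := by
        rw [hX]; calc (n + 2) * 1 ≤ (n + 2) * ((n + 2) * (K + 1)) :=
              Nat.mul_le_mul_left _ (Nat.mul_pos (by omega) (Nat.succ_pos K))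
          _ = _ := by ring
      have h3 : (n + 2) * ((K + 1) * (n + 1)) ≤ X := by
        rw [hX]; calc (n + 2) * ((K + 1) * (n + 1)) ≤ (n + 2) * ((K + 1) * (n + 2)) :=
              Nat.mul_le_mul_left _ (Nat.mul_le_mul_left _ (by omega))
          _ = _ := by ring
      calc _ = (2 + retryReset.work + (Expr.var 15).work) * ((n + 2) * 1) +
            armsWork * ((n + 2) * ((K + 1) * (n + 1))) := by ring
        _ ≤ (2 + retryReset.work + (Expr.var 15).work) * X + armsWork * X := by gcongr
        _ = _ := by ring
    have h4 : w ≤ (w + 1) * X := le_trans (by omega) (Nat.le_mul_of_pos_right _ hX1)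
    have h5 : 1 ≤ (w + 1) * X := Nat.mul_pos (Nat.succ_pos w) hX1
    have h6 : w * X ≤ (w + 1) * X := Nat.mul_le_mul_right _ (Nat.le_succ w)
    calc _ ≤ 1 + outerInit.work + (1 + (w * (1 + decrease.work + ((2 + retryReset.work + armsWork +
          (Expr.var 15).work) * X + ((Expr.var 15).work + 1)) +
          (Expr.sub (.var 13) (.var 14)).work + 1) + ((Expr.sub (.var 13) (.var 14)).work + 1)) +
          outerOutput.work) := by gcongr
      _ = (3 + outerInit.work + (Expr.sub (.var 13) (.var 14)).work + outerOutput.work) * 1 +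
          (3 + decrease.work + (Expr.var 15).work + (Expr.sub (.var 13) (.var 14)).work) * w +
          (2 + retryReset.work + armsWork + (Expr.var 15).work) * (w * X) := by ring
      _ ≤ (3 + outerInit.work + (Expr.sub (.var 13) (.var 14)).work + outerOutput.work) *
            ((w + 1) * X) +
          (3 + decrease.work + (Expr.var 15).work + (Expr.sub (.var 13) (.var 14)).work) *
            ((w + 1) * X) +
          (2 + retryReset.work + armsWork + (Expr.var 15).work) * ((w + 1) * X) := by gcongr
      _ = searchWork * ((w + 1) * X) := by rw [searchWork]; ring

end

end FeedbackMAB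

/-! ### The program that computes the policy -/

section MainProgram
open Expr Prog

/-- The factor of the base that belongs to the present arm. -/
def eFactor : Expr := mul (mul (mul (add (get 1 (var 9)) (const 1)) (get 2 (var 9)))
  (mul (add (get 3 (var 9)) (const 1)) (get 4 (var 9))))
  (mul (add (get 5 (var 9)) (const 1)) (get 6 (var 9)))
/-- Computes `⌈1 / ε⌉` and the first factor of the base. -/
def prepInit : Prog := seq (set 20 (const 0) (div (sub (add (get 0 (const 2)) (get 0 (const 1)))
  (const 1)) (get 0 (const 1)))) (seq (set 10 (const 0) (mul (mul (mul (const 16) (add (add (var 0)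
    (var 20)) (const 1))) (get 0 (const 1))) (get 0 (const 2)))) (set 11 (const 0) (const 1)))
/-- Computes the base. -/
def scanBody : Prog := seq (set 10 (const 0) (mul (var 10) eFactor))
  (seq (set 22 (const 0) (add (var 22) (mul (get 5 (var 9)) (get 1 (var 9)))))
    (set 9 (const 0) (add (var 9) (const 1))))
/-- Computes the base. -/
def scanLoop : Prog := loop (sub (var 0) (var 9)) scanBody
/-- Doubles the power of two. -/
def sizeBody : Prog := seq (set 11 (const 0) (mul (const 2) (var 11)))
  (set 12 (const 0) (add (var 12) (const 1)))
/-- Computes a power of two that bounds the waits. -/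
def sizeLoop : Prog := loop (sub (pow (var 10) 14) (var 11)) sizeBody
/-- The preparation of the search. -/
def prepProg : Prog := seq prepInit (seq scanLoop sizeLoop)
/-- Computes a balanced multiplier and the waits. -/
def mainProg : Prog := seq prepProg (ite (var 22) searchProg (set 7 (const 1) (const 1)))

end MainProgram

/-- A bound for the numbers that describe the arm. -/
def ArmCode.factor (R : ArmCode) : ℤ :=
  (R.an + 1) * R.ad * ((R.bn + 1) * R.bd) * ((R.rn + 1) * R.rd)

/-- Numerators are nonnegative and denominators are positive. -/
structure ArmCode.Valid (R : ArmCode) : Prop where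
  an : 0 ≤ R.an
  ad : 1 ≤ R.ad
  bn : 0 ≤ R.bn
  bd : 1 ≤ R.bd
  rn : 0 ≤ R.rn
  rd : 1 ≤ R.rd

namespace ArmCode

variable {R : ArmCode}

lemma Valid.le_factor (V : R.Valid) {a b c d e f : ℤ} (ha' : a ≤ R.an + 1)
    (hb : 0 ≤ b) (hb' : b ≤ R.ad) (hc : 0 ≤ c) (hc' : c ≤ R.bn + 1) (hd : 0 ≤ d) (hd' : d ≤ R.bd)
    (he : 0 ≤ e) (he' : e ≤ R.rn + 1) (hf : 0 ≤ f) (hf' : f ≤ R.rd) :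
    a * b * (c * d) * (e * f) ≤ R.factor := by
  have := V.an; have := V.ad; have := V.bn; have := V.bd; have := V.rn; have := V.rd
  have h1 : a * b ≤ (R.an + 1) * R.ad := mul_le_mul ha' hb' hb (by linarith)
  have h2 : c * d ≤ (R.bn + 1) * R.bd := mul_le_mul hc' hd' hd (by linarith)
  have h3 : e * f ≤ (R.rn + 1) * R.rd := mul_le_mul he' hf' hf (by linarith)
  have h4 : 0 ≤ (R.an + 1) * R.ad := mul_nonneg (by linarith) (by linarith)
  have h5 : 0 ≤ (R.bn + 1) * R.bd := mul_nonneg (by linarith) (by linarith)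
  exact mul_le_mul (mul_le_mul h1 h2 (mul_nonneg hc hd) h4) h3 (mul_nonneg he hf)
    (mul_nonneg h4 h5)

variable (V : R.Valid)
include V

lemma Valid.factor_pos : 0 < R.factor := by
  have h1 := V.an; have h2 := V.ad; have h3 := V.bn; have h4 := V.bd; have h5 := V.rn
  have h6 := V.rd
  have := V.le_factor (a := 1) (b := 1) (c := 1) (d := 1) (e := 1) (f := 1)
  simp only [mul_one] at this
  have := this (by linarith) (by norm_num) h2 (by norm_num) (by linarith)
    (by norm_num) h4 (by norm_num) (by linarith) (by norm_num) h6
  linarith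

lemma Valid.bounds : R.D ≤ R.factor ∧ R.an ≤ R.factor ∧
    R.ad ≤ R.factor ∧ R.bn ≤ R.factor ∧ R.bd ≤ R.factor ∧ R.rn ≤ R.factor ∧ R.rd ≤ R.factor ∧
    R.rn * R.an ≤ R.factor := by
  have h1 := V.an; have h2 := V.ad; have h3 := V.bn; have h4 := V.bd; have h5 := V.rn
  have h6 := V.rd
  refine ⟨?_, ?_, ?_, ?_, ?_, ?_, ?_, ?_⟩
  · have := V.le_factor (a := 1) (b := R.ad) (c := 1) (d := R.bd) (e := 1) (f := 1)
    simp only [mul_one, one_mul] at this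
    apply this <;> linarith
  · have := V.le_factor (a := R.an) (b := 1) (c := 1) (d := 1) (e := 1) (f := 1)
    simp only [mul_one] at this
    apply this <;> linarith
  · have := V.le_factor (a := 1) (b := R.ad) (c := 1) (d := 1) (e := 1) (f := 1)
    simp only [mul_one, one_mul] at this
    apply this <;> linarith
  · have := V.le_factor (a := 1) (b := 1) (c := R.bn) (d := 1) (e := 1) (f := 1)
    simp only [mul_one, one_mul] at this
    apply this <;> linarith
  · have := V.le_factor (a := 1) (b := 1) (c := 1) (d := R.bd) (e := 1) (f := 1)
    simp only [mul_one, one_mul] at this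
    apply this <;> linarith
  · have := V.le_factor (a := 1) (b := 1) (c := 1) (d := 1) (e := R.rn) (f := 1)
    simp only [mul_one, one_mul] at this
    apply this <;> linarith
  · have := V.le_factor (a := 1) (b := 1) (c := 1) (d := 1) (e := 1) (f := R.rd)
    simp only [mul_one, one_mul] at this
    apply this <;> linarith
  · have := V.le_factor (a := R.an) (b := 1) (c := 1) (d := 1) (e := R.rn) (f := 1)
    simp only [mul_one] at this
    rw [mul_comm]; apply this <;> linarith

end ArmCode

namespace FeedbackMAB

variable {n : ℕ} {M : FeedbackMAB n} {R : Fin n → ArmCode} {a b q U : ℤ} {m : Mem}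

/-- The memory holds the arms `R` and the fraction `a / b`, and zeros otherwise. -/
structure Input (R : Fin n → ArmCode) (a b : ℤ) (m : Mem) : Prop where
  count : m 0 0 = n
  num : m 0 1 = a
  den : m 0 2 = b
  an : ∀ i : Fin n, m 1 i = (R i).an
  ad : ∀ i : Fin n, m 2 i = (R i).ad
  bn : ∀ i : Fin n, m 3 i = (R i).bn
  bd : ∀ i : Fin n, m 4 i = (R i).bd
  rn : ∀ i : Fin n, m 5 i = (R i).rn
  rd : ∀ i : Fin n, m 6 i = (R i).rd
  zero : ∀ k, 7 ≤ k → m k = 0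

lemma Input.congr (V : Input R a b m) {m' : Mem} {p : Prog} (hF : Framed p m m')
    (hp : ∀ k ∈ [0, 1, 2, 3, 4, 5, 6], ¬ p.Writes k) : m' 0 0 = n ∧
      ∀ i : Fin n, m' 1 i = (R i).an ∧ m' 2 i = (R i).ad ∧ m' 3 i = (R i).bn ∧
        m' 4 i = (R i).bd ∧ m' 5 i = (R i).rn ∧ m' 6 i = (R i).rd := by
  have h : ∀ k ∈ [0, 1, 2, 3, 4, 5, 6], m' k = m k := fun k hk => hF k (hp k hk)
  simp only [List.forall_mem_cons] at h
  obtain ⟨h0, h1, h2, h3, h4, h5, h6, -⟩ := h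
  rw [h0, h1, h2, h3, h4, h5, h6]
  exact ⟨V.count, fun i => ⟨V.an i, V.ad i, V.bn i, V.bd i, V.rn i, V.rd i⟩⟩

/-- The base of the search. -/
def baseOf (R : Fin n → ArmCode) (a b q : ℤ) : ℤ :=
  16 * (n + q + 1) * a * b * ∏ i, (R i).factor

lemma prod_ite_lt_le {f : Fin n → ℤ} (hf : ∀ i, 1 ≤ f i) (k : ℕ) :
    ∏ i : Fin n, (if (i : ℕ) < k then f i else 1) ≤ ∏ i, f i := by
  refine Finset.prod_le_prod (fun i _ => ?_) fun i _ => ?_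
  · split_ifs
    exacts [by linarith [hf i], by norm_num]
  · split_ifs
    exacts [le_rfl, hf i]

section
variable (hR : ∀ i, (R i).Valid) (ha : 1 ≤ a) (hb : 1 ≤ b) (hq : 1 ≤ q) (hU : U = baseOf R a b q)
include hR ha hb hq hU

lemma le_baseOf : 16 * (n + q + 1) ≤ U ∧ a ≤ U ∧ b ≤ U ∧ ∀ i, (R i).factor ≤ U := by
  have hp : 0 < ∏ i, (R i).factor := Finset.prod_pos fun i _ => (hR i).factor_pos
  have hpos : 0 < U := by rw [hU, baseOf]; positivity
  refine ⟨Int.le_of_dvd hpos ?_, Int.le_of_dvd hpos ?_, Int.le_of_dvd hpos ?_,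
    fun i => Int.le_of_dvd hpos ?_⟩
  · exact ⟨a * b * ∏ i, (R i).factor, by rw [hU, baseOf]; ring⟩
  · exact ⟨16 * (n + q + 1) * b * ∏ i, (R i).factor, by rw [hU, baseOf]; ring⟩
  · exact ⟨16 * (n + q + 1) * a * ∏ i, (R i).factor, by rw [hU, baseOf]; ring⟩
  · rw [hU, baseOf]
    exact Dvd.dvd.mul_left (Finset.dvd_prod_of_mem _ (Finset.mem_univ i)) _

lemma ensures_prepProg (hqd : q = (b + a - 1) / a) (I : Input R a b m)
    (hm : m.Bdd (memBits U)) {K : ℕ} (hK : K = Nat.clog 2 (U ^ 14).toNat) :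
    Ensures (memBits U) prepProg m (1 + prepInit.work + (1 + (n * (scanBody.work +
      (Expr.sub (.var 0) (.var 9)).work + 1) + ((Expr.sub (.var 0) (.var 9)).work + 1)) +
      (K * (sizeBody.work + (Expr.sub (.pow (.var 10) 14) (.var 11)).work + 1) +
        ((Expr.sub (.pow (.var 10) 14) (.var 11)).work + 1)))) fun m' =>
      m'.Bdd (memBits U) ∧ Setup R U q K m' ∧ m' 22 0 = ∑ i, (R i).rn * (R i).an ∧
        m' 7 = 0 ∧ m' 8 = 0 := by
  obtain ⟨hU16, haU, hbU, hfU⟩ := le_baseOf hR ha hb hq hU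
  have hn0 : (0 : ℤ) ≤ n := Int.natCast_nonneg n
  have hU1 : 1 ≤ U := by linarith
  have hz : ∀ z : ℤ, |z| ≤ 1 → bitLen z ≤ memBits U := fun z hz =>
    bitLen_le_memBits hU1 (by norm_num : 0 ≤ 150) (by simpa using hz)
  set U₀ := 16 * (n + q + 1) * a * b with hU₀
  have hU₀0 : 0 < U₀ := by positivity
  have hUe : U = U₀ * ∏ i, (R i).factor := hU
  have hf1 : ∀ i, 1 ≤ (R i).factor := fun i => (hR i).factor_pos
  have hpart : ∀ k : ℕ, U₀ * ∏ i : Fin n, (if (i : ℕ) < k then (R i).factor else 1) ≤ U ∧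
      0 ≤ U₀ * ∏ i : Fin n, (if (i : ℕ) < k then (R i).factor else 1) := fun k => by
    refine ⟨?_, mul_nonneg hU₀0.le (Finset.prod_nonneg fun i _ => ?_)⟩
    · rw [hUe]; exact mul_le_mul_of_nonneg_left (prod_ite_lt_le hf1 k) hU₀0.le
    · split_ifs
      exacts [(hR i).factor_pos.le, by norm_num]
  have hpart2 : ∀ k : ℕ,
      |∑ i : Fin n, (if (i : ℕ) < k then (R i).rn * (R i).an else 0)| ≤ U ^ 2 := fun k => by
    rw [abs_of_nonneg (Finset.sum_nonneg fun i _ => by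
      split_ifs
      exacts [mul_nonneg (hR i).rn (hR i).an, le_rfl])]
    calc _ ≤ ∑ i : Fin n, U := Finset.sum_le_sum fun i _ => by
          split_ifs
          exacts [(hR i).bounds.2.2.2.2.2.2.2.trans (hfU i), by linarith]
      _ = n * U := by simp
      _ ≤ U * U := mul_le_mul_of_nonneg_right (by linarith) (by linarith)
      _ = U ^ 2 := by ring
  refine Ensures.seq hm.one_le (Ensures.frame (Ensures.of_run (p := prepInit) (Q := fun m₁ =>
    m₁.Bdd (memBits U) ∧ m₁ 20 0 = q ∧ m₁ 10 0 = U₀ ∧ m₁ 11 0 = 1) ⟨trivial, trivial, trivial⟩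
    hm ?_)) ?_
  · have e : prepInit.run m = ((m.store 20 0 q).store 10 0 U₀).store 11 0 1 := by
      simp [prepInit, Prog.run, Expr.eval, Mem.store, I.count, I.num, I.den, ← hqd, hU₀]
    rw [e]
    refine ⟨((hm.store ?_ _ _).store ?_ _ _).store (hz 1 (by norm_num)) _ _, by simp [Mem.store],
      by simp [Mem.store], by simp [Mem.store]⟩
    · refine bitLen_le_memBits hU1 (by norm_num : 1 ≤ 150) ?_
      rw [abs_of_nonneg (by linarith), pow_one]; linarith
    · refine bitLen_le_memBits hU1 (by norm_num : 1 ≤ 150) ?_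
      rw [abs_of_pos hU₀0, pow_one]
      simpa using (hpart 0).1
  rintro m₁ ⟨⟨hb1, g20, g10, g11⟩, hF1⟩
  have hF1' : ∀ k, 7 ≤ k → k ≠ 20 → k ≠ 10 → k ≠ 11 → m₁ k = 0 := fun k hk h1 h2 h3 => by
    rw [hF1 k (by simp [prepInit, Prog.Writes, h1, h2, h3]), I.zero k hk]
  refine Ensures.seq hm.one_le (Ensures.loop_count' (p := scanBody) (N := n) (k := scanBody.work)
    (fun k m' => m'.Bdd (memBits U) ∧ m' 9 0 = k ∧
      m' 10 0 = U₀ * ∏ i : Fin n, (if (i : ℕ) < k then (R i).factor else 1) ∧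
      m' 22 0 = ∑ i : Fin n, (if (i : ℕ) < k then (R i).rn * (R i).an else 0))
    (fun _ _ h => h.1) (fun k m' hk hF h => ?_) (fun m' hF h => ?_) ?_) ?_
  · obtain ⟨hb, h9, h10, h22⟩ := h
    obtain ⟨h0, hA⟩ := I.congr (p := .seq prepInit scanBody) (m' := m') (fun a ha =>
      (hF a fun h => ha (Or.inr h)).trans (hF1 a fun h => ha (Or.inl h)))
      (by simp [prepInit, scanBody, Prog.Writes])
    obtain ⟨a1, a2, a3, a4, a5, a6⟩ := hA ⟨k, hk⟩
    simp only at a1 a2 a3 a4 a5 a6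
    refine ⟨by simp only [Expr.eval, Int.toNat_zero, h0, h9]; omega,
      Ensures.of_run ⟨trivial, trivial, trivial⟩ hb ?_⟩
    have e : scanBody.run m' = ((m'.store 10 0
        (U₀ * ∏ i : Fin n, (if (i : ℕ) < k + 1 then (R i).factor else 1))).store 22 0
        (∑ i : Fin n, (if (i : ℕ) < k + 1 then (R i).rn * (R i).an else 0))).store 9 0
        ((k + 1 : ℕ) : ℤ) := by
      rw [prod_ite_lt_succ hk, sum_ite_lt_succ hk, ← mul_assoc, ← h10, ← h22]
      simp [scanBody, eFactor, Prog.run, Expr.eval, Mem.store, h9, a1, a2, a3, a4, a5, a6,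
        ArmCode.factor]
    rw [e]
    refine ⟨((hb.store ?_ _ _).store ?_ _ _).store ?_ _ _, by simp [Mem.store],
      by simp [Mem.store], by simp [Mem.store]⟩
    · refine bitLen_le_memBits hU1 (by norm_num : 1 ≤ 150) ?_
      rw [abs_of_nonneg (hpart _).2, pow_one]; exact (hpart _).1
    · exact bitLen_le_memBits hU1 (by norm_num : 2 ≤ 150) (hpart2 _)
    · refine bitLen_le_memBits hU1 (by norm_num : 1 ≤ 150) ?_
      rw [abs_of_nonneg (by positivity), pow_one]
      have : ((k + 1 : ℕ) : ℤ) ≤ n := by exact_mod_cast hk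
      linarith
  · obtain ⟨hb, h9, -⟩ := h
    obtain ⟨h0, -⟩ := I.congr (p := .seq prepInit scanBody) (m' := m') (fun a ha =>
      (hF a fun h => ha (Or.inr h)).trans (hF1 a fun h => ha (Or.inl h)))
      (by simp [prepInit, scanBody, Prog.Writes])
    simp [Expr.eval, h9, h0]
  · refine ⟨hb1, ?_, by simpa using g10, ?_⟩
    · rw [hF1' 9 (by norm_num) (by norm_num) (by norm_num) (by norm_num)]; rfl
    · rw [hF1' 22 (by norm_num) (by norm_num) (by norm_num) (by norm_num)]; simp
  rintro m₂ ⟨⟨hb2, -, k10, k22⟩, hF2⟩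
  simp only [Fin.is_lt, if_true] at k10 k22
  rw [← hUe] at k10
  have hx : ((U ^ 14).toNat : ℤ) = U ^ 14 := Int.toNat_of_nonneg (by positivity)
  have hKlt : ∀ k < K, (2 : ℤ) ^ k < U ^ 14 := fun k hk => by
    have : 2 ^ k < (U ^ 14).toNat := (Nat.lt_clog_iff_pow_lt (by norm_num)).1 (hK ▸ hk)
    rw [← hx]; exact_mod_cast this
  have hKle : U ^ 14 ≤ 2 ^ K := by
    have : (U ^ 14).toNat ≤ 2 ^ K := hK ▸ Nat.le_pow_clog (by norm_num) _
    rw [← hx]; exact_mod_cast this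
  refine (Ensures.loop_count' (p := sizeBody) (N := K) (k := sizeBody.work)
    (fun k m' => m'.Bdd (memBits U) ∧ m' 11 0 = 2 ^ k ∧ m' 12 0 = k)
    (fun _ _ h => h.1) (fun k m' hk hF h => ?_) (fun m' hF h => ?_) ⟨hb2, ?_, ?_⟩).mono le_rfl ?_
  · obtain ⟨hb, h11, h12⟩ := h
    have h10 : m' 10 0 = U := by rw [hF 10 (by simp [sizeBody, Prog.Writes]), k10]
    refine ⟨?_, Ensures.of_run ⟨trivial, trivial⟩ hb ?_⟩
    · simp only [Expr.eval, Expr.eval_pow, Int.toNat_zero, h10, h11]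
      linarith [hKlt k hk]
    · have e : sizeBody.run m' =
          (m'.store 11 0 (2 ^ (k + 1))).store 12 0 ((k + 1 : ℕ) : ℤ) := by
        simp [sizeBody, Prog.run, Expr.eval, Mem.store, h11, h12, pow_succ']
      have h1 : (2 : ℤ) ^ (k + 1) ≤ U ^ 15 := by
        have h2 : 2 * U ^ 14 ≤ U * U ^ 14 :=
          mul_le_mul_of_nonneg_right (by linarith) (by positivity)
        have h3 := hKlt k hk
        have h4 : U ^ 15 = U * U ^ 14 := by ring
        rw [pow_succ, h4]; linarith
      have h2 : ((k + 1 : ℕ) : ℤ) < 2 ^ (k + 1) := by exact_mod_cast Nat.lt_two_pow_self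
      rw [e]
      refine ⟨(hb.store ?_ _ _).store ?_ _ _, by simp [Mem.store], by simp [Mem.store]⟩
      · refine bitLen_le_memBits hU1 (by norm_num : 15 ≤ 150) ?_
        rwa [abs_of_nonneg (by positivity)]
      · refine bitLen_le_memBits hU1 (by norm_num : 15 ≤ 150) ?_
        rw [abs_of_nonneg (by positivity)]; linarith
  · obtain ⟨hb, h11, h12⟩ := h
    have h10 : m' 10 0 = U := by rw [hF 10 (by simp [sizeBody, Prog.Writes]), k10]
    simp only [Expr.eval, Expr.eval_pow, Int.toNat_zero, h10, h11]
    linarith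
  · rw [hF2 11 (by simp [scanBody, Prog.Writes]), g11]; simp
  · rw [hF2 12 (by simp [scanBody, Prog.Writes]), hF1' 12 (by norm_num) (by norm_num)
      (by norm_num) (by norm_num)]; simp
  · rintro m₃ ⟨⟨hb3, l11, l12⟩, hF3⟩
    have hFF : Framed prepProg m m₃ := fun a ha =>
      (hF3 a fun h => ha (Or.inr (Or.inr h))).trans ((hF2 a fun h => ha (Or.inr (Or.inl h))).trans
        (hF1 a fun h => ha (Or.inl h)))
    obtain ⟨h0, hA⟩ := I.congr hFF (by
      simp [prepProg, prepInit, scanLoop, scanBody, sizeLoop, sizeBody, Prog.Writes])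
    refine ⟨hb3, ⟨h0, fun i => (hA i).1, fun i => (hA i).2.1, fun i => (hA i).2.2.1,
      fun i => (hA i).2.2.2.1, fun i => (hA i).2.2.2.2.1, fun i => (hA i).2.2.2.2.2,
      ?_, l11, l12, ?_⟩, ?_, ?_, ?_⟩
    · rw [hF3 10 (by simp [sizeBody, Prog.Writes]), k10]
    · rw [hF3 20 (by simp [sizeBody, Prog.Writes]), hF2 20 (by simp [scanBody, Prog.Writes]), g20]
    · rw [hF3 22 (by simp [sizeBody, Prog.Writes]), k22]
    · rw [hFF 7 (by simp [prepProg, prepInit, scanLoop, scanBody, sizeLoop, sizeBody,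
        Prog.Writes]), I.zero 7 le_rfl]
    · rw [hFF 8 (by simp [prepProg, prepInit, scanLoop, scanBody, sizeLoop, sizeBody,
        Prog.Writes]), I.zero 8 (by norm_num)]

end

end FeedbackMAB

/-! ### The running time of the whole computation -/

lemma bitLen_pow_le (x : ℤ) (k : ℕ) : bitLen (x ^ k) ≤ k * bitLen x + 2 := by
  induction k with
  | zero => simp [bitLen]
  | succ k ih =>
    rw [pow_succ, add_mul, one_mul]
    have := bitLen_mul_le (x ^ k) x
    omega

lemma bitLen_le_natAbs_succ (x : ℤ) : bitLen x ≤ x.natAbs + 1 :=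
  Nat.add_le_add_right (Nat.size_le.2 Nat.lt_two_pow_self) 1

lemma bitLen_prod_le {ι : Type*} (s : Finset ι) (f : ι → ℤ) :
    bitLen (∏ i ∈ s, f i) ≤ 2 + ∑ i ∈ s, bitLen (f i) := by
  classical
  induction s using Finset.induction_on with
  | empty => simp [bitLen]
  | insert i s hi ih =>
    rw [Finset.prod_insert hi, Finset.sum_insert hi]
    have := bitLen_mul_le (f i) (∏ i ∈ s, f i)
    omega

lemma ArmCode.bitLen_factor_le (R : ArmCode) : bitLen R.factor ≤ bitLen R.an + bitLen R.ad +
    bitLen R.bn + bitLen R.bd + bitLen R.rn + bitLen R.rd + 6 := by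
  have h1 : ∀ z : ℤ, bitLen (z + 1) ≤ bitLen z + 2 := fun z => by
    simpa [bitLen] using bitLen_add_le z 1
  have := bitLen_mul_le ((R.an + 1) * R.ad * ((R.bn + 1) * R.bd)) ((R.rn + 1) * R.rd)
  have := bitLen_mul_le ((R.an + 1) * R.ad) ((R.bn + 1) * R.bd)
  have := bitLen_mul_le (R.an + 1) R.ad
  have := bitLen_mul_le (R.bn + 1) R.bd
  have := bitLen_mul_le (R.rn + 1) R.rd
  have := h1 R.an
  have := h1 R.bn
  have := h1 R.rn
  unfold ArmCode.factor
  omega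

namespace FeedbackMAB

lemma two_pow_clog_le {x : ℕ} (hx : 1 < x) : 2 ^ Nat.clog 2 x ≤ 2 * x := by
  have h1 : 0 < Nat.clog 2 x := Nat.clog_pos (by norm_num) hx
  obtain ⟨k, hk⟩ : ∃ k, Nat.clog 2 x = k + 1 := ⟨Nat.clog 2 x - 1, by omega⟩
  have h2 : 2 ^ k < x := (Nat.lt_clog_iff_pow_lt (by norm_num)).1 (by omega)
  rw [hk, pow_succ']
  omega

lemma exists_ensures_mainProg : ∃ w : ℕ, ∀ (n : ℕ) (M : FeedbackMAB n) (R : Fin n → ArmCode)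
    (a b q U : ℤ) (m : Mem), (∀ i, (R i).Valid) → (∀ i, M.α i * (R i).ad = (R i).an) →
    (∀ i, M.β i * (R i).bd = (R i).bn) → (∀ i, M.r i * (R i).rd = (R i).rn) → 1 ≤ a → 1 ≤ b →
    1 ≤ q → U = baseOf R a b q → q = (b + a - 1) / a → Input R a b m → m.Bdd (memBits U) →
    Ensures (memBits U) mainProg m
      (w * ((progress q (U ^ 9) + 1) * ((n + 2) ^ 2 * (Nat.clog 2 (U ^ 14).toNat + 1))))
      fun m' => 0 < m' 7 1 ∧ M.IsBalanced (1 / (2 * q)) (m' 7 0 / m' 7 1) ∧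
        ∀ i : Fin n, ∃ t : ℕ, m' 8 i = t ∧ M.IsThreshold (m' 7 0 / m' 7 1) i t := by
  refine ⟨8 + prepInit.work + scanBody.work + 2 * (Expr.sub (.var 0) (.var 9)).work +
    sizeBody.work + 2 * (Expr.sub (.pow (.var 10) 14) (.var 11)).work + (Expr.var 22).work +
    searchWork + (Prog.set 7 (.const 1) (.const 1)).work,
    fun n M R a b q U m hR hα hβ hr ha hb hq hU hqd I hm => ?_⟩
  obtain ⟨hU16, haU, hbU, hfU⟩ := le_baseOf hR ha hb hq hU
  have hn0 : (0 : ℤ) ≤ n := Int.natCast_nonneg n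
  have hU32 : 32 ≤ U := by linarith
  have hn : 16 * (n : ℤ) ≤ U := by linarith
  have hx : ((U ^ 14).toNat : ℤ) = U ^ 14 := Int.toNat_of_nonneg (by positivity)
  have hx1 : 1 < (U ^ 14).toNat := by
    have : (1 : ℤ) < U ^ 14 := one_lt_pow₀ (by linarith) (by norm_num)
    omega
  have hprep := ensures_prepProg hR ha hb hq hU hqd I hm rfl
  set K := Nat.clog 2 (U ^ 14).toNat with hK
  have hK1 : (2 : ℤ) ^ K ≤ 2 * U ^ 14 := by
    rw [← hx]; exact_mod_cast two_pow_clog_le hx1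
  have hK2 : U ^ 14 ≤ 2 ^ K := by
    rw [← hx]; exact_mod_cast Nat.le_pow_clog (by norm_num) _
  set X := (progress q (U ^ 9) + 1) * ((n + 2) ^ 2 * (K + 1)) with hX
  have E : ∀ i, M.Encodes i (R i) U := fun i => by
    obtain ⟨h1, -, -, -, -, h2, h3, -⟩ := (hR i).bounds
    exact ⟨hU32, hα i, hβ i, hr i, (hR i).ad, (hR i).bd, (hR i).rd, h1.trans (hfU i),
      h2.trans (hfU i), h3.trans (hfU i)⟩
  refine (Ensures.seq hm.one_le hprep (k' := 1 + (Expr.var 22).work + (searchWork * X +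
    (Prog.set 7 (.const 1) (.const 1)).work)) fun m₁ ⟨hb1, V, h22, h7, h8⟩ =>
      Ensures.ite hb1 (fun h => ?_) (fun h => ?_)).mono ?_ fun _ h => h
  · replace h : 0 < ∑ i, (R i).rn * (R i).an := by simpa [Expr.eval, h22] using h
    obtain ⟨i, -, hi⟩ := Finset.exists_lt_of_sum_lt
      (by simpa using h : ∑ i : Fin n, (0 : ℤ) < ∑ i, (R i).rn * (R i).an)
    exact (ensures_searchProg E hU32 hn hK1 hK2 hq (by linarith) hi V hb1).mono
      (Nat.le_add_right _ _) fun _ h => h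
  · replace h : ∑ i, (R i).rn * (R i).an ≤ 0 := by simpa [Expr.eval, h22] using h
    have h0 : ∀ i, (R i).rn * (R i).an = 0 := fun i => by
      refine le_antisymm ?_ (mul_nonneg (hR i).rn (hR i).an)
      exact (Finset.single_le_sum (fun j _ => mul_nonneg (hR j).rn (hR j).an)
        (Finset.mem_univ i)).trans h
    have hopt : ∀ i, M.armOpt i 0 = 0 := fun i => by
      refine M.armOpt_eq_zero_of_margin_nonpos i le_rfl ?_
      have h1 : (M.r i * M.α i) * ((R i).rd * (R i).ad) = 0 := by
        have h2 : ((R i).rn : ℝ) * (R i).an = 0 := by exact_mod_cast h0 i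
        rw [← hα i, ← hr i] at h2
        linarith
      have h3 : ((R i).rd : ℝ) * (R i).ad ≠ 0 := by
        have h4 : 0 < (R i).rd * (R i).ad := mul_pos (hR i).rd (hR i).ad
        exact_mod_cast h4.ne'
      have h5 : M.r i * M.α i = 0 := (mul_eq_zero.1 h1).resolve_right h3
      unfold margin
      simp [h5]
    refine (Ensures.of_run (p := .set 7 (.const 1) (.const 1)) trivial hb1 ?_).mono
      (Nat.le_add_left _ _) fun _ h => h
    have e : (Prog.set 7 (.const 1) (.const 1)).run m₁ = m₁.store 7 1 1 := by
      simp [Prog.run, Expr.eval]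
    rw [e, Mem.store_same, Mem.store_same, h7]
    simp only [Pi.zero_apply, if_true, if_neg (by norm_num : (0 : ℕ) ≠ 1), Int.cast_zero, zero_div]
    refine ⟨by norm_num, ⟨le_rfl, by simp [hopt], by simp [hopt]⟩,
      fun i => ⟨0, by simp [Mem.store_ne, h8], Or.inr ⟨hopt i, rfl⟩⟩⟩
  · have h1 : 1 ≤ X := Nat.mul_pos (Nat.succ_pos _) (Nat.mul_pos (by positivity) (Nat.succ_pos K))
    have h2 : (n + 2) ^ 2 * (K + 1) ≤ X := Nat.le_mul_of_pos_left _ (Nat.succ_pos _)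
    have h3 : n ≤ X := by
      refine le_trans ?_ h2
      calc n ≤ (n + 2) ^ 2 := by nlinarith
        _ ≤ _ := Nat.le_mul_of_pos_right _ (Nat.succ_pos K)
    have h4 : K ≤ X := by
      refine le_trans ?_ h2
      exact (Nat.le_succ K).trans (Nat.le_mul_of_pos_left _ (by positivity))
    calc _ ≤ (6 + prepInit.work + (Expr.sub (.var 0) (.var 9)).work +
          (Expr.sub (.pow (.var 10) 14) (.var 11)).work + (Expr.var 22).work +
          (Prog.set 7 (.const 1) (.const 1)).work) * 1 +
          n * (scanBody.work + (Expr.sub (.var 0) (.var 9)).work + 1) +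
          K * (sizeBody.work + (Expr.sub (.pow (.var 10) 14) (.var 11)).work + 1) +
          searchWork * X := le_of_eq (by ring)
      _ ≤ (6 + prepInit.work + (Expr.sub (.var 0) (.var 9)).work +
          (Expr.sub (.pow (.var 10) 14) (.var 11)).work + (Expr.var 22).work +
          (Prog.set 7 (.const 1) (.const 1)).work) * X +
          X * (scanBody.work + (Expr.sub (.var 0) (.var 9)).work + 1) +
          X * (sizeBody.work + (Expr.sub (.pow (.var 10) 14) (.var 11)).work + 1) +
          searchWork * X := by gcongr
      _ ≤ _ := by
        have := Nat.zero_le X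
        linarith

end FeedbackMAB

/-- The integers that encode an arm with rational parameters. -/
def ArmCode.ofRat (α β r : ℚ) : ArmCode := ⟨α.num, α.den, β.num, β.den, r.num, r.den⟩

lemma ArmCode.valid_ofRat {α β r : ℚ} (hα : 0 ≤ α) (hβ : 0 ≤ β) (hr : 0 ≤ r) :
    (ArmCode.ofRat α β r).Valid where
  an := Rat.num_nonneg.2 hα
  ad := Int.natCast_pos.2 α.den_pos
  bn := Rat.num_nonneg.2 hβ
  bd := Int.natCast_pos.2 β.den_pos
  rn := Rat.num_nonneg.2 hr
  rd := Int.natCast_pos.2 r.den_pos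

lemma input_instanceMem {n : ℕ} (α β r : Fin n → ℚ) (ε : ℚ) :
    FeedbackMAB.Input (fun i => ArmCode.ofRat (α i) (β i) (r i)) ε.num ε.den
      (instanceMem α β r ε) where
  count := rfl
  num := rfl
  den := rfl
  an i := toArray_apply (fun i => (α i).num) i
  ad i := toArray_apply (fun i => ((α i).den : ℤ)) i
  bn i := toArray_apply (fun i => (β i).num) i
  bd i := toArray_apply (fun i => ((β i).den : ℤ)) i
  rn i := toArray_apply (fun i => (r i).num) i
  rd i := toArray_apply (fun i => ((r i).den : ℤ)) i
  zero k hk := by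
    obtain ⟨j, rfl⟩ : ∃ j, k = j + 7 := ⟨k - 7, by omega⟩
    rfl

lemma bdd_instanceMem {n : ℕ} {α β r : Fin n → ℚ} {ε : ℚ} {B : ℕ} (hB : 1 ≤ B)
    (hn : bitLen n ≤ B) (hε : bitLen ε.num ≤ B) (hε' : bitLen ε.den ≤ B)
    (h : ∀ i, bitLen (α i).num ≤ B ∧ bitLen (α i).den ≤ B ∧ bitLen (β i).num ≤ B ∧
      bitLen (β i).den ≤ B ∧ bitLen (r i).num ≤ B ∧ bitLen (r i).den ≤ B) :
    (instanceMem α β r ε).Bdd B := by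
  intro k j
  match k with
  | 0 =>
    refine bitLen_toArray_le hB (fun i => ?_) j
    fin_cases i
    exacts [hn, hε, hε']
  | 1 => exact bitLen_toArray_le hB (fun i => (h i).1) j
  | 2 => exact bitLen_toArray_le hB (fun i => (h i).2.1) j
  | 3 => exact bitLen_toArray_le hB (fun i => (h i).2.2.1) j
  | 4 => exact bitLen_toArray_le hB (fun i => (h i).2.2.2.1) j
  | 5 => exact bitLen_toArray_le hB (fun i => (h i).2.2.2.2.1) j
  | 6 => exact bitLen_toArray_le hB (fun i => (h i).2.2.2.2.2) j
  | k + 7 => exact hB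

lemma ceil_div_bounds {a b q : ℤ} (ha : 1 ≤ a) (hb : 1 ≤ b) (hq : q = (b + a - 1) / a) :
    1 ≤ q ∧ b ≤ q * a ∧ (q - 1) * a < b := by
  have h1 := Int.ediv_mul_le (b + a - 1) (by linarith : a ≠ 0)
  have h2 := Int.lt_ediv_add_one_mul_self (b + a - 1) (by linarith : 0 < a)
  rw [← hq] at h1 h2
  have h3 : b ≤ q * a := by linarith
  refine ⟨?_, h3, by linarith⟩
  by_contra h
  have : q * a ≤ 0 := mul_nonpos_of_nonpos_of_nonneg (by linarith) (by linarith)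
  linarith

lemma card_le_instanceLen {n : ℕ} (α β r : Fin n → ℚ) (ε : ℚ) : n ≤ instanceLen α β r ε := by
  have h : ∑ _i : Fin n, 1 ≤ ∑ i, (ratLen (α i) + ratLen (β i) + ratLen (r i)) :=
    Finset.sum_le_sum fun i _ => by
      have := one_le_bitLen (α i).num
      unfold ratLen; omega
  simp only [Finset.sum_const, Finset.card_univ, Fintype.card_fin, smul_eq_mul, mul_one] at h
  unfold instanceLen; omega

lemma bitLen_baseOf_le {n : ℕ} (α β r : Fin n → ℚ) (ε : ℚ) {q : ℤ} {ℓ : ℕ}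
    (hℓ : instanceLen α β r ε + q.natAbs ≤ ℓ) :
    bitLen (FeedbackMAB.baseOf (fun i => ArmCode.ofRat (α i) (β i) (r i)) ε.num ε.den q) ≤
      20 * (ℓ + 1) := by
  have h1 := bitLen_prod_le Finset.univ fun i => (ArmCode.ofRat (α i) (β i) (r i)).factor
  have h2 : ∑ i, bitLen (ArmCode.ofRat (α i) (β i) (r i)).factor ≤
      2 * ∑ i, (ratLen (α i) + ratLen (β i) + ratLen (r i)) := by
    rw [Finset.mul_sum]
    refine Finset.sum_le_sum fun i _ => ?_
    have h3 := (ArmCode.ofRat (α i) (β i) (r i)).bitLen_factor_le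
    simp only [ArmCode.ofRat] at h3 ⊢
    have := one_le_bitLen (α i).num
    have := one_le_bitLen (α i).den
    have := one_le_bitLen (β i).num
    have := one_le_bitLen (β i).den
    have := one_le_bitLen (r i).num
    have := one_le_bitLen (r i).den
    unfold ratLen; omega
  have h3 := bitLen_mul_le (16 * (n + q + 1) * ε.num * ε.den)
    (∏ i, (ArmCode.ofRat (α i) (β i) (r i)).factor)
  have h4 := bitLen_mul_le (16 * (n + q + 1) * ε.num) ε.den
  have h5 := bitLen_mul_le (16 * (n + q + 1)) ε.num
  have h6 := bitLen_mul_le 16 (n + q + 1)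
  have h7 := bitLen_add_le (n + q) 1
  have h8 := bitLen_add_le n q
  have h9 := bitLen_le_natAbs_succ q
  have h10 : bitLen 16 = 6 := by decide
  have h11 : bitLen 1 = 2 := by decide
  unfold instanceLen ratLen at hℓ
  unfold FeedbackMAB.baseOf
  beta_reduce
  unfold ratLen at h2
  omega

theorem exists_balanceProg : ∃ (P : Prog) (p : Polynomial ℕ), ∀ (n : ℕ) (M : FeedbackMAB n)
    (α β r : Fin n → ℚ) (ε : ℚ), (∀ i, M.α i = α i ∧ M.β i = β i ∧ M.r i = r i) → 0 < ε →
    ∃ (c : ℕ) (m : Mem), Exec P (instanceMem α β r ε) c m ∧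
      c ≤ p.eval (instanceLen α β r ε + ⌈1 / ε⌉₊) ∧
      0 < m 7 1 ∧ M.IsBalanced ((ε : ℝ) / 2) ((m 7 0 : ℝ) / (m 7 1 : ℝ)) ∧
      ∀ i : Fin n, ∃ t : ℕ, m 8 (i : ℕ) = (t : ℤ) ∧
        M.IsThreshold ((m 7 0 : ℝ) / (m 7 1 : ℝ)) i t := by
  obtain ⟨w, hw⟩ := FeedbackMAB.exists_ensures_mainProg
  refine ⟨mainProg, Polynomial.C (w * 10 ^ 15) * (Polynomial.X + 1) ^ 7,
    fun n M α β r ε h hε => ?_⟩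
  have ha : 1 ≤ ε.num := Rat.num_pos.2 hε
  have hb : (1 : ℤ) ≤ ε.den := by exact_mod_cast ε.den_pos
  set q : ℤ := (ε.den + ε.num - 1) / ε.num with hqd
  obtain ⟨hq1, hq2, hq3⟩ := ceil_div_bounds ha hb hqd
  set R : Fin n → ArmCode := fun i => ArmCode.ofRat (α i) (β i) (r i) with hR
  have hV : ∀ i, (R i).Valid := fun i => by
    obtain ⟨h1, h2, h3⟩ := h i
    refine ArmCode.valid_ofRat ?_ ?_ ?_
    · exact_mod_cast h1 ▸ M.α_nonneg i
    · exact_mod_cast h2 ▸ M.β_nonneg i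
    · exact_mod_cast h3 ▸ M.r_nonneg i
  have hcast : ∀ x : ℚ, (x : ℝ) * ((x.den : ℤ) : ℝ) = x.num := fun x => by
    exact_mod_cast Rat.mul_den_eq_num x
  set U := FeedbackMAB.baseOf R ε.num ε.den q with hU
  obtain ⟨hU16, haU, hbU, hfU⟩ := FeedbackMAB.le_baseOf hV ha hb hq1 hU
  have hU1 : 1 ≤ U := hb.trans hbU
  have hle : ∀ z : ℤ, 0 ≤ z → z ≤ U → bitLen z ≤ memBits U := fun z h0 h1 =>
    bitLen_le_memBits hU1 (by norm_num : 1 ≤ 150) (by rwa [abs_of_nonneg h0, pow_one])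
  have hbdd : (instanceMem α β r ε).Bdd (memBits U) := by
    refine bdd_instanceMem (one_le_bitLen _) (hle _ (by positivity) (by linarith))
      (hle _ (by linarith) haU) (hle _ (by linarith) hbU) fun i => ?_
    obtain ⟨-, h1, h2, h3, h4, h5, h6, -⟩ := (hV i).bounds
    have hv := hV i
    exact ⟨hle _ hv.an (h1.trans (hfU i)), hle _ (by linarith [hv.ad]) (h2.trans (hfU i)),
      hle _ hv.bn (h3.trans (hfU i)), hle _ (by linarith [hv.bd]) (h4.trans (hfU i)),
      hle _ hv.rn (h5.trans (hfU i)), hle _ (by linarith [hv.rd]) (h6.trans (hfU i))⟩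
  obtain ⟨c, m, h1, h2, h3, h4, h5⟩ := hw n M R ε.num ε.den q U _ hV
    (fun i => by rw [(h i).1]; exact hcast _) (fun i => by rw [(h i).2.1]; exact hcast _)
    (fun i => by rw [(h i).2.2]; exact hcast _) ha hb hq1 hU hqd (input_instanceMem α β r ε) hbdd
  refine ⟨c, m, h1, ?_, h3, ?_, h5⟩
  · have hq' : q.natAbs ≤ ⌈1 / ε⌉₊ := by
      have e1 : 1 / ε = (ε.den : ℚ) / ε.num := by
        rw [one_div]; nth_rw 1 [← Rat.num_div_den ε]; rw [inv_div]
      have ha' : (0 : ℚ) < ε.num := by exact_mod_cast ha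
      have e2 : ((q - 1 : ℤ) : ℚ) < ⌈1 / ε⌉₊ := by
        refine lt_of_lt_of_le ?_ (Nat.le_ceil _)
        rw [e1, lt_div_iff₀ ha']
        exact_mod_cast hq3
      have e3 : q - 1 < (⌈1 / ε⌉₊ : ℤ) := by exact_mod_cast e2
      omega
    set ℓ := instanceLen α β r ε + ⌈1 / ε⌉₊ with hℓ
    have hn : n ≤ ℓ := (card_le_instanceLen α β r ε).trans (Nat.le_add_right _ _)
    have hb : bitLen U ≤ 20 * (ℓ + 1) :=
      bitLen_baseOf_le α β r ε (Nat.add_le_add_left hq' _)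
    have hp : progress q (U ^ 9) + 1 ≤ 2881 * (ℓ + 1) ^ 2 := by
      have e1 := progress_pow_le hq1 hU1 9
      have e2 : q.toNat ≤ ℓ := by omega
      have e3 : 16 * q.toNat * (9 * bitLen U) ≤ 16 * ℓ * (9 * (20 * (ℓ + 1))) :=
        Nat.mul_le_mul (Nat.mul_le_mul_left _ e2) (Nat.mul_le_mul_left _ hb)
      linarith [sq_nonneg ℓ, Nat.zero_le ℓ]
    have hK : Nat.clog 2 (U ^ 14).toNat + 1 ≤ 281 * (ℓ + 1) := by
      have e1 : (U ^ 14).toNat ≤ 2 ^ (14 * bitLen U) := by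
        have e2 := (natAbs_lt_two_pow_bitLen U).le.trans
          (Nat.pow_le_pow_right (by norm_num) (Nat.sub_le (bitLen U) 1))
        have e3 : (U ^ 14).toNat = U.natAbs ^ 14 := by
          rw [← Int.natAbs_pow]
          have : 0 ≤ U ^ 14 := by positivity
          omega
        rw [e3, mul_comm, pow_mul]
        exact Nat.pow_le_pow_left e2 14
      have := Nat.clog_le_of_le_pow e1
      omega
    have hB : memBits U ≤ 3002 * (ℓ + 1) := by
      have := bitLen_pow_le U 150
      unfold memBits; omega
    have hn2 : (n + 2) ^ 2 ≤ 4 * (ℓ + 1) ^ 2 := by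
      calc (n + 2) ^ 2 ≤ (2 * (ℓ + 1)) ^ 2 := Nat.pow_le_pow_left (by omega) 2
        _ = _ := by ring
    calc c ≤ _ := h2
      _ ≤ w * (2881 * (ℓ + 1) ^ 2 * (4 * (ℓ + 1) ^ 2 * (281 * (ℓ + 1)))) *
          (3002 * (ℓ + 1)) ^ 2 := by gcongr
      _ = w * 29183067880976 * (ℓ + 1) ^ 7 := by ring
      _ ≤ w * 10 ^ 15 * (ℓ + 1) ^ 7 := by gcongr; norm_num
      _ = _ := by simp
  · refine h4.mono (by positivity) ?_
    have hq0 : (0 : ℝ) < q := by exact_mod_cast hq1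
    have e1 : (1 : ℝ) ≤ q * ε := by
      have e2 := hcast ε
      have e3 : (0 : ℝ) < ((ε.den : ℤ) : ℝ) := by exact_mod_cast hb
      have e4 : (((ε.den : ℤ)) : ℝ) ≤ q * ε.num := by exact_mod_cast hq2
      rw [← e2] at e4
      by_contra hc
      have := mul_lt_mul_of_pos_right (not_le.1 hc) e3
      linarith
    rw [div_le_div_iff₀ (by positivity) (by norm_num)]
    linarith

end

theorem mainTheorem1 :
    -- suitable multipliers and thresholds exist, and with all of them the policy exists and is a
    -- `(2 + ε)`-approximation
    (∀ (n : ℕ) (M : FeedbackMAB n) (ε : ℝ), 0 < ε →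
      (∃ (lam : ℝ) (t : Fin n → ℕ), M.IsBalanced (ε / 2) lam ∧ ∀ i, M.IsThreshold lam i (t i)) ∧
      ∀ (lam : ℝ) (t : Fin n → ℕ), M.IsBalanced (ε / 2) lam → (∀ i, M.IsThreshold lam i (t i)) →
        ∀ σ : Info n, σ.IsInitial →
          (∃ π : Policy n, M.IsBalancedIndex lam t σ π) ∧
          ∀ π : Policy n, M.IsBalancedIndex lam t σ π →
            ∀ π' : Policy n, M.upperReward σ π' ≤ (2 + ε) * M.lowerReward σ π) ∧
    -- the multiplier, the set of arms that are played, and the thresholds are computed in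
    -- polynomial time
    (∃ (P : Prog) (p : Polynomial ℕ), ∀ (n : ℕ) (M : FeedbackMAB n) (α β r : Fin n → ℚ) (ε : ℚ),
      (∀ i, M.α i = α i ∧ M.β i = β i ∧ M.r i = r i) → 0 < ε →
      ∃ (c : ℕ) (m : Mem), Exec P (instanceMem α β r ε) c m ∧
        c ≤ p.eval (instanceLen α β r ε + ⌈1 / ε⌉₊) ∧
        0 < m 7 1 ∧ M.IsBalanced ((ε : ℝ) / 2) ((m 7 0 : ℝ) / (m 7 1 : ℝ)) ∧
        ∀ i : Fin n, ∃ t : ℕ, m 8 (i : ℕ) = (t : ℤ) ∧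
          M.IsThreshold ((m 7 0 : ℝ) / (m 7 1 : ℝ)) i t) ∧
    -- each step of the policy is executed in polynomial time
    (∃ (P : Prog) (p : Polynomial ℕ), ∀ (n : ℕ) (t : Fin n → ℕ) (x : Info n),
      ∃ (c : ℕ) (m : Mem) (a : Option (Fin n)), Exec P (stepMem t x) c m ∧
        c ≤ p.eval (stepLen t x) ∧ m 4 0 = actionCode a ∧ IndexRule {i | t i ≠ 0} t x a) := by
  refine ⟨fun n M ε hε => ⟨?_, fun lam t hb ht σ hσ => ⟨M.exists_isBalancedIndex lam t σ,
    fun π hπ π' => M.upperReward_le_mul_lowerReward hε hb ht hσ hπ π'⟩⟩,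
    exists_balanceProg, exists_stepProg⟩
  obtain ⟨lam, hlam⟩ := M.exists_isBalanced (half_pos hε)
  choose t ht using fun i => M.exists_isThreshold hlam.1 i
  exact ⟨lam, t, hlam, ht⟩
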